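/- For an integer $n\ge 1$ put $$p_m(n)=\begin{cases}+\infty & n\le 30,\\[2pt] \dfrac{5n+30-\sqrt{15n^2-60n+190}}{5n-30-\sqrt{15n^2-60n+190}} & n\ge 31,\end{cases}\qquad p_c(n)=\begin{cases}+\infty & n\le 14,\\[2pt] \dfrac{n+4-2d(n)}{n-8-2d(n)} & n\ge 15,\end{cases}$$ where $d(n)=\frac16\big(9n^2+96-\frac{1536+1152n^2}{d_0(n)}-\frac32 d_0(n)\big)^{1/2}$, $d_0(n)=-\big(d_1(n)+36\sqrt{d_2(n)}\big)^{1/3}$ (real cube root), $$d_1(n)=-94976+20736n+103104n^2-10368n^3-3024n^4+1296n^5-108n^6,$$ $$\begin{aligned}d_2(n)={}&6131712-3039232n-16644096n^2+4818944n^3+6915840n^4-1936384n^5-690432n^6\\&+251136n^7-30864n^8-4320n^9+1800n^{10}-216n^{11}+9n^{12}.\end{aligned}$$ Let $p>1$, $k=\frac6{p-1}$, $u\in C^6(\mathbb R^n)$, $x\in\mathbb R^n$, $\lambda>0$. Write $B_\lambda=B_\lambda(x)$, $r=|y-x|$, $\partial_r f(y)=\nabla f(y)\cdot\frac{y-x}{|y-x|}$,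 and $u^\lambda(\theta)=\lambda^{k}u(x+\lambda\theta)$ for $|\theta|=1$. Put $$\begin{aligned} P_1&=ku+\lambda\partial_ru,\\ P_2&=k(k-1)u+2k\lambda\partial_ru+\lambda^2\partial_{rr}u,\\ P_3&=k(k-1)(k-2)u+3k(k-1)\lambda\partial_ru+3k\lambda^2\partial_{rr}u+\lambda^3\partial_{rrr}u,\\ P_4&=k(k-1)(k-2)(k-3)u+4k(k-1)(k-2)\lambda\partial_ru+6k(k-1)\lambda^2\partial_{rr}u+4k\lambda^3\partial_{rrr}u+\lambda^4\partial_{rrrr}u, \end{aligned}$$ $$\begin{aligned} \delta_1&=2(n-1)-4k,\qquad \delta_2=6k(1+k)-6(n-1)k+(n-1)(n-3),\\ \delta_4&=(1+k)(2+k)(3+k)k-2(n-1)(1+k)(2+k)k+(n-1)(n-3)(2+k)k,\qquad \beta=k(4+k-n), \end{aligned}$$ and, for functions $g$ on $\partial B_\lambda$, $\langle g\rangle_\lambda=\lambda^{6\frac{p+1}{p-1}-n-5}\int_{\partial B_\lambda}g$. Let $$\mathcal A(\lambda)=\big\langle(\lambda^2\Delta u-\lambda^2\partial_{rr}u-(n-1)\lambda\partial_ru)^2\big\rangle_\lambda,\quad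 \mathcal G(\lambda)=\big\langle\lambda^2|\nabla u|^2-\lambda^2|\partial_ru|^2\big\rangle_\lambda,\quad \mathcal H(\lambda)=\big\langle|\nabla P_1|^2-|\partial_rP_1|^2\big\rangle_\lambda$$ (that is, $\mathcal A=\int_{\partial B_1}(\Delta_\theta u^\lambda)^2$, $\mathcal G=\int_{\partial B_1}|\nabla_\theta u^\lambda|^2$, $\mathcal H=\int_{\partial B_1}|\nabla_\theta\frac{du^\lambda}{d\lambda}|^2$). Define $$\begin{aligned} E(\lambda,x,u)={}&\lambda^{6\frac{p+1}{p-1}-n}\Big(\int_{B_\lambda}\tfrac12|\nabla\Delta u|^2-\tfrac1{p+1}\int_{B_\lambda}|u|^{p+1}\Big)-\langle P_4P_1\rangle_\lambda+2\langle P_3P_2\rangle_\lambda-(\delta_1-6)\langle P_3P_1\rangle_\lambda\\ &+\tfrac{k+2}2\langle\lambda^4(\Delta u)^2\rangle_\lambda-(24-6\delta_1+\delta_2)\langle P_2P_1\rangle_\lambda-(9\delta_1-3\delta_2-36)\langle P_1^2\rangle_\lambda+(\delta_1-8)\langle P_2^2\rangle_\lambda\\ &+\delta_4\langle P_1u\rangle_\lambda+2\delta_4\langle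 u^2\rangle_\lambda+2\mathcal A+\tfrac12\lambda\mathcal A'-4(\beta-n+4)\mathcal G-(\beta-n+4)\lambda\mathcal G'-6\lambda^2\mathcal H+\lambda^3\mathcal H', \end{aligned}$$ and, for real constants $c=(c_{ij})_{0\le i,j\le2}$, $$E^c(\lambda,x,u)=E(\lambda,x,u)-\int_{\partial B_1(0)}\sum_{0\le i,j\le2}c_{ij}\lambda^{i+j}\frac{d^iu^\lambda}{d\lambda^i}\frac{d^ju^\lambda}{d\lambda^j}.$$ **Theorem.** Let $n\ge7$ and $\frac{n+6}{n-6}<p<p_m(n)$. There are constants $c_{ij}\in\mathbb R$ $(0\le i,j\le2)$ and $C>0$, depending only on $n$ and $p$, such that for every classical solution $u\in C^6(\mathbb R^n)$ of $(-\Delta)^3u=|u|^{p-1}u$ in $\mathbb R^n$ and every $x\in\mathbb R^n$, the function $\lambda\mapsto E^c(\lambda,x,u)$ is nondecreasing and differentiable on $(0,\infty)$, and $$\frac{dE^c(\lambda,x,u)}{d\lambda}\ \ge\ C\,\lambda^{6\frac{p+1}{p-1}-6-n}\int_{\partial B_\lambda(x)}\Big(\frac6{p-1}u+\lambda\partial_ru\Big)^2\qquad(\lambda>0).$$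 Moreover $p_c(n)<p_m(n)$ for every $n\ge15$ (for $n\le14$ both are $+\infty$). -/

import Mathlib

open MeasureTheory Laplacian

noncomputable section

namespace Triharmonic

/-! ### The exponents -/

/-- The exponent `p_m(n)`. -/
def pM (n : ℕ) : EReal :=
  if n ≤ 30 then ⊤
  else (((5 * n + 30 - √(15 * n ^ 2 - 60 * n + 190)) /
    (5 * n - 30 - √(15 * n ^ 2 - 60 * n + 190)) : ℝ) : EReal)

/-- The real cube root, also for negative arguments. -/
def cbrt (y : ℝ) : ℝ := SignType.sign y * |y| ^ (1 / 3 : ℝ)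

def d₁ (n : ℝ) : ℝ :=
  -94976 + 20736 * n + 103104 * n ^ 2 - 10368 * n ^ 3 + 1296 * n ^ 5 - 3024 * n ^ 4 - 108 * n ^ 6

def d₂ (n : ℝ) : ℝ :=
  6131712 - 16644096 * n ^ 2 + 6915840 * n ^ 4 - 690432 * n ^ 6 - 3039232 * n
    + 4818944 * n ^ 3 - 1936384 * n ^ 5 + 251136 * n ^ 7 - 30864 * n ^ 8 - 4320 * n ^ 9
    + 1800 * n ^ 10 - 216 * n ^ 11 + 9 * n ^ 12

def d₀ (n : ℝ) : ℝ := -cbrt (d₁ n + 36 * √(d₂ n))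

def d (n : ℝ) : ℝ :=
  1 / 6 * √(9 * n ^ 2 + 96 - (1536 + 1152 * n ^ 2) / d₀ n - 3 / 2 * d₀ n)

/-- The Joseph-Lundgren exponent `p_c(n)`. -/
def pC (n : ℕ) : EReal :=
  if n ≤ 14 then ⊤ else (((n + 4 - 2 * d n) / (n - 8 - 2 * d n) : ℝ) : EReal)

/-! ### The equation -/

/-- `u` is a classical solution of `(-Δ)³ u = |u|^(p-1) u` in `ℝⁿ`. -/
def IsSolution (n : ℕ) (p : ℝ) (u : EuclideanSpace ℝ (Fin n) → ℝ) : Prop :=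
  ContDiff ℝ 6 u ∧ ∀ y, -(Δ (Δ (Δ u))) y = |u y| ^ (p - 1) * u y

/-! ### Radial derivatives and surface integrals -/

/-- The radial derivative `∂_r f (y) = ∇f(y) · (y - x) / |y - x|` with respect to the centre `x`. -/
def radialDeriv {n : ℕ} (x : EuclideanSpace ℝ (Fin n)) (f : EuclideanSpace ℝ (Fin n) → ℝ) :
    EuclideanSpace ℝ (Fin n) → ℝ :=
  fun y => fderiv ℝ f y (‖y - x‖⁻¹ • (y - x))

/-- `∫_{∂B_t(x)} g`, with respect to the surface measure; `volume.toSphere` is the surface measure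
of the unit sphere. -/
def surfaceIntegral {n : ℕ} (x : EuclideanSpace ℝ (Fin n)) (t : ℝ)
    (g : EuclideanSpace ℝ (Fin n) → ℝ) : ℝ :=
  t ^ (n - 1) * ∫ θ : Metric.sphere (0 : EuclideanSpace ℝ (Fin n)) 1, g (x + t • (θ : _))
    ∂((volume : Measure (EuclideanSpace ℝ (Fin n))).toSphere)

/-! ### The energy

Throughout `k = 6 / (p - 1)`, `x` is the centre and `t > 0` the radius. -/

def kExp (p : ℝ) : ℝ := 6 / (p - 1)

/-- The rescaled function `u^t (θ) = t^k u (x + t θ)`. -/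
def rescaled {n : ℕ} (p : ℝ) (x : EuclideanSpace ℝ (Fin n)) (u : EuclideanSpace ℝ (Fin n) → ℝ)
    (t : ℝ) (θ : EuclideanSpace ℝ (Fin n)) : ℝ :=
  t ^ kExp p * u (x + t • θ)

/-- `δ₁, δ₂, δ₄`: the coefficients of `t³ d³/dt³`, `t² d²/dt²` and `1` in the expression of
`∂_rrrr + 2(n-1) ∂_rrr + (n-1)(n-3) ∂_rr - (n-1)(n-3) ∂_r`, applied to `u^t` on the unit sphere,
through `t`-derivatives of `u^t`. -/
def δ₁ (n : ℕ) (p : ℝ) : ℝ := 2 * (n - 1) - 4 * kExp p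

def δ₂ (n : ℕ) (p : ℝ) : ℝ :=
  6 * kExp p * (1 + kExp p) - 6 * (n - 1) * kExp p + (n - 1) * (n - 3)

def δ₄ (n : ℕ) (p : ℝ) : ℝ :=
  (1 + kExp p) * (2 + kExp p) * (3 + kExp p) * kExp p
    - 2 * (n - 1) * (1 + kExp p) * (2 + kExp p) * kExp p
    + (n - 1) * (n - 3) * (2 + kExp p) * kExp p

def β (n : ℕ) (p : ℝ) : ℝ := kExp p * (4 + kExp p - n)

section

variable {n : ℕ} (p : ℝ) (x : EuclideanSpace ℝ (Fin n)) (u : EuclideanSpace ℝ (Fin n) → ℝ) (t : ℝ)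

/-- On `∂B_t(x)`, the function `jetᵢ` is `t^(-k)` times `tⁱ dⁱu^t/dtⁱ`, written with radial
derivatives of `u`. -/
def jet₁ (y : EuclideanSpace ℝ (Fin n)) : ℝ :=
  kExp p * u y + t * radialDeriv x u y

def jet₂ (y : EuclideanSpace ℝ (Fin n)) : ℝ :=
  kExp p * (kExp p - 1) * u y + 2 * kExp p * t * radialDeriv x u y
    + t ^ 2 * (radialDeriv x)^[2] u y

def jet₃ (y : EuclideanSpace ℝ (Fin n)) : ℝ :=
  kExp p * (kExp p - 1) * (kExp p - 2) * u y
    + 3 * kExp p * (kExp p - 1) * t * radialDeriv x u y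
    + 3 * kExp p * t ^ 2 * (radialDeriv x)^[2] u y
    + t ^ 3 * (radialDeriv x)^[3] u y

def jet₄ (y : EuclideanSpace ℝ (Fin n)) : ℝ :=
  kExp p * (kExp p - 1) * (kExp p - 2) * (kExp p - 3) * u y
    + 4 * kExp p * (kExp p - 1) * (kExp p - 2) * t * radialDeriv x u y
    + 6 * kExp p * (kExp p - 1) * t ^ 2 * (radialDeriv x)^[2] u y
    + 4 * kExp p * t ^ 3 * (radialDeriv x)^[3] u y
    + t ^ 4 * (radialDeriv x)^[4] u y

/-- `∫_{∂B_t(x)} t^(6(p+1)/(p-1) - n - 5) g`. -/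
def boundary (g : EuclideanSpace ℝ (Fin n) → ℝ) : ℝ :=
  t ^ (6 * (p + 1) / (p - 1) - n - 5) * surfaceIntegral x t g

/-- `∫_{∂B₁} (Δ_θ u^t)²`, scaled back to `∂B_t(x)`. -/
def angularLaplacianEnergy : ℝ :=
  boundary p x t fun y =>
    (t ^ 2 * (Δ u) y - t ^ 2 * (radialDeriv x)^[2] u y - (n - 1) * t * radialDeriv x u y) ^ 2

/-- `∫_{∂B₁} |∇_θ u^t|²`, scaled back to `∂B_t(x)`. -/
def angularGradientEnergy : ℝ :=
  boundary p x t fun y => t ^ 2 * ‖gradient u y‖ ^ 2 - t ^ 2 * (radialDeriv x u y) ^ 2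

/-- `∫_{∂B₁} |∇_θ (du^t/dt)|²`, scaled back to `∂B_t(x)`. -/
def angularGradientEnergy' : ℝ :=
  boundary p x t fun y =>
    ‖gradient (jet₁ p x u t) y‖ ^ 2 - (radialDeriv x (jet₁ p x u t) y) ^ 2

/-- The energy `E(t, x, u)`. -/
def energy : ℝ :=
  t ^ (6 * (p + 1) / (p - 1) - n) *
      ((∫ y in Metric.ball x t, 1 / 2 * ‖gradient (Δ u) y‖ ^ 2)
        - 1 / (p + 1) * ∫ y in Metric.ball x t, |u y| ^ (p + 1))
    - boundary p x t (fun y => jet₄ p x u t y * jet₁ p x u t y)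
    + 2 * boundary p x t (fun y => jet₃ p x u t y * jet₂ p x u t y)
    - (δ₁ n p - 6) * boundary p x t (fun y => jet₃ p x u t y * jet₁ p x u t y)
    + (kExp p + 2) / 2 * boundary p x t (fun y => t ^ 4 * (Δ u) y ^ 2)
    - (24 - 6 * δ₁ n p + δ₂ n p) * boundary p x t (fun y => jet₂ p x u t y * jet₁ p x u t y)
    - (9 * δ₁ n p - 3 * δ₂ n p - 36) * boundary p x t (fun y => jet₁ p x u t y ^ 2)
    + (δ₁ n p - 8) * boundary p x t (fun y => jet₂ p x u t y ^ 2)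
    + δ₄ n p * boundary p x t (fun y => jet₁ p x u t y * u y)
    + 2 * δ₄ n p * boundary p x t (fun y => u y ^ 2)
    + 2 * angularLaplacianEnergy p x u t
    + 1 / 2 * t * deriv (fun s => angularLaplacianEnergy p x u s) t
    - 4 * (β n p - n + 4) * angularGradientEnergy p x u t
    - (β n p - n + 4) * t * deriv (fun s => angularGradientEnergy p x u s) t
    - 6 * t ^ 2 * angularGradientEnergy' p x u t
    + t ^ 3 * deriv (fun s => angularGradientEnergy' p x u s) t

/-- The modified energy
`E^c(t, x, u) = E(t, x, u) - ∫_{∂B₁} ∑_{0 ≤ i, j ≤ 2} c_{ij} t^(i+j) (dⁱu^t/dtⁱ) (dʲu^t/dtʲ)`. -/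
def modifiedEnergy (c : Fin 3 → Fin 3 → ℝ) : ℝ :=
  energy p x u t -
    surfaceIntegral (0 : EuclideanSpace ℝ (Fin n)) 1 fun θ =>
      ∑ i : Fin 3, ∑ j : Fin 3, c i j * t ^ ((i : ℕ) + (j : ℕ))
        * iteratedDeriv i (fun s => rescaled p x u s θ) t
        * iteratedDeriv j (fun s => rescaled p x u s θ) t

end

end Triharmonic

end

/-! Put k = 6/(p-1) and Λ = k + (y-x)·∇ (`scaling x k`), so that Λ acts on `u` as t d/dt acts on the
rescaled function. For ⟨f,g⟩ = t^(2k) ∫ f g over directions (`pairing`) one has t d/dt ⟨f,g⟩ =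
⟨Λf,g⟩ + ⟨f,Λg⟩. The angular Laplacian L (`angLap`) commutes with Λ and is symmetric for the
pairing, and r²Δ = Λ² + aΛ + b + L. Multiplication by r² shifts k to k + 2, so r⁴Δ² = (Λ² + a'Λ + b'
+ L) r²Δ. Hence every boundary term of the energy is a combination of pairings of the jets Uⱼ = Λʲu
and LUⱼ (`energy_eq`).

The only bulk term is t^(2k+6-n) times the integral of the Lagrangian over the ball. Testing the
equation with Λu gives a Pohozaev identity (`pohozaev`) that turns the derivative of this term into
a sphere integral (`hasDerivAt_bulk`). Adding the derivatives of the boundary terms, and using the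
freedom in c, all terms with U₀, U₄ and U₅ cancel: t times the derivative of the modified energy is
a quadratic form in U₁, U₂, U₃, LU₁, LU₂ (`hasDerivAt_modifiedEnergy`). One parameter γ stays free
in c. Raising it increases the coefficient of ⟨U₂,U₂⟩ at the price of a term 2γ⟨U₃,U₁⟩.

Completing squares (`le_quadraticForm`) bounds the form below by a multiple of ⟨U₁,U₁⟩ under two
inequalities on γ, and a third makes that multiple positive. With e = (n-6)/2 - k and q = (n-2)/2
these are polynomial inequalities on 0 < e < q - 2, where e > 0 is supercriticality and e < q - 2 is
k > 0. The choice γ = 0 works when 10e² ≤ 6q² + 16, which p < p_m guarantees for n ≥ 31. For n ≤ 30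
one has e < 12, and when the inequality fails γ = (10e² - 6q² - 16)/2 works (`exists_parameter`).

The comparison of p_c with p_m reduces to d(n) < 7n/20 - 1 for n ≥ 31. The expression under the root
in d is Cardano's formula for a root of an explicit cubic, so it is enough to know the sign of that
cubic at one point (`lt_cubic_root`). -/

noncomputable section

namespace Triharmonic

open Set Metric Filter Topology

/-! ### Integrals over spheres and polar coordinates -/

/-- The integral of `f (x + t θ)` over the unit sphere. -/
def sphereIntegral {n : ℕ} (x : EuclideanSpace ℝ (Fin n)) (f : EuclideanSpace ℝ (Fin n) → ℝ)
    (t : ℝ) : ℝ :=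
  ∫ θ : sphere (0 : EuclideanSpace ℝ (Fin n)) 1, f (x + t • (θ : EuclideanSpace ℝ (Fin n)))
    ∂((volume : Measure (EuclideanSpace ℝ (Fin n))).toSphere)

section Polar

variable {n : ℕ} (x : EuclideanSpace ℝ (Fin n))

/-- Polar coordinates: move the centre to the origin, then identify the punctured space with sphere
× (0,∞), which preserves measure for the density r^(n-1). -/
theorem integral_eq_integral_sphereIntegral [NeZero n] {f : EuclideanSpace ℝ (Fin n) → ℝ}
    (hf : Integrable f) :
    ∫ y, f y = ∫ r in Ioi (0 : ℝ), r ^ (n - 1) * sphereIntegral x f r := by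
  set μ : Measure (EuclideanSpace ℝ (Fin n)) := volume
  have hg : Integrable (fun y => f (x + y)) := hf.comp_add_left x
  have h0 : ∫ y, f y = ∫ y, f (x + y) := (integral_add_left_eq_self f x).symm
  have hmp := μ.measurePreserving_homeomorphUnitSphereProd
  have hdim : Module.finrank ℝ (EuclideanSpace ℝ (Fin n)) = n := by simp
  rw [hdim] at hmp
  let F : sphere (0 : EuclideanSpace ℝ (Fin n)) 1 × Ioi (0 : ℝ) → ℝ :=
    fun z => f (x + (z.2 : ℝ) • (z.1 : EuclideanSpace ℝ (Fin n)))
  have hF : ∀ y : ({0}ᶜ : Set (EuclideanSpace ℝ (Fin n))),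
      F (homeomorphUnitSphereProd _ y) = f (x + y) := by
    intro y
    have hy : ‖(y : EuclideanSpace ℝ (Fin n))‖ ≠ 0 := norm_ne_zero_iff.mpr y.2
    simp [F, smul_smul, mul_inv_cancel₀ hy]
  have hFi : Integrable F (μ.toSphere.prod (.volumeIoiPow (n - 1))) := by
    rw [← hmp.integrable_comp_emb (Homeomorph.measurableEmbedding _)]
    have : (F ∘ (homeomorphUnitSphereProd (EuclideanSpace ℝ (Fin n)))) =
        (fun y => f (x + y)) ∘ Subtype.val := by
      funext y; exact hF y
    rw [this, ← integrableOn_iff_comap_subtypeVal (by measurability)]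
    exact hg.integrableOn
  calc
    ∫ y, f y = ∫ y : ({0}ᶜ : Set (EuclideanSpace ℝ (Fin n))), f (x + y) ∂(μ.comap (↑)) := by
      rw [h0, integral_subtype_comap (measurableSet_singleton _).compl fun y => f (x + y),
        restrict_compl_singleton]
    _ = ∫ z, F z ∂μ.toSphere.prod (.volumeIoiPow (n - 1)) := by
      rw [← hmp.integral_comp (Homeomorph.measurableEmbedding _)]
      exact integral_congr_ae (Eventually.of_forall fun y => (hF y).symm)
    _ = ∫ r : Ioi (0 : ℝ), sphereIntegral x f r ∂(.volumeIoiPow (n - 1)) :=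
      integral_prod_symm _ hFi
    _ = _ := by
      simp only [Measure.volumeIoiPow, ENNReal.ofReal]
      rw [integral_withDensity_eq_integral_smul,
        integral_subtype_comap measurableSet_Ioi
          fun a ↦ Real.toNNReal (a ^ (n - 1)) • sphereIntegral x f a,
        setIntegral_congr_fun measurableSet_Ioi fun x hx ↦ ?_]
      · rw [NNReal.smul_def, Real.coe_toNNReal _ (pow_nonneg hx.out.le _), smul_eq_mul]
      · exact (measurable_subtype_coe.pow_const _).real_toNNReal

theorem integral_ball_eq [NeZero n] {f : EuclideanSpace ℝ (Fin n) → ℝ} (hf : Continuous f)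
    {t : ℝ} (ht : 0 ≤ t) :
    ∫ y in ball x t, f y = ∫ r in (0 : ℝ)..t, r ^ (n - 1) * sphereIntegral x f r := by
  have hi : Integrable ((ball x t).indicator f) := by
    rw [integrable_indicator_iff measurableSet_ball]
    exact (hf.continuousOn.integrableOn_compact (isCompact_closedBall x t)).mono_set
      ball_subset_closedBall
  rw [← integral_indicator measurableSet_ball, integral_eq_integral_sphereIntegral x hi,
    intervalIntegral.integral_of_le ht, integral_Ioc_eq_integral_Ioo,
    ← Ioi_inter_Iio, ← setIntegral_indicator measurableSet_Iio]
  refine setIntegral_congr_fun measurableSet_Ioi fun r hr => ?_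
  have hr : 0 < r := hr
  by_cases hrt : r < t
  · rw [indicator_of_mem (by exact hrt)]
    simp only [sphereIntegral]
    congr 1
    refine integral_congr_ae (Eventually.of_forall fun θ => ?_)
    have : ‖(θ : EuclideanSpace ℝ (Fin n))‖ = 1 := by simp
    exact indicator_of_mem (by simp [norm_smul, this, abs_of_pos hr, hrt]) f
  · rw [indicator_of_notMem (by exact hrt)]
    simp only [sphereIntegral]
    have : ∀ θ : sphere (0 : EuclideanSpace ℝ (Fin n)) 1,
        (ball x t).indicator f (x + r • (θ : EuclideanSpace ℝ (Fin n))) = 0 := by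
      intro θ
      exact indicator_of_notMem (by simpa [norm_smul, abs_of_pos hr] using hrt) f
    simp [this]

theorem continuous_sphereIntegral {f : EuclideanSpace ℝ (Fin n) → ℝ} (hf : Continuous f) :
    Continuous (sphereIntegral x f) := by
  have h : Continuous (fun q : ℝ × sphere (0 : EuclideanSpace ℝ (Fin n)) 1 =>
      f (x + q.1 • (q.2 : EuclideanSpace ℝ (Fin n)))) := by fun_prop
  have := continuousOn_integral_of_compact_support (μ := (volume :
    Measure (EuclideanSpace ℝ (Fin n))).toSphere) (s := univ) (k := univ)
    (f := fun t (θ : sphere (0 : EuclideanSpace ℝ (Fin n)) 1) =>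
      f (x + t • (θ : EuclideanSpace ℝ (Fin n)))) isCompact_univ
    (by simpa [Function.uncurry_def, continuousOn_univ] using h) (by simp)
  exact continuousOn_univ.mp this

theorem integrable_sphere {f : EuclideanSpace ℝ (Fin n) → ℝ} (hf : Continuous f) (t : ℝ) :
    Integrable (fun θ : sphere (0 : EuclideanSpace ℝ (Fin n)) 1 =>
      f (x + t • (θ : EuclideanSpace ℝ (Fin n))))
      ((volume : Measure (EuclideanSpace ℝ (Fin n))).toSphere) := by
  have h : Continuous (fun θ : sphere (0 : EuclideanSpace ℝ (Fin n)) 1 =>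
      f (x + t • (θ : EuclideanSpace ℝ (Fin n)))) := by fun_prop
  exact h.integrable_of_hasCompactSupport (HasCompactSupport.of_compactSpace _)

theorem hasDerivAt_integral_ball [NeZero n] {f : EuclideanSpace ℝ (Fin n) → ℝ} (hf : Continuous f)
    {t : ℝ} (ht : 0 < t) :
    HasDerivAt (fun s => ∫ y in ball x s, f y) (t ^ (n - 1) * sphereIntegral x f t) t := by
  have hc : Continuous (fun r : ℝ => r ^ (n - 1) * sphereIntegral x f r) :=
    (continuous_pow _).mul (continuous_sphereIntegral x hf)
  have h := intervalIntegral.integral_hasDerivAt_right (hc.intervalIntegrable 0 t)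
    (hc.stronglyMeasurableAtFilter _ _) hc.continuousAt
  refine h.congr_of_eventuallyEq ?_
  filter_upwards [lt_mem_nhds ht] with s hs
  exact integral_ball_eq x hf hs.le

/-- The Euler operator `(y - x) · ∇f`. -/
def euler (f : EuclideanSpace ℝ (Fin n) → ℝ) (y : EuclideanSpace ℝ (Fin n)) : ℝ :=
  fderiv ℝ f y (y - x)

theorem hasDerivAt_comp_ray {f : EuclideanSpace ℝ (Fin n) → ℝ} {θ : EuclideanSpace ℝ (Fin n)}
    {t : ℝ} (hf : DifferentiableAt ℝ f (x + t • θ)) :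
    HasDerivAt (fun s : ℝ => f (x + s • θ)) (fderiv ℝ f (x + t • θ) θ) t := by
  have h1 : HasDerivAt (fun s : ℝ => x + s • θ) θ t := by
    simpa using ((hasDerivAt_id t).smul_const θ).const_add x
  exact hf.hasFDerivAt.comp_hasDerivAt t h1

/-- Differentiation under the integral. Since y - x = tθ, the derivative along the ray is t⁻¹ times
the Euler derivative; a bound on the compact set interval × sphere dominates it. -/
theorem hasDerivAt_sphereIntegral {f : EuclideanSpace ℝ (Fin n) → ℝ} (hf : ContDiff ℝ 1 f)
    {t : ℝ} (ht : 0 < t) :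
    HasDerivAt (sphereIntegral x f) (t⁻¹ * sphereIntegral x (euler x f) t) t := by
  have hc : Continuous (fun q : ℝ × sphere (0 : EuclideanSpace ℝ (Fin n)) 1 =>
      fderiv ℝ f (x + q.1 • (q.2 : EuclideanSpace ℝ (Fin n))) q.2) := by
    have := hf.continuous_fderiv (by norm_num)
    fun_prop
  obtain ⟨C, hC⟩ := ((isCompact_Icc (a := t - 1) (b := t + 1)).prod
    (isCompact_univ (X := sphere (0 : EuclideanSpace ℝ (Fin n)) 1))).exists_bound_of_continuousOn
      hc.continuousOn
  have key := hasDerivAt_integral_of_dominated_loc_of_deriv_le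
    (μ := (volume : Measure (EuclideanSpace ℝ (Fin n))).toSphere)
    (F := fun s (θ : sphere (0 : EuclideanSpace ℝ (Fin n)) 1) =>
      f (x + s • (θ : EuclideanSpace ℝ (Fin n))))
    (F' := fun s (θ : sphere (0 : EuclideanSpace ℝ (Fin n)) 1) =>
      fderiv ℝ f (x + s • (θ : EuclideanSpace ℝ (Fin n))) θ)
    (x₀ := t) (s := Icc (t - 1) (t + 1)) (bound := fun _ => C)
    (Icc_mem_nhds (by linarith) (by linarith))
    (Eventually.of_forall fun s => (integrable_sphere x hf.continuous s).aestronglyMeasurable)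
    (integrable_sphere x hf.continuous t)
    ((hc.comp (Continuous.prodMk_right t)).aestronglyMeasurable)
    (Eventually.of_forall fun θ s hs => hC (s, θ) ⟨hs, mem_univ _⟩)
    (integrable_const C)
    (Eventually.of_forall fun θ s _ =>
      hasDerivAt_comp_ray x (hf.differentiable (by norm_num) _))
  convert! key.2 using 1
  rw [sphereIntegral, ← integral_const_mul]
  refine integral_congr_ae (Eventually.of_forall fun θ => ?_)
  simp [euler, ht.ne']

end Polar

/-! ### The divergence theorem on spheres -/

section Divergence

variable {n : ℕ} (x : EuclideanSpace ℝ (Fin n))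

/-- The partial derivative `∂ᵢ f`. -/
def pderiv (i : Fin n) (f : EuclideanSpace ℝ (Fin n) → ℝ) (y : EuclideanSpace ℝ (Fin n)) : ℝ :=
  fderiv ℝ f y (EuclideanSpace.single i 1)

theorem hasFDerivAt_coord (i : Fin n) (y : EuclideanSpace ℝ (Fin n)) :
    HasFDerivAt (fun y : EuclideanSpace ℝ (Fin n) => (y - x) i)
      (EuclideanSpace.proj i : EuclideanSpace ℝ (Fin n) →L[ℝ] ℝ) y := by
  have := ((EuclideanSpace.proj i : EuclideanSpace ℝ (Fin n) →L[ℝ] ℝ).hasFDerivAt (x := y)).sub_const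
    (x i)
  simpa using this

theorem contDiff_coord (i : Fin n) {m : WithTop ℕ∞} :
    ContDiff ℝ m (fun y : EuclideanSpace ℝ (Fin n) => (y - x) i) := by
  have := ((EuclideanSpace.proj i : EuclideanSpace ℝ (Fin n) →L[ℝ] ℝ).contDiff (n := m)).sub
    (contDiff_const (c := x i))
  simpa using this

theorem contDiff_pderiv (i : Fin n) {f : EuclideanSpace ℝ (Fin n) → ℝ} {m l : WithTop ℕ∞}
    (hf : ContDiff ℝ l f) (h : m + 1 ≤ l) : ContDiff ℝ m (pderiv i f) :=
  (hf.fderiv_right h).clm_apply contDiff_const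

theorem contDiff_euler {f : EuclideanSpace ℝ (Fin n) → ℝ} {m l : WithTop ℕ∞}
    (hf : ContDiff ℝ l f) (h : m + 1 ≤ l) : ContDiff ℝ m (euler x f) :=
  (hf.fderiv_right h).clm_apply (contDiff_id.sub contDiff_const)

theorem euler_mul {f g : EuclideanSpace ℝ (Fin n) → ℝ} {y : EuclideanSpace ℝ (Fin n)}
    (hf : DifferentiableAt ℝ f y) (hg : DifferentiableAt ℝ g y) :
    euler x (fun z => f z * g z) y = euler x f y * g y + f y * euler x g y := by
  simp only [euler]
  rw [fderiv_fun_mul hf hg]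
  simp; ring

theorem euler_coord (i : Fin n) (y : EuclideanSpace ℝ (Fin n)) :
    euler x (fun z => (z - x) i) y = (y - x) i := by
  rw [euler, (hasFDerivAt_coord x i y).fderiv]; simp

theorem contDiff_radial {g : ℝ → ℝ} (hg : ContDiff ℝ 1 g) (h0 : (0 : ℝ) ∉ tsupport g) :
    ContDiff ℝ 1 (fun y : EuclideanSpace ℝ (Fin n) => g ‖y - x‖) := by
  rw [contDiff_iff_contDiffAt]
  intro y
  by_cases hy : y = x
  · have h1 : g =ᶠ[𝓝 ‖y - x‖] 0 := by
      rw [notMem_tsupport_iff_eventuallyEq] at h0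
      simpa [hy] using h0
    have h2 : Tendsto (fun z : EuclideanSpace ℝ (Fin n) => ‖z - x‖) (𝓝 y) (𝓝 ‖y - x‖) :=
      (by fun_prop : Continuous (fun z : EuclideanSpace ℝ (Fin n) => ‖z - x‖)).tendsto y
    exact (contDiffAt_const (c := (0 : ℝ))).congr_of_eventuallyEq (h2.eventually h1)
  · exact hg.contDiffAt.comp y ((contDiffAt_id.sub contDiffAt_const).norm ℝ (sub_ne_zero.mpr hy))

theorem pderiv_radial (i : Fin n) {g : ℝ → ℝ} (hg : Differentiable ℝ g)
    {y : EuclideanSpace ℝ (Fin n)} (hy : y ≠ x) :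
    pderiv i (fun y : EuclideanSpace ℝ (Fin n) => g ‖y - x‖) y =
      deriv g ‖y - x‖ * (‖y - x‖⁻¹ * (y - x) i) := by
  have hyx : y - x ≠ 0 := sub_ne_zero.mpr hy
  have hd : DifferentiableAt ℝ (fun y : EuclideanSpace ℝ (Fin n) => ‖y - x‖) y :=
    (differentiableAt_id.sub (differentiableAt_const x)).norm ℝ hyx
  have h1 : HasFDerivAt (fun y : EuclideanSpace ℝ (Fin n) => ‖y - x‖ ^ 2)
      (2 • (innerSL ℝ (y - x)).comp (ContinuousLinearMap.id ℝ _)) y :=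
    ((hasFDerivAt_id y).sub_const x).norm_sq
  -- The derivative of the norm is read off from two computations of the derivative of its square.
  have h2 := hd.hasFDerivAt.pow 2
  have h3 := congrArg (fun L => L (EuclideanSpace.single i 1)) (h2.unique h1)
  simp only [_root_.smul_apply, ContinuousLinearMap.comp_id, innerSL_apply_apply,
    EuclideanSpace.inner_single_right] at h3
  have hn : ‖y - x‖ ≠ 0 := norm_ne_zero_iff.mpr hyx
  have h4 : fderiv ℝ (fun y : EuclideanSpace ℝ (Fin n) => ‖y - x‖) y (EuclideanSpace.single i 1) =
      ‖y - x‖⁻¹ * (y - x) i := by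
    simp at h3 ⊢
    field_simp
    linarith
  have h5 := (hg ‖y - x‖).hasDerivAt.comp_hasFDerivAt y hd.hasFDerivAt
  rw [pderiv]
  erw [h5.fderiv]
  rw [_root_.smul_apply, h4, smul_eq_mul]

theorem hasCompactSupport_radial {g : ℝ → ℝ} (hg : HasCompactSupport g) :
    HasCompactSupport (fun y : EuclideanSpace ℝ (Fin n) => g ‖y - x‖) := by
  obtain ⟨R, hR⟩ := hg.isCompact.isBounded.subset_closedBall 0
  refine HasCompactSupport.intro (isCompact_closedBall x R) fun y hy => ?_
  by_contra h
  have h1 := hR (subset_tsupport g (Function.mem_support.mpr h))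
  rw [mem_closedBall, dist_eq_norm] at hy
  simp at h1
  exact hy h1

theorem integrable_mul_of_tsupport {g k : ℝ → ℝ} {U : Set ℝ} (hg : Continuous g)
    (hc : HasCompactSupport g) (hU : tsupport g ⊆ U) (hk : ContinuousOn k U) :
    Integrable (fun r => g r * k r) := by
  have h : IntegrableOn (fun r => g r * k r) (tsupport g) :=
    (hg.continuousOn.mul (hk.mono hU)).integrableOn_compact hc.isCompact
  refine (integrableOn_iff_integrable_of_support_subset fun r hr => ?_).mp h
  exact subset_tsupport g (left_ne_zero_of_mul hr)

theorem sphereIntegral_congr {f g : EuclideanSpace ℝ (Fin n) → ℝ} {t : ℝ} (ht : 0 < t)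
    (h : ∀ y, ‖y - x‖ = t → f y = g y) : sphereIntegral x f t = sphereIntegral x g t := by
  refine integral_congr_ae (Eventually.of_forall fun θ => h _ ?_)
  simp [norm_smul, abs_of_pos ht]

theorem sphereIntegral_const_mul (c : ℝ) (f : EuclideanSpace ℝ (Fin n) → ℝ) (t : ℝ) :
    sphereIntegral x (fun y => c * f y) t = c * sphereIntegral x f t :=
  integral_const_mul _ _

theorem sphereIntegral_add {f g : EuclideanSpace ℝ (Fin n) → ℝ} (hf : Continuous f)
    (hg : Continuous g) (t : ℝ) :
    sphereIntegral x (fun y => f y + g y) t = sphereIntegral x f t + sphereIntegral x g t :=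
  integral_add (integrable_sphere x hf t) (integrable_sphere x hg t)

theorem sphereIntegral_sub {f g : EuclideanSpace ℝ (Fin n) → ℝ} (hf : Continuous f)
    (hg : Continuous g) (t : ℝ) :
    sphereIntegral x (fun y => f y - g y) t = sphereIntegral x f t - sphereIntegral x g t :=
  integral_sub (integrable_sphere x hf t) (integrable_sphere x hg t)

theorem sphereIntegral_sum {ι : Type*} (s : Finset ι) {f : ι → EuclideanSpace ℝ (Fin n) → ℝ}
    (hf : ∀ i ∈ s, Continuous (f i)) (t : ℝ) :
    sphereIntegral x (fun y => ∑ i ∈ s, f i y) t = ∑ i ∈ s, sphereIntegral x (f i) t :=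
  integral_finsetSum s fun i hi => integrable_sphere x (hf i hi) t

/-- The weak form of the divergence theorem, tested against radial functions. -/
theorem integral_radial_mul_pderiv [NeZero n] (i : Fin n) {f : EuclideanSpace ℝ (Fin n) → ℝ}
    (hf : ContDiff ℝ 1 f) {g : ℝ → ℝ} (hg : ContDiff ℝ 1 g) (hc : HasCompactSupport g)
    (hs : tsupport g ⊆ Ioi 0) :
    ∫ r in Ioi (0 : ℝ), g r * (r ^ (n - 1) * sphereIntegral x (pderiv i f) r) =
      -∫ r in Ioi (0 : ℝ), deriv g r *
        (r ^ (n - 1) * r⁻¹ * sphereIntegral x (fun y => f y * (y - x) i) r) := by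
  have h0 : (0 : ℝ) ∉ tsupport g := fun h => lt_irrefl (0 : ℝ) (mem_Ioi.mp (hs h))
  set χ : EuclideanSpace ℝ (Fin n) → ℝ := fun y => g ‖y - x‖
  have hχ : ContDiff ℝ 1 χ := contDiff_radial x hg h0
  have hχc : HasCompactSupport χ := hasCompactSupport_radial x hc
  have hχ' : Continuous (pderiv i χ) := (contDiff_pderiv (m := 0) i hχ (by norm_num)).continuous
  have hf' : Continuous (pderiv i f) := (contDiff_pderiv (m := 0) i hf (by norm_num)).continuous
  have hχ'c : HasCompactSupport (pderiv i χ) := hχc.fderiv_apply ℝ _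
  have i1 : Integrable (fun y => pderiv i χ y * f y) :=
    (hχ'.mul hf.continuous).integrable_of_hasCompactSupport hχ'c.mul_right
  have i2 : Integrable (fun y => χ y * pderiv i f y) :=
    (hχ.continuous.mul hf').integrable_of_hasCompactSupport hχc.mul_right
  have i3 : Integrable (fun y => χ y * f y) :=
    (hχ.continuous.mul hf.continuous).integrable_of_hasCompactSupport hχc.mul_right
  -- Integration by parts in the whole space against the radial cutoff `χ`; polar coordinates then
  -- reduce both sides to integrals over the radius.
  have key := integral_mul_fderiv_eq_neg_fderiv_mul_of_integrable (μ := volume) i1 i2 i3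
    (fun y _ => hχ.differentiable (by norm_num) y) (fun y _ => hf.differentiable (by norm_num) y)
  change ∫ y, χ y * pderiv i f y = -∫ y, pderiv i χ y * f y at key
  rw [integral_eq_integral_sphereIntegral x i1, integral_eq_integral_sphereIntegral x i2] at key
  convert key using 1
  · refine setIntegral_congr_fun measurableSet_Ioi fun r hr => ?_
    have : sphereIntegral x (fun y => χ y * pderiv i f y) r =
        sphereIntegral x (fun y => g r * pderiv i f y) r :=
      sphereIntegral_congr x hr fun y hy => by simp [χ, hy]
    simp only [this, sphereIntegral_const_mul]
    ring
  · congr 1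
    refine setIntegral_congr_fun measurableSet_Ioi fun r hr => ?_
    have : sphereIntegral x (fun y => pderiv i χ y * f y) r =
        sphereIntegral x (fun y => (deriv g r * r⁻¹) * (f y * (y - x) i)) r :=
      sphereIntegral_congr x hr fun y hy => by
        have hyx : y ≠ x := by
          rintro rfl; simp at hy; exact (ne_of_gt hr) hy.symm
        rw [pderiv_radial x i (hg.differentiable (by norm_num)) hyx, hy]
        ring
    simp only [this, sphereIntegral_const_mul]
    ring

/-- The divergence theorem on the sphere of radius `t`, for the field `f eᵢ`. -/
theorem sphereIntegral_pderiv [NeZero n] (i : Fin n) {f : EuclideanSpace ℝ (Fin n) → ℝ}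
    (hf : ContDiff ℝ 1 f) {t : ℝ} (ht : 0 < t) :
    t ^ 2 * sphereIntegral x (pderiv i f) t =
      sphereIntegral x (fun y => (y - x) i * euler x f y) t
        + (n - 1) * sphereIntegral x (fun y => f y * (y - x) i) t := by
  set N := sphereIntegral x (fun y => f y * (y - x) i)
  set N' := sphereIntegral x (fun y => (y - x) i * euler x f y)
  set P := sphereIntegral x (pderiv i f)
  have hfc := hf.continuous
  have hco : Continuous (fun y : EuclideanSpace ℝ (Fin n) => (y - x) i) :=
    (contDiff_coord x i (m := 0)).continuous
  have hec : Continuous (euler x f) := (contDiff_euler x (m := 0) hf (by norm_num)).continuous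
  have hNc : Continuous N := continuous_sphereIntegral x (hfc.mul hco)
  have hN'c : Continuous N' := continuous_sphereIntegral x (hco.mul hec)
  have hPc : Continuous P := continuous_sphereIntegral x
    (contDiff_pderiv (m := 0) i hf (by norm_num)).continuous
  have hNd : ∀ r : ℝ, 0 < r → HasDerivAt N (r⁻¹ * (N' r + N r)) r := by
    intro r hr
    have := hasDerivAt_sphereIntegral x (hf.mul (contDiff_coord x i)) hr
    have e : euler x (fun y => f y * (y - x) i) =
        fun y => (y - x) i * euler x f y + f y * (y - x) i := by
      funext y
      rw [euler_mul x (hf.differentiable (by norm_num) y)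
        ((contDiff_coord x i (m := 1)).differentiable (by norm_num) y), euler_coord]
      ring
    rw [e, sphereIntegral_add x (f := fun y => (y - x) i * euler x f y)
      (g := fun y => f y * (y - x) i) (hco.mul hec) (hfc.mul hco)] at this
    exact this
  -- With n = l + 1, the weak identity says that r^l P is the weak derivative of r^(l-1) N, whose
  -- classical derivative is `Ψ'`.
  obtain ⟨l, rfl⟩ : ∃ l, n = l + 1 := ⟨n - 1, by have := NeZero.pos n; omega⟩
  let Ψ' : ℝ → ℝ := fun r => r ^ l * r⁻¹ * r⁻¹ * (l * N r + N' r)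
  have hΨ : ∀ r : ℝ, 0 < r → HasDerivAt (fun r => r ^ l * r⁻¹ * N r) (Ψ' r) r := by
    intro r hr
    have hr' := hr.ne'
    have h := ((hasDerivAt_pow l r).mul (hasDerivAt_inv hr')).mul (hNd r hr)
    refine h.congr_deriv ?_
    -- The power rule contains the truncated exponent l - 1, so l = 0 is separate.
    rcases l with _ | l
    · simp [Ψ']; field_simp; ring
    · simp [Ψ']; field_simp; ring
  have hΨ'c : ContinuousOn Ψ' (Ioi 0) := by
    have : ContinuousOn (fun r : ℝ => r⁻¹) (Ioi 0) :=
      continuousOn_inv₀.mono fun r hr => (ne_of_gt hr)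
    fun_prop
  have hQc : ContinuousOn (fun r => r ^ l * P r - Ψ' r) (Ioi 0) :=
    ((continuous_pow l).mul hPc).continuousOn.sub hΨ'c
  have hΨc : ContinuousOn (fun r : ℝ => r ^ l * r⁻¹ * N r) (Ioi 0) :=
    fun r hr => (hΨ r hr).continuousAt.continuousWithinAt
  -- The difference is annihilated by every test function supported in (0,∞), so it vanishes almost
  -- everywhere and, being continuous, everywhere.
  have hz := isOpen_Ioi.ae_eq_zero_of_integral_contDiff_smul_eq_zero (μ := volume)
    (f := fun r => r ^ l * P r - Ψ' r) (U := Ioi (0 : ℝ))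
    (hQc.locallyIntegrableOn measurableSet_Ioi) (by
      intro g hg hc hs
      have hg1 : ContDiff ℝ 1 g := hg.of_le (by exact_mod_cast le_top)
      have hg' : Continuous (deriv g) := hg1.continuous_deriv (by norm_num)
      have hs' : tsupport (deriv g) ⊆ Ioi 0 := (tsupport_deriv_subset (𝕜 := ℝ)).trans hs
      have hw := integral_radial_mul_pderiv x i hf hg1 hc hs
      simp only [Nat.add_sub_cancel] at hw
      have r1 : ∀ (a k : ℝ → ℝ), tsupport a ⊆ Ioi 0 →
          ∫ r in Ioi (0 : ℝ), a r * k r = ∫ r, a r * k r := by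
        intro a k ha
        refine setIntegral_eq_integral_of_forall_compl_eq_zero fun r hr => ?_
        rw [image_eq_zero_of_notMem_tsupport fun h => hr (ha h), zero_mul]
      rw [r1 _ _ hs, r1 _ _ hs'] at hw
      have i1 := integrable_mul_of_tsupport hg1.continuous hc hs hΨ'c
      have i2 := integrable_mul_of_tsupport hg' hc.deriv hs' hΨc
      have i3 := integrable_mul_of_tsupport hg1.continuous hc hs hΨc
      have i4 := integrable_mul_of_tsupport (k := fun r => r ^ l * P r) hg1.continuous hc hs
        ((continuous_pow l).mul hPc).continuousOn
      have ibp := integral_mul_deriv_eq_deriv_mul_of_integrable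
        (u := g) (u' := deriv g) (v := fun r => r ^ l * r⁻¹ * N r) (v' := Ψ')
        (fun r _ => (hg1.differentiable (by norm_num) r).hasDerivAt) (fun r hr => hΨ r (hs hr))
        i1 i2 i3
      simp only [smul_eq_mul, mul_sub]
      rw [integral_sub i4 i1, ibp]
      linarith)
  have hz' : EqOn (fun r => r ^ l * P r - Ψ' r) (fun _ => 0) (Ioi 0) := by
    refine Measure.eqOn_open_of_ae_eq (μ := volume) ?_ isOpen_Ioi hQc continuousOn_const
    exact (ae_restrict_iff' measurableSet_Ioi).mpr hz
  have h := hz' ht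
  simp only [Ψ'] at h
  have ht' := ht.ne'
  field_simp at h
  push_cast
  have h6 : t ^ 2 * P t - (l * N t + N' t) = 0 := by
    rw [mul_zero] at h
    rcases mul_eq_zero.mp h with h | h
    · exact absurd h (pow_ne_zero _ ht')
    · linarith
  linarith

end Divergence

/-! ### The angular Laplacian -/

section Angular

variable {n : ℕ} (x : EuclideanSpace ℝ (Fin n))

theorem sum_coord_smul_single (v : EuclideanSpace ℝ (Fin n)) :
    ∑ i, v i • EuclideanSpace.single i (1 : ℝ) = v := by
  ext j
  simp [Finset.sum_apply, Pi.single_apply]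

theorem fderiv_eq_sum (f : EuclideanSpace ℝ (Fin n) → ℝ) (y v : EuclideanSpace ℝ (Fin n)) :
    fderiv ℝ f y v = ∑ i, v i * pderiv i f y := by
  conv_lhs => rw [← sum_coord_smul_single v]
  simp [pderiv]

theorem euler_eq_sum (f : EuclideanSpace ℝ (Fin n) → ℝ) (y : EuclideanSpace ℝ (Fin n)) :
    euler x f y = ∑ i, (y - x) i * pderiv i f y :=
  fderiv_eq_sum f y _

theorem gradient_coord (f : EuclideanSpace ℝ (Fin n) → ℝ) (y : EuclideanSpace ℝ (Fin n))
    (i : Fin n) : gradient f y i = pderiv i f y := by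
  have h : inner ℝ (gradient f y) (EuclideanSpace.single i (1 : ℝ)) = pderiv i f y := by
    rw [gradient, InnerProductSpace.toDual_symm_apply, pderiv]
  rw [EuclideanSpace.inner_single_right] at h
  simpa using h

theorem norm_gradient_sq (f : EuclideanSpace ℝ (Fin n) → ℝ) (y : EuclideanSpace ℝ (Fin n)) :
    ‖gradient f y‖ ^ 2 = ∑ i, pderiv i f y ^ 2 := by
  rw [EuclideanSpace.real_norm_sq_eq]
  simp [gradient_coord]

theorem norm_sub_sq_eq_sum (y : EuclideanSpace ℝ (Fin n)) :
    ‖y - x‖ ^ 2 = ∑ i, (y - x) i ^ 2 :=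
  EuclideanSpace.real_norm_sq_eq _

theorem fderiv_pderiv (i : Fin n) {f : EuclideanSpace ℝ (Fin n) → ℝ}
    {y : EuclideanSpace ℝ (Fin n)} (hd : DifferentiableAt ℝ (fderiv ℝ f) y) :
    fderiv ℝ (pderiv i f) y =
      (fderiv ℝ (fderiv ℝ f) y).flip (EuclideanSpace.single i 1) := by
  have h := (hd.hasFDerivAt.clm_apply
    (hasFDerivAt_const (EuclideanSpace.single i (1 : ℝ)) y)).fderiv
  rw [ContinuousLinearMap.comp_zero, zero_add] at h
  exact h

theorem laplacian_eq_sum {f : EuclideanSpace ℝ (Fin n) → ℝ} (hf : ContDiff ℝ 2 f)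
    (y : EuclideanSpace ℝ (Fin n)) : (Δ f) y = ∑ i, pderiv i (pderiv i f) y := by
  rw [InnerProductSpace.laplacian_eq_iteratedFDeriv_orthonormalBasis f
    (EuclideanSpace.basisFun (Fin n) ℝ)]
  refine Finset.sum_congr rfl fun i _ => ?_
  have hd : DifferentiableAt ℝ (fderiv ℝ f) y :=
    (hf.fderiv_right (m := 1) (by norm_num)).differentiable (by norm_num) y
  rw [iteratedFDeriv_two_apply, pderiv, fderiv_pderiv i hd]
  simp

theorem contDiff_laplacian {f : EuclideanSpace ℝ (Fin n) → ℝ} {m l : WithTop ℕ∞}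
    (hf : ContDiff ℝ l f) (h : m + 2 ≤ l) : ContDiff ℝ m (Δ f) := by
  have h2 : ContDiff ℝ 2 f := hf.of_le (le_trans (by simp) h)
  have : Δ f = fun y => ∑ i, pderiv i (pderiv i f) y := funext fun y => laplacian_eq_sum h2 y
  rw [this]
  refine ContDiff.sum fun i _ => contDiff_pderiv i (contDiff_pderiv (m := m + 1) i hf ?_) le_rfl
  rw [add_assoc]
  convert h using 2
  norm_num

theorem pderiv_add (i : Fin n) {f g : EuclideanSpace ℝ (Fin n) → ℝ} {y : EuclideanSpace ℝ (Fin n)}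
    (hf : DifferentiableAt ℝ f y) (hg : DifferentiableAt ℝ g y) :
    pderiv i (fun z => f z + g z) y = pderiv i f y + pderiv i g y := by
  simp only [pderiv]
  rw [fderiv_fun_add hf hg]; simp

theorem pderiv_mul (i : Fin n) {f g : EuclideanSpace ℝ (Fin n) → ℝ} {y : EuclideanSpace ℝ (Fin n)}
    (hf : DifferentiableAt ℝ f y) (hg : DifferentiableAt ℝ g y) :
    pderiv i (fun z => f z * g z) y = pderiv i f y * g y + f y * pderiv i g y := by
  simp only [pderiv]
  rw [fderiv_fun_mul hf hg]; simp; ring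

theorem euler_add {f g : EuclideanSpace ℝ (Fin n) → ℝ} {y : EuclideanSpace ℝ (Fin n)}
    (hf : DifferentiableAt ℝ f y) (hg : DifferentiableAt ℝ g y) :
    euler x (fun z => f z + g z) y = euler x f y + euler x g y := by
  simp only [euler]
  rw [fderiv_fun_add hf hg]; simp

theorem euler_const_mul (c : ℝ) {f : EuclideanSpace ℝ (Fin n) → ℝ} {y : EuclideanSpace ℝ (Fin n)}
    (hf : DifferentiableAt ℝ f y) :
    euler x (fun z => c * f z) y = c * euler x f y := by
  simp only [euler]
  rw [fderiv_const_mul hf]; simp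

theorem pderiv_const_mul (i : Fin n) (c : ℝ) {f : EuclideanSpace ℝ (Fin n) → ℝ}
    {y : EuclideanSpace ℝ (Fin n)} (hf : DifferentiableAt ℝ f y) :
    pderiv i (fun z => c * f z) y = c * pderiv i f y := by
  simp only [pderiv]
  rw [fderiv_const_mul hf]; simp

theorem euler_sum {ι : Type*} (s : Finset ι) {f : ι → EuclideanSpace ℝ (Fin n) → ℝ}
    {y : EuclideanSpace ℝ (Fin n)} (hf : ∀ i ∈ s, DifferentiableAt ℝ (f i) y) :
    euler x (fun z => ∑ i ∈ s, f i z) y = ∑ i ∈ s, euler x (f i) y := by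
  simp only [euler]
  rw [fderiv_fun_sum hf]; simp

/-- Symmetry of the second derivative moves ∂ᵢ inside; differentiating the factor y - x leaves the
extra term. -/
theorem pderiv_euler (i : Fin n) {f : EuclideanSpace ℝ (Fin n) → ℝ} (hf : ContDiff ℝ 2 f)
    (y : EuclideanSpace ℝ (Fin n)) :
    pderiv i (euler x f) y = euler x (pderiv i f) y + pderiv i f y := by
  have hd : DifferentiableAt ℝ (fderiv ℝ f) y :=
    (hf.fderiv_right (m := 1) (by norm_num)).differentiable (by norm_num) y
  have hs : IsSymmSndFDerivAt ℝ f y := hf.contDiffAt.isSymmSndFDerivAt (by simp)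
  have h1 : fderiv ℝ (euler x f) y =
      (fderiv ℝ f y).comp (ContinuousLinearMap.id ℝ _) + (fderiv ℝ (fderiv ℝ f) y).flip (y - x) := by
    have : HasFDerivAt (fun z : EuclideanSpace ℝ (Fin n) => z - x) (ContinuousLinearMap.id ℝ _) y :=
      (hasFDerivAt_id y).sub_const x
    exact (hd.hasFDerivAt.clm_apply this).fderiv
  rw [pderiv, h1, euler, fderiv_pderiv i hd]
  simp only [_root_.add_apply, ContinuousLinearMap.comp_id, ContinuousLinearMap.flip_apply,
    hs.eq (EuclideanSpace.single i 1) (y - x), pderiv]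
  ring

theorem laplacian_euler {f : EuclideanSpace ℝ (Fin n) → ℝ} (hf : ContDiff ℝ 3 f)
    (y : EuclideanSpace ℝ (Fin n)) :
    (Δ (euler x f)) y = euler x (Δ f) y + 2 * (Δ f) y := by
  have hp : ∀ i : Fin n, ContDiff ℝ 2 (pderiv i f) := fun i => contDiff_pderiv i hf (by norm_num)
  have hpp : ∀ i : Fin n, ContDiff ℝ 1 (pderiv i (pderiv i f)) :=
    fun i => contDiff_pderiv i (hp i) (by norm_num)
  have h2 : ContDiff ℝ 2 f := hf.of_le (by norm_num)
  rw [laplacian_eq_sum (contDiff_euler x hf (by norm_num)),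
    show Δ f = fun y => ∑ i, pderiv i (pderiv i f) y from funext fun y => laplacian_eq_sum h2 y,
    euler_sum x _ fun i _ => (hpp i).differentiable (by norm_num) y, Finset.mul_sum,
    ← Finset.sum_add_distrib]
  refine Finset.sum_congr rfl fun i _ => ?_
  have e : pderiv i (euler x f) = fun y => euler x (pderiv i f) y + pderiv i f y :=
    funext fun y => pderiv_euler x i h2 y
  rw [e, pderiv_add i ((contDiff_euler x (hp i) (m := 1) (by norm_num)).differentiable
    (by norm_num) y) ((hp i).differentiable (by norm_num) y), pderiv_euler x i (hp i)]
  ring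

/-- The Laplacian of the sphere through `y` centred at `x`, scaled by `‖y - x‖²`. -/
def angLap (f : EuclideanSpace ℝ (Fin n) → ℝ) (y : EuclideanSpace ℝ (Fin n)) : ℝ :=
  ‖y - x‖ ^ 2 * (Δ f) y - euler x (euler x f) y - (n - 2) * euler x f y

/-- The product of the tangential gradients, scaled by `‖y - x‖²`. -/
def angGrad (f g : EuclideanSpace ℝ (Fin n) → ℝ) (y : EuclideanSpace ℝ (Fin n)) : ℝ :=
  ‖y - x‖ ^ 2 * ∑ i, pderiv i f y * pderiv i g y - euler x f y * euler x g y

theorem contDiff_normSq {m : WithTop ℕ∞} :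
    ContDiff ℝ m (fun y : EuclideanSpace ℝ (Fin n) => ‖y - x‖ ^ 2) :=
  (contDiff_id.sub contDiff_const).norm_sq ℝ

theorem contDiff_angLap {f : EuclideanSpace ℝ (Fin n) → ℝ} {m l : WithTop ℕ∞}
    (hf : ContDiff ℝ l f) (h : m + 2 ≤ l) : ContDiff ℝ m (angLap x f) := by
  have h' : m + 1 + 1 ≤ l := by rw [add_assoc]; convert h using 2; norm_num
  have he : ContDiff ℝ (m + 1) (euler x f) := contDiff_euler x hf h'
  exact (((contDiff_normSq x).mul (contDiff_laplacian hf h)).sub (contDiff_euler x he le_rfl)).sub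
    (contDiff_const.mul (he.of_le (by simp)))

theorem continuous_pderiv (i : Fin n) {f : EuclideanSpace ℝ (Fin n) → ℝ} (hf : ContDiff ℝ 1 f) :
    Continuous (pderiv i f) := (contDiff_pderiv (m := 0) i hf (by norm_num)).continuous

theorem continuous_euler {f : EuclideanSpace ℝ (Fin n) → ℝ} (hf : ContDiff ℝ 1 f) :
    Continuous (euler x f) := (contDiff_euler x (m := 0) hf (by norm_num)).continuous

theorem continuous_angGrad {f g : EuclideanSpace ℝ (Fin n) → ℝ} (hf : ContDiff ℝ 1 f)
    (hg : ContDiff ℝ 1 g) : Continuous (angGrad x f g) := by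
  have h1 := fun i => continuous_pderiv i hf
  have h2 := fun i => continuous_pderiv i hg
  have h3 := continuous_euler x hf
  have h4 := continuous_euler x hg
  unfold angGrad
  fun_prop

theorem sum_coord_mul_euler_pderiv {g : EuclideanSpace ℝ (Fin n) → ℝ} (hg : ContDiff ℝ 2 g)
    (y : EuclideanSpace ℝ (Fin n)) :
    ∑ i, (y - x) i * euler x (pderiv i g) y = euler x (euler x g) y - euler x g y := by
  rw [euler_eq_sum x (euler x g), euler_eq_sum x g, ← Finset.sum_sub_distrib]
  refine Finset.sum_congr rfl fun i _ => ?_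
  rw [pderiv_euler x i hg]; ring

/-- Integration by parts on the sphere. -/
theorem sphereIntegral_mul_angLap [NeZero n] {f g : EuclideanSpace ℝ (Fin n) → ℝ}
    (hf : ContDiff ℝ 1 f) (hg : ContDiff ℝ 2 g) {t : ℝ} (ht : 0 < t) :
    sphereIntegral x (fun y => f y * angLap x g y) t = -sphereIntegral x (angGrad x f g) t := by
  have hg1 : ContDiff ℝ 1 g := hg.of_le (by norm_num)
  have hp : ∀ i : Fin n, ContDiff ℝ 1 (pderiv i g) := fun i => contDiff_pderiv i hg (by norm_num)
  have hfp : ∀ i : Fin n, ContDiff ℝ 1 (fun y => f y * pderiv i g y) := fun i => hf.mul (hp i)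
  have hco : ∀ i : Fin n, Continuous (fun y : EuclideanSpace ℝ (Fin n) => (y - x) i) :=
    fun i => (contDiff_coord x i (m := 0)).continuous
  -- The divergence theorem for the field f ∂ᵢg eᵢ, with t² written as ‖y - x‖². Summation over i
  -- assembles the two angular operators.
  have key : ∀ i : Fin n, sphereIntegral x (fun y =>
      ‖y - x‖ ^ 2 * pderiv i (fun y => f y * pderiv i g y) y
        - (y - x) i * euler x (fun y => f y * pderiv i g y) y
        - (n - 1) * ((f y * pderiv i g y) * (y - x) i)) t = 0 := by
    intro i
    have c1 := continuous_pderiv i (hfp i)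
    have c2 := continuous_euler x (hfp i)
    have c3 := (hfp i).continuous
    have c4 := hco i
    rw [sphereIntegral_sub x (by fun_prop) (by fun_prop),
      sphereIntegral_sub x (by fun_prop) (by fun_prop), sphereIntegral_const_mul,
      sphereIntegral_congr x (g := fun y =>
        t ^ 2 * pderiv i (fun y => f y * pderiv i g y) y) ht (fun y hy => by rw [hy]),
      sphereIntegral_const_mul, sphereIntegral_pderiv x i (hfp i) ht]
    ring
  have hsum := Finset.sum_eq_zero fun i (_ : i ∈ Finset.univ) => key i
  rw [← sphereIntegral_sum x _ fun i _ => by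
    have c1 := continuous_pderiv i (hfp i)
    have c2 := continuous_euler x (hfp i)
    have c3 := (hfp i).continuous
    have c4 := hco i
    fun_prop] at hsum
  have cl : Continuous (angLap x g) := (contDiff_angLap x (m := 0) hg (by norm_num)).continuous
  have hadd : sphereIntegral x (fun y => f y * angLap x g y + angGrad x f g y) t = 0 := by
    rw [← hsum]
    congr 1
    funext y
    have hd := hf.differentiable (by norm_num) y
    have hdp := fun i => (hp i).differentiable (by norm_num) y
    have e1 : ∀ i, ‖y - x‖ ^ 2 * pderiv i (fun y => f y * pderiv i g y) y
        - (y - x) i * euler x (fun y => f y * pderiv i g y) y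
        - (n - 1) * ((f y * pderiv i g y) * (y - x) i) =
        ‖y - x‖ ^ 2 * (pderiv i f y * pderiv i g y) +
          (f y * ‖y - x‖ ^ 2) * pderiv i (pderiv i g) y
        - euler x f y * ((y - x) i * pderiv i g y)
        - f y * ((y - x) i * euler x (pderiv i g) y)
        - ((n - 1) * f y) * ((y - x) i * pderiv i g y) := by
      intro i
      rw [pderiv_mul i hd (hdp i), euler_mul x hd (hdp i)]
      ring
    simp only [e1, Finset.sum_add_distrib, Finset.sum_sub_distrib, ← Finset.mul_sum]
    rw [sum_coord_mul_euler_pderiv x hg, ← laplacian_eq_sum hg, ← euler_eq_sum x g, angLap, angGrad]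
    ring
  have cf := hf.continuous
  rw [sphereIntegral_add x (by fun_prop) (continuous_angGrad x hf hg1)] at hadd
  linarith

theorem angGrad_comm (f g : EuclideanSpace ℝ (Fin n) → ℝ) : angGrad x f g = angGrad x g f := by
  funext y
  simp only [angGrad, mul_comm]

/-- Cauchy–Schwarz for the Euler derivative (y - x)·∇f. -/
theorem angGrad_self_nonneg (f : EuclideanSpace ℝ (Fin n) → ℝ) (y : EuclideanSpace ℝ (Fin n)) :
    0 ≤ angGrad x f f y := by
  have h := Finset.sum_mul_sq_le_sq_mul_sq Finset.univ (fun i => (y - x) i) (fun i => pderiv i f y)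
  rw [← euler_eq_sum, ← norm_sub_sq_eq_sum] at h
  simp only [angGrad, ← pow_two]
  linarith

theorem euler_normSq_mul {f : EuclideanSpace ℝ (Fin n) → ℝ} {y : EuclideanSpace ℝ (Fin n)}
    (hf : DifferentiableAt ℝ f y) :
    euler x (fun z => ‖z - x‖ ^ 2 * f z) y = ‖y - x‖ ^ 2 * (euler x f y + 2 * f y) := by
  have h1 : HasFDerivAt (fun y : EuclideanSpace ℝ (Fin n) => ‖y - x‖ ^ 2)
      (2 • (innerSL ℝ (y - x)).comp (ContinuousLinearMap.id ℝ _)) y :=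
    ((hasFDerivAt_id y).sub_const x).norm_sq
  have h2 : euler x (fun y => ‖y - x‖ ^ 2) y = 2 * ‖y - x‖ ^ 2 := by
    rw [euler, h1.fderiv]
    rw [_root_.smul_apply, ContinuousLinearMap.comp_id, innerSL_apply_apply,
      real_inner_self_eq_norm_sq]
    simp
  rw [euler_mul x h1.differentiableAt hf, h2]
  ring

theorem pderiv_normSq (i : Fin n) (y : EuclideanSpace ℝ (Fin n)) :
    pderiv i (fun z => ‖z - x‖ ^ 2) y = 2 * (y - x) i := by
  have h1 : HasFDerivAt (fun y : EuclideanSpace ℝ (Fin n) => ‖y - x‖ ^ 2)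
      (2 • (innerSL ℝ (y - x)).comp (ContinuousLinearMap.id ℝ _)) y :=
    ((hasFDerivAt_id y).sub_const x).norm_sq
  rw [pderiv, h1.fderiv]
  simp [EuclideanSpace.inner_single_right]

theorem laplacian_normSq_mul {f : EuclideanSpace ℝ (Fin n) → ℝ} (hf : ContDiff ℝ 2 f)
    (y : EuclideanSpace ℝ (Fin n)) :
    (Δ (fun z => ‖z - x‖ ^ 2 * f z)) y =
      ‖y - x‖ ^ 2 * (Δ f) y + 4 * euler x f y + 2 * n * f y := by
  have hN : ∀ y, DifferentiableAt ℝ (fun z : EuclideanSpace ℝ (Fin n) => ‖z - x‖ ^ 2) y :=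
    fun y => (contDiff_normSq x (m := 1)).differentiable (by norm_num) y
  have hf' := hf.differentiable (by norm_num)
  have hp : ∀ i : Fin n, Differentiable ℝ (pderiv i f) := fun i =>
    (contDiff_pderiv (m := 1) i hf (by norm_num)).differentiable (by norm_num)
  have hco : ∀ i : Fin n, Differentiable ℝ (fun z : EuclideanSpace ℝ (Fin n) => (z - x) i) :=
    fun i => (contDiff_coord x i (m := 1)).differentiable (by norm_num)
  have hpc : ∀ i : Fin n, pderiv i (fun z : EuclideanSpace ℝ (Fin n) => (z - x) i) y = 1 := by
    intro i
    rw [pderiv, (hasFDerivAt_coord x i y).fderiv]; simp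
  have e : ∀ i, pderiv i (pderiv i (fun z => ‖z - x‖ ^ 2 * f z)) y =
      ‖y - x‖ ^ 2 * pderiv i (pderiv i f) y + 4 * ((y - x) i * pderiv i f y) + 2 * f y := by
    intro i
    have e1 : pderiv i (fun z => ‖z - x‖ ^ 2 * f z) =
        fun z => (2 * (z - x) i) * f z + ‖z - x‖ ^ 2 * pderiv i f z := by
      funext z
      rw [pderiv_mul i (hN z) (hf' z), pderiv_normSq]
    have hc2 : DifferentiableAt ℝ (fun z : EuclideanSpace ℝ (Fin n) => 2 * (z - x) i) y :=
      (hco i y).const_mul 2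
    rw [e1, pderiv_add i (hc2.fun_mul (hf' y)) ((hN y).fun_mul (hp i y)), pderiv_mul i hc2 (hf' y),
      pderiv_mul i (hN y) (hp i y), pderiv_normSq, pderiv_const_mul i 2 (hco i y), hpc]
    ring
  rw [laplacian_eq_sum ((contDiff_normSq x).mul hf), laplacian_eq_sum hf, euler_eq_sum]
  simp only [e, Finset.sum_add_distrib, ← Finset.mul_sum]
  simp
  ring

/-- The factor is radial, and `angLap` differentiates only along spheres. -/
theorem angLap_normSq_mul {f : EuclideanSpace ℝ (Fin n) → ℝ} (hf : ContDiff ℝ 2 f)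
    (y : EuclideanSpace ℝ (Fin n)) :
    angLap x (fun z => ‖z - x‖ ^ 2 * f z) y = ‖y - x‖ ^ 2 * angLap x f y := by
  have hf' := hf.differentiable (by norm_num)
  have he : Differentiable ℝ (euler x f) :=
    (contDiff_euler x (m := 1) hf (by norm_num)).differentiable (by norm_num)
  have e1 : euler x (fun z => ‖z - x‖ ^ 2 * f z) =
      fun z => ‖z - x‖ ^ 2 * (euler x f z + 2 * f z) := funext fun z => euler_normSq_mul x (hf' z)
  rw [angLap, laplacian_normSq_mul x hf, e1,
    euler_normSq_mul x ((he y).fun_add ((hf' y).const_mul 2)),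
    euler_add x (he y) ((hf' y).const_mul 2), euler_const_mul x 2 (hf' y), angLap]
  ring

/-- The only commutator to check is that of the Euler operator E with r²Δ: E produces 2 from the
factor r², and the commutator [Δ, E] = 2Δ produces the same 2. -/
theorem euler_angLap {f : EuclideanSpace ℝ (Fin n) → ℝ} (hf : ContDiff ℝ 3 f)
    (y : EuclideanSpace ℝ (Fin n)) : euler x (angLap x f) y = angLap x (euler x f) y := by
  have he : ContDiff ℝ 2 (euler x f) := contDiff_euler x hf (by norm_num)
  have hee : ContDiff ℝ 1 (euler x (euler x f)) := contDiff_euler x he (by norm_num)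
  have hl : ContDiff ℝ 1 (Δ f) := contDiff_laplacian hf (by norm_num)
  have d1 := (hee.differentiable (by norm_num) y)
  have d2 := (he.differentiable (by norm_num) y)
  have d3 := (hl.differentiable (by norm_num) y)
  have d4 : DifferentiableAt ℝ (fun z => ‖z - x‖ ^ 2 * (Δ f) z) y :=
    (((contDiff_normSq x).mul hl).differentiable (by norm_num) y)
  have e : angLap x f = fun z => (‖z - x‖ ^ 2 * (Δ f) z + (-1) * euler x (euler x f) z) +
      (-(n - 2)) * euler x f z := by
    funext z; rw [angLap]; ring
  rw [e, euler_add x (d4.fun_add (d1.const_mul _)) (d2.const_mul _), euler_add x d4 (d1.const_mul _),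
    euler_normSq_mul x d3, euler_const_mul x _ d1, euler_const_mul x _ d2, angLap,
    laplacian_euler x hf]
  ring

theorem angLap_add {f g : EuclideanSpace ℝ (Fin n) → ℝ} (hf : ContDiff ℝ 2 f)
    (hg : ContDiff ℝ 2 g) (y : EuclideanSpace ℝ (Fin n)) :
    angLap x (fun z => f z + g z) y = angLap x f y + angLap x g y := by
  have e : euler x (fun z => f z + g z) = fun z => euler x f z + euler x g z :=
    funext fun z => euler_add x (hf.differentiable (by norm_num) z)
      (hg.differentiable (by norm_num) z)
  have hl : (Δ (fun z => f z + g z)) y = (Δ f) y + (Δ g) y :=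
    ContDiffAt.laplacian_add hf.contDiffAt hg.contDiffAt
  rw [angLap, hl, e, euler_add x
    ((contDiff_euler x (m := 1) hf (by norm_num)).differentiable (by norm_num) y)
    ((contDiff_euler x (m := 1) hg (by norm_num)).differentiable (by norm_num) y), angLap, angLap]
  ring

theorem angLap_const_mul (c : ℝ) {f : EuclideanSpace ℝ (Fin n) → ℝ} (hf : ContDiff ℝ 2 f)
    (y : EuclideanSpace ℝ (Fin n)) :
    angLap x (fun z => c * f z) y = c * angLap x f y := by
  have e : euler x (fun z => c * f z) = fun z => c * euler x f z :=
    funext fun z => euler_const_mul x c (hf.differentiable (by norm_num) z)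
  have hl : (Δ (fun z => c * f z)) y = c * (Δ f) y :=
    InnerProductSpace.laplacian_smul c hf.contDiffAt
  rw [angLap, hl, e, euler_const_mul x c
    ((contDiff_euler x (m := 1) hf (by norm_num)).differentiable (by norm_num) y), angLap]
  ring

end Angular

/-! ### The Pohozaev identity -/

section Pohozaev

variable {n : ℕ} (x : EuclideanSpace ℝ (Fin n))

/-- The generator `f ↦ k f + (y - x) · ∇f` of the scaling `f ↦ t^k f (x + t ·)`. -/
def scaling (k : ℝ) (f : EuclideanSpace ℝ (Fin n) → ℝ) (y : EuclideanSpace ℝ (Fin n)) : ℝ :=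
  k * f y + euler x f y

theorem contDiff_scaling (k : ℝ) {f : EuclideanSpace ℝ (Fin n) → ℝ} {m l : WithTop ℕ∞}
    (hf : ContDiff ℝ l f) (h : m + 1 ≤ l) : ContDiff ℝ m (scaling x k f) :=
  (contDiff_const.mul (hf.of_le (le_trans (by simp) h))).add (contDiff_euler x hf h)

theorem scaling_angLap (k : ℝ) {f : EuclideanSpace ℝ (Fin n) → ℝ} (hf : ContDiff ℝ 3 f)
    (y : EuclideanSpace ℝ (Fin n)) :
    scaling x k (angLap x f) y = angLap x (scaling x k f) y := by
  have h2 : ContDiff ℝ 2 f := hf.of_le (by norm_num)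
  have he : ContDiff ℝ 2 (euler x f) := contDiff_euler x hf (by norm_num)
  have e : scaling x k f = fun z => k * f z + euler x f z := rfl
  rw [e, angLap_add x (contDiff_const.mul h2) he, angLap_const_mul x k h2, scaling,
    euler_angLap x hf]

/-- The divergence theorem in differentiated form: the left function is the flux of f∇g through the
sphere of radius r (the Euler operator is r∂ᵣ, hence the power n - 2), and div(f∇g) is the integrand
on the right. It follows from Green's formula on the sphere once r²Δ is rewritten through `angLap`.
-/
theorem hasDerivAt_flux (hn : 3 ≤ n) {f g : EuclideanSpace ℝ (Fin n) → ℝ} (hf : ContDiff ℝ 1 f)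
    (hg : ContDiff ℝ 2 g) {t : ℝ} (ht : 0 < t) :
    HasDerivAt (fun r => r ^ (n - 2) * sphereIntegral x (fun y => f y * euler x g y) r)
      (t ^ (n - 1) *
        sphereIntegral x (fun y => ∑ i, pderiv i f y * pderiv i g y + f y * (Δ g) y) t) t := by
  have : NeZero n := ⟨by omega⟩
  have he : ContDiff ℝ 1 (euler x g) := contDiff_euler x hg (by norm_num)
  have hg1 : ContDiff ℝ 1 g := hg.of_le (by norm_num)
  have hfe : ContDiff ℝ 1 (fun y => f y * euler x g y) := hf.mul he
  have hd := (hasDerivAt_pow (n - 2) t).mul (hasDerivAt_sphereIntegral x hfe ht)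
  refine hd.congr_deriv ?_
  have c0 := hf.continuous
  have c1 := he.continuous
  have c2 := continuous_euler x hfe
  have c3 := continuous_angGrad x hf hg1
  have c4 : Continuous (angLap x g) := (contDiff_angLap x (m := 0) hg (by norm_num)).continuous
  have key : (n - 2) * sphereIntegral x (fun y => f y * euler x g y) t
      + sphereIntegral x (euler x (fun y => f y * euler x g y)) t =
      t ^ 2 * sphereIntegral x (fun y => ∑ i, pderiv i f y * pderiv i g y + f y * (Δ g) y) t := by
    have h1 := sphereIntegral_mul_angLap x hf hg ht
    have h2 : sphereIntegral x (fun y => ‖y - x‖ ^ 2 *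
        (∑ i, pderiv i f y * pderiv i g y + f y * (Δ g) y)) t =
        t ^ 2 * sphereIntegral x (fun y => ∑ i, pderiv i f y * pderiv i g y + f y * (Δ g) y) t := by
      rw [← sphereIntegral_const_mul]
      exact sphereIntegral_congr x ht fun y hy => by rw [hy]
    rw [← h2, ← sphereIntegral_const_mul, ← sphereIntegral_add x (by fun_prop) c2]
    have h3 : sphereIntegral x (fun y => f y * angLap x g y + angGrad x f g y) t = 0 := by
      rw [sphereIntegral_add x (by fun_prop) c3, h1]; ring
    have h4 := sphereIntegral_add x (f := fun y => ((n : ℝ) - 2) * (f y * euler x g y)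
      + euler x (fun y => f y * euler x g y) y)
      (g := fun y => f y * angLap x g y + angGrad x f g y) (by fun_prop) (by fun_prop) t
    rw [h3, add_zero] at h4
    rw [← h4]
    congr 1
    funext y
    rw [euler_mul x (hf.differentiable (by norm_num) y) (he.differentiable (by norm_num) y),
      angLap, angGrad]
    ring
  obtain ⟨l, rfl⟩ : ∃ l, n = l + 3 := ⟨n - 3, by omega⟩
  have e1 : l + 3 - 2 = l + 1 := by omega
  have e2 : l + 3 - 1 = l + 2 := by omega
  rw [e1, e2]
  push_cast at key ⊢
  have ht' := ht.ne'
  have : t ^ (l + 1) * (t⁻¹ * sphereIntegral x (euler x (fun y => f y * euler x g y)) t) =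
      t ^ l * sphereIntegral x (euler x (fun y => f y * euler x g y)) t := by
    field_simp
    ring
  rw [this]
  linear_combination t ^ l * key

/-- The same flux principle for the radial field g(y)(y - x). -/
theorem hasDerivAt_pow_mul_sphereIntegral (hn : 1 ≤ n) {g : EuclideanSpace ℝ (Fin n) → ℝ}
    (hg : ContDiff ℝ 1 g) {t : ℝ} (ht : 0 < t) :
    HasDerivAt (fun r => r ^ n * sphereIntegral x g r)
      (t ^ (n - 1) * sphereIntegral x (fun y => n * g y + euler x g y) t) t := by
  have hd := (hasDerivAt_pow n t).mul (hasDerivAt_sphereIntegral x hg ht)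
  refine hd.congr_deriv ?_
  have c1 := hg.continuous
  rw [sphereIntegral_add x (by fun_prop) (continuous_euler x hg), sphereIntegral_const_mul]
  obtain ⟨l, rfl⟩ : ∃ l, n = l + 1 := ⟨n - 1, by omega⟩
  have ht' := ht.ne'
  simp only [Nat.add_sub_cancel]
  field_simp
  ring

theorem contDiff_abs_rpow {q : ℝ} (hq : 1 < q) {u : EuclideanSpace ℝ (Fin n) → ℝ}
    (hu : ContDiff ℝ 1 u) : ContDiff ℝ 1 (fun y => |u y| ^ q) := by
  have := hu.norm_rpow hq
  simpa using this

theorem euler_abs_rpow {p : ℝ} (hp : 1 < p) {u : EuclideanSpace ℝ (Fin n) → ℝ}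
    {y : EuclideanSpace ℝ (Fin n)} (hu : DifferentiableAt ℝ u y) :
    euler x (fun y => |u y| ^ (p + 1)) y = (p + 1) * (|u y| ^ (p - 1) * u y * euler x u y) := by
  have h := (hasDerivAt_abs_rpow (u y) (p := p + 1) (by linarith)).comp_hasFDerivAt y hu.hasFDerivAt
  rw [euler]
  erw [h.fderiv]
  rw [_root_.smul_apply, smul_eq_mul, euler, show p + 1 - 2 = p - 1 by ring]
  ring

theorem abs_rpow_add_one {p : ℝ} (hp : 1 < p) (a : ℝ) : |a| ^ (p + 1) = |a| ^ (p - 1) * a * a := by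
  rcases eq_or_ne a 0 with rfl | ha
  · simp [Real.zero_rpow (by linarith : p + 1 ≠ 0)]
  · rw [show p + 1 = (p - 1) + (2 : ℕ) by push_cast; ring,
      Real.rpow_add_natCast (abs_ne_zero.mpr ha), sq_abs]
    ring

/-- The integrand of the energy. -/
def lagrangian (p : ℝ) (u : EuclideanSpace ℝ (Fin n) → ℝ) (y : EuclideanSpace ℝ (Fin n)) : ℝ :=
  1 / 2 * ‖gradient (Δ u) y‖ ^ 2 - 1 / (p + 1) * |u y| ^ (p + 1)

/-- The boundary integrand in the Pohozaev identity. -/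
def pohozaevFlux (k : ℝ) (u : EuclideanSpace ℝ (Fin n) → ℝ) (y : EuclideanSpace ℝ (Fin n)) : ℝ :=
  scaling x (k + 2) (Δ u) y * euler x (Δ u) y
    - (Δ (Δ u)) y * euler x (scaling x k u) y + scaling x k u y * euler x (Δ (Δ u)) y

theorem contDiff_normSq_gradient {v : EuclideanSpace ℝ (Fin n) → ℝ} (hv : ContDiff ℝ 2 v) :
    ContDiff ℝ 1 (fun y => ‖gradient v y‖ ^ 2) := by
  simp only [norm_gradient_sq]
  exact ContDiff.sum fun i _ => (contDiff_pderiv i hv (by norm_num)).pow 2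

theorem contDiff_lagrangian {p : ℝ} (hp : 1 < p) {u : EuclideanSpace ℝ (Fin n) → ℝ}
    (hu : ContDiff ℝ 6 u) : ContDiff ℝ 1 (lagrangian p u) :=
  (contDiff_const.mul (contDiff_normSq_gradient (contDiff_laplacian hu (by norm_num)))).sub
    (contDiff_const.mul (contDiff_abs_rpow (by linarith) (hu.of_le (by norm_num))))

/-- The equation is tested with ψ = `scaling x k u`. Since Δψ = `scaling x (k + 2) (Δ u)`, the
products of Δ²u with Δψ cancel, and so do those of ∇Δ²u with ∇ψ. The gradient part and the power
part of the Lagrangian get the same weight because 2k + 6 = k(p + 1). -/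
theorem lagrangian_identity {p k : ℝ} (hp : 1 < p) (hk : k * (p - 1) = 6)
    {u : EuclideanSpace ℝ (Fin n) → ℝ} (hu : IsSolution n p u) (y : EuclideanSpace ℝ (Fin n)) :
    (∑ i, pderiv i (scaling x (k + 2) (Δ u)) y * pderiv i (Δ u) y
        + scaling x (k + 2) (Δ u) y * (Δ (Δ u)) y)
      - (∑ i, pderiv i (Δ (Δ u)) y * pderiv i (scaling x k u) y
        + (Δ (Δ u)) y * (Δ (scaling x k u)) y)
      + (∑ i, pderiv i (scaling x k u) y * pderiv i (Δ (Δ u)) y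
        + scaling x k u y * (Δ (Δ (Δ u))) y)
      - (n * lagrangian p u y + euler x (lagrangian p u) y) =
      (2 * k + 6 - n) * lagrangian p u y := by
  obtain ⟨hu6, heq⟩ := hu
  have hv : ContDiff ℝ 4 (Δ u) := contDiff_laplacian hu6 (by norm_num)
  have hv2 : ContDiff ℝ 2 (Δ u) := hv.of_le (by norm_num)
  have hu2 : ContDiff ℝ 2 u := hu6.of_le (by norm_num)
  have hu3 : ContDiff ℝ 3 u := hu6.of_le (by norm_num)
  have hud := hu6.differentiable (by norm_num) y
  have hvd := hv.differentiable (by norm_num)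
  have hpd : ∀ i, DifferentiableAt ℝ (pderiv i (Δ u)) y := fun i =>
    (contDiff_pderiv (m := 1) i hv (by norm_num)).differentiable (by norm_num) y
  have hG : ContDiff ℝ 1 (fun y => ‖gradient (Δ u) y‖ ^ 2) := contDiff_normSq_gradient hv2
  have hU : ContDiff ℝ 1 (fun y => |u y| ^ (p + 1)) :=
    contDiff_abs_rpow (by linarith) (hu6.of_le (by norm_num))
  have hGd := hG.differentiable (by norm_num) y
  have hUd := hU.differentiable (by norm_num) y
  have e1 : ∀ i, pderiv i (scaling x (k + 2) (Δ u)) y =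
      (k + 3) * pderiv i (Δ u) y + euler x (pderiv i (Δ u)) y := by
    intro i
    have : scaling x (k + 2) (Δ u) = fun z => (k + 2) * (Δ u) z + euler x (Δ u) z := rfl
    rw [this, pderiv_add i ((hvd y).const_mul _)
      ((contDiff_euler x (m := 1) hv (by norm_num)).differentiable (by norm_num) y),
      pderiv_const_mul i _ (hvd y), pderiv_euler x i hv2]
    ring
  have e2 : euler x (fun y => ‖gradient (Δ u) y‖ ^ 2) y =
      2 * ∑ i, euler x (pderiv i (Δ u)) y * pderiv i (Δ u) y := by
    simp only [norm_gradient_sq]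
    simp only [pow_two]
    rw [euler_sum x _ fun i _ => (hpd i).fun_mul (hpd i), Finset.mul_sum]
    refine Finset.sum_congr rfl fun i _ => ?_
    rw [euler_mul x (hpd i) (hpd i)]; ring
  have e3 : euler x (lagrangian p u) y =
      (∑ i, euler x (pderiv i (Δ u)) y * pderiv i (Δ u) y)
        - |u y| ^ (p - 1) * u y * euler x u y := by
    have : lagrangian p u = fun z => 1 / 2 * ‖gradient (Δ u) z‖ ^ 2 +
        (-(1 / (p + 1))) * |u z| ^ (p + 1) := by
      funext z; rw [lagrangian]; ring
    rw [this, euler_add x (hGd.const_mul _) (hUd.const_mul _), euler_const_mul x _ hGd,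
      euler_const_mul x _ hUd, e2, euler_abs_rpow x hp hud]
    have : p + 1 ≠ 0 := by linarith
    field_simp
    ring
  have e4 : (Δ (scaling x k u)) y = scaling x (k + 2) (Δ u) y := by
    have h1 : (Δ (scaling x k u)) y = (Δ (fun z => k * u z)) y + (Δ (euler x u)) y :=
      ContDiffAt.laplacian_add (contDiff_const.mul hu2).contDiffAt
        (contDiff_euler x hu3 (m := 2) (by norm_num)).contDiffAt
    have h2 : (Δ (fun z => k * u z)) y = k * (Δ u) y :=
      InnerProductSpace.laplacian_smul k hu2.contDiffAt
    rw [h1, h2, laplacian_euler x hu3, scaling]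
    ring
  have e5 : (Δ (Δ (Δ u))) y = -(|u y| ^ (p - 1) * u y) := by rw [← heq y]; simp
  have e6 : ∑ i, pderiv i (scaling x (k + 2) (Δ u)) y * pderiv i (Δ u) y =
      (k + 3) * ‖gradient (Δ u) y‖ ^ 2 + ∑ i, euler x (pderiv i (Δ u)) y * pderiv i (Δ u) y := by
    rw [norm_gradient_sq, Finset.mul_sum, ← Finset.sum_add_distrib]
    refine Finset.sum_congr rfl fun i _ => ?_
    rw [e1]; ring
  have e7 : ∑ i, pderiv i (Δ (Δ u)) y * pderiv i (scaling x k u) y =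
      ∑ i, pderiv i (scaling x k u) y * pderiv i (Δ (Δ u)) y :=
    Finset.sum_congr rfl fun i _ => mul_comm _ _
  rw [e6, e7, e3, e4, e5, lagrangian, abs_rpow_add_one hp, scaling, scaling]
  have hp1 : p + 1 ≠ 0 := by linarith
  have hkp : 2 * k + 6 = k * (p + 1) := by linarith
  have : 1 / (p + 1) * (|u y| ^ (p - 1) * u y * u y) * (2 * k + 6) =
      k * (|u y| ^ (p - 1) * u y * u y) := by
    rw [hkp]; field_simp
  linear_combination this

theorem continuous_pohozaevFlux (k : ℝ) {u : EuclideanSpace ℝ (Fin n) → ℝ} (hu : ContDiff ℝ 6 u) :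
    Continuous (pohozaevFlux x k u) := by
  have hv : ContDiff ℝ 4 (Δ u) := contDiff_laplacian hu (by norm_num)
  have hw : ContDiff ℝ 2 (Δ (Δ u)) := contDiff_laplacian hv (by norm_num)
  have hψ : ContDiff ℝ 5 (scaling x k u) := contDiff_scaling x k hu (by norm_num)
  have c1 := continuous_euler x (hv.of_le (by norm_num))
  have c2 := continuous_euler x (hw.of_le (by norm_num))
  have c3 := continuous_euler x (hψ.of_le (by norm_num))
  have c4 := hψ.continuous
  have c5 := hw.continuous
  have c6 : Continuous (scaling x (k + 2) (Δ u)) :=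
    (contDiff_scaling x (m := 3) _ hv (by norm_num)).continuous
  unfold pohozaevFlux
  fun_prop

/-- The right-hand side `Φ` vanishes at t = 0, where n ≥ 3 makes both powers of t vanish. Its
derivative is (2k + 6 - n) times the Lagrangian on the sphere, by the flux lemmas and
`lagrangian_identity`; integrate from 0 to t. -/
theorem pohozaev (hn : 3 ≤ n) {p k : ℝ} (hp : 1 < p) (hk : k * (p - 1) = 6)
    {u : EuclideanSpace ℝ (Fin n) → ℝ} (hu : IsSolution n p u) {t : ℝ} (ht : 0 < t) :
    (2 * k + 6 - n) * ∫ y in ball x t, lagrangian p u y =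
      t ^ (n - 2) * sphereIntegral x (pohozaevFlux x k u) t
        - t ^ n * sphereIntegral x (lagrangian p u) t := by
  have : NeZero n := ⟨by omega⟩
  have hu6 := hu.1
  have hv : ContDiff ℝ 4 (Δ u) := contDiff_laplacian hu6 (by norm_num)
  have hw : ContDiff ℝ 2 (Δ (Δ u)) := contDiff_laplacian hv (by norm_num)
  have hψ : ContDiff ℝ 5 (scaling x k u) := contDiff_scaling x k hu6 (by norm_num)
  have hv' : ContDiff ℝ 3 (scaling x (k + 2) (Δ u)) := contDiff_scaling x _ hv (by norm_num)
  have hL := contDiff_lagrangian hp hu6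
  have cv : Continuous (Δ (Δ (Δ u))) := (contDiff_laplacian (m := 0) hw (by norm_num)).continuous
  have cψ2 : Continuous (Δ (scaling x k u)) :=
    (contDiff_laplacian (m := 3) hψ (by norm_num)).continuous
  have c1 := fun i => continuous_pderiv i (hv.of_le (by norm_num))
  have c2 := fun i => continuous_pderiv i (hw.of_le (by norm_num))
  have c3 := fun i => continuous_pderiv i (hψ.of_le (by norm_num))
  have c4 := fun i => continuous_pderiv i (hv'.of_le (by norm_num))
  have c5 := hψ.continuous
  have c6 := hw.continuous
  have c7 := hv'.continuous
  have c8 := hL.continuous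
  have c9 := continuous_euler x hL
  have b1 := continuous_euler x (hv.of_le (by norm_num))
  have b2 := continuous_euler x (hw.of_le (by norm_num))
  have b3 := continuous_euler x (hψ.of_le (by norm_num))
  let Φ : ℝ → ℝ := fun r => r ^ (n - 2) * sphereIntegral x (pohozaevFlux x k u) r
    - r ^ n * sphereIntegral x (lagrangian p u) r
  have hΦc : Continuous Φ :=
    ((continuous_pow _).mul (continuous_sphereIntegral x (continuous_pohozaevFlux x k hu6))).sub
      ((continuous_pow _).mul (continuous_sphereIntegral x hL.continuous))
  have hΦ0 : Φ 0 = 0 := by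
    simp only [Φ]
    rw [zero_pow (by omega), zero_pow (by omega)]; ring
  have hΦd : ∀ r : ℝ, 0 < r → HasDerivAt Φ
      ((2 * k + 6 - n) * (r ^ (n - 1) * sphereIntegral x (lagrangian p u) r)) r := by
    intro r hr
    have h1 := hasDerivAt_flux x hn (hv'.of_le (by norm_num)) (hv.of_le (by norm_num)) hr
    have h2 := hasDerivAt_flux x hn (hw.of_le (by norm_num)) (hψ.of_le (by norm_num)) hr
    have h3 := hasDerivAt_flux x hn (hψ.of_le (by norm_num)) hw hr
    have h4 := hasDerivAt_pow_mul_sphereIntegral x (by omega) hL hr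
    have h := ((h1.sub h2).add h3).sub h4
    have hE : Φ = (((fun r => r ^ (n - 2) * sphereIntegral x (fun y =>
        scaling x (k + 2) (Δ u) y * euler x (Δ u) y) r) - fun r => r ^ (n - 2) *
        sphereIntegral x (fun y => (Δ (Δ u)) y * euler x (scaling x k u) y) r) +
        fun r => r ^ (n - 2) * sphereIntegral x (fun y =>
        scaling x k u y * euler x (Δ (Δ u)) y) r) -
        fun r => r ^ n * sphereIntegral x (lagrangian p u) r := by
      funext r
      have e : pohozaevFlux x k u = fun y => scaling x (k + 2) (Δ u) y * euler x (Δ u) y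
          - (Δ (Δ u)) y * euler x (scaling x k u) y
          + scaling x k u y * euler x (Δ (Δ u)) y := rfl
      simp only [Φ, Pi.sub_apply, Pi.add_apply, e]
      rw [sphereIntegral_add x (by fun_prop) (by fun_prop),
        sphereIntegral_sub x (by fun_prop) (by fun_prop)]
      ring
    rw [hE]
    refine h.congr_deriv ?_
    rw [← mul_sub, ← mul_add, ← mul_sub, ← sphereIntegral_sub x (by fun_prop) (by fun_prop),
      ← sphereIntegral_add x (by fun_prop) (by fun_prop),
      ← sphereIntegral_sub x (by fun_prop) (by fun_prop)]
    simp only [lagrangian_identity x hp hk hu]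
    rw [sphereIntegral_const_mul]
    ring
  have hci : Continuous fun r : ℝ => (2 * k + 6 - n) *
      (r ^ (n - 1) * sphereIntegral x (lagrangian p u) r) :=
    continuous_const.mul ((continuous_pow _).mul (continuous_sphereIntegral x hL.continuous))
  have hint := intervalIntegral.integral_eq_sub_of_hasDerivAt_of_le ht.le hΦc.continuousOn
    (fun r hr => hΦd r hr.1) (hci.intervalIntegrable 0 t)
  rw [hΦ0, sub_zero, intervalIntegral.integral_const_mul, ← integral_ball_eq x hL.continuous ht.le]
    at hint
  exact hint

/-- Differentiating the power brings out exactly the multiple of the bulk integral that `pohozaev`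
evaluates. The Lagrangian on the sphere that results cancels the derivative of the ball integral, so
only the flux survives. -/
theorem hasDerivAt_bulk (hn : 3 ≤ n) {p k : ℝ} (hp : 1 < p) (hk : k * (p - 1) = 6)
    {u : EuclideanSpace ℝ (Fin n) → ℝ} (hu : IsSolution n p u) {t : ℝ} (ht : 0 < t) :
    HasDerivAt (fun s => s ^ (2 * k + 6 - n) * ∫ y in ball x s, lagrangian p u y)
      (t⁻¹ * (t ^ (2 * k) *
        sphereIntegral x (fun y => ‖y - x‖ ^ 4 * pohozaevFlux x k u y) t)) t := by
  have : NeZero n := ⟨by omega⟩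
  have hL := contDiff_lagrangian hp hu.1
  have h := (Real.hasDerivAt_rpow_const (x := t) (p := 2 * k + 6 - n) (Or.inl ht.ne')).mul
    (hasDerivAt_integral_ball x hL.continuous ht)
  refine h.congr_deriv ?_
  have hP := pohozaev x hn hp hk hu ht
  rw [sphereIntegral_congr x (f := fun y => ‖y - x‖ ^ 4 * pohozaevFlux x k u y)
    (g := fun y => t ^ 4 * pohozaevFlux x k u y) ht (fun y hy => by rw [hy]), sphereIntegral_const_mul]
  have r1 : t ^ (2 * k + 6 - n - 1) = t ^ (2 * k) * t ^ 5 / t ^ n := by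
    rw [show 2 * k + 6 - n - 1 = 2 * k + (5 : ℕ) - (n : ℕ) by push_cast; ring,
      Real.rpow_sub_natCast ht.ne', Real.rpow_add_natCast ht.ne']
  have r2 : t ^ (2 * k + 6 - n) = t ^ (2 * k) * t ^ 6 / t ^ n := by
    rw [show 2 * k + 6 - n = 2 * k + (6 : ℕ) - (n : ℕ) by push_cast; ring,
      Real.rpow_sub_natCast ht.ne', Real.rpow_add_natCast ht.ne']
  rw [r1, r2]
  obtain ⟨l, hl⟩ : ∃ l, n = l + 3 := ⟨n - 3, by omega⟩
  have e1 : n - 2 = l + 1 := by omega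
  have e2 : n - 1 = l + 2 := by omega
  have e3 : t ^ n = t ^ (l + 3) := by rw [hl]
  rw [e1, e3] at hP
  rw [e2, e3]
  have ht' := ht.ne'
  have ee : (2 * k + 6 - n) * (t ^ (2 * k) * t ^ 5 / t ^ (l + 3)) * ∫ y in ball x t, lagrangian p u y
      = (t ^ (2 * k) * t ^ 5 / t ^ (l + 3)) *
        ((2 * k + 6 - n) * ∫ y in ball x t, lagrangian p u y) := by ring
  rw [ee, hP]
  field_simp
  ring

end Pohozaev

/-! ### Radial derivatives in terms of the Euler operator -/

section Radial

variable {n : ℕ} (x : EuclideanSpace ℝ (Fin n))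

theorem radialDeriv_eq (f : EuclideanSpace ℝ (Fin n) → ℝ) (y : EuclideanSpace ℝ (Fin n)) :
    radialDeriv x f y = ‖y - x‖⁻¹ * euler x f y := by
  simp [radialDeriv, euler]

theorem hasFDerivAt_inv_norm_pow (j : ℕ) {y : EuclideanSpace ℝ (Fin n)} (hy : y ≠ x) :
    DifferentiableAt ℝ (fun z : EuclideanSpace ℝ (Fin n) => ‖z - x‖⁻¹ ^ j) y ∧
      euler x (fun z => ‖z - x‖⁻¹ ^ j) y = -j * ‖y - x‖⁻¹ ^ j := by
  have hyx : y - x ≠ 0 := sub_ne_zero.mpr hy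
  have hn : ‖y - x‖ ≠ 0 := norm_ne_zero_iff.mpr hyx
  have hd : DifferentiableAt ℝ (fun y : EuclideanSpace ℝ (Fin n) => ‖y - x‖) y :=
    (differentiableAt_id.sub (differentiableAt_const x)).norm ℝ hyx
  have he : euler x (fun y => ‖y - x‖) y = ‖y - x‖ := by
    have h1 := euler_mul x hd hd
    have h2 := euler_normSq_mul x (f := fun _ => 1) (y := y) (differentiableAt_const _)
    have h3 : euler x (fun _ => (1 : ℝ)) y = 0 := by simp [euler]
    simp only [mul_one, h3, zero_add, pow_two] at h2
    rw [h2] at h1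
    have : ‖y - x‖ * (2 * euler x (fun y => ‖y - x‖) y) = ‖y - x‖ * (2 * ‖y - x‖) := by linarith
    have := mul_left_cancel₀ hn this
    linarith
  have hdi : DifferentiableAt ℝ (fun z : EuclideanSpace ℝ (Fin n) => ‖z - x‖⁻¹) y := hd.inv hn
  have hei : euler x (fun z => ‖z - x‖⁻¹) y = -‖y - x‖⁻¹ := by
    have hv := (hasDerivAt_inv hn).comp_hasFDerivAt y hd.hasFDerivAt
    rw [euler]
    erw [hv.fderiv]
    rw [_root_.smul_apply]
    change _ • euler x (fun y => ‖y - x‖) y = _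
    rw [he, smul_eq_mul]
    field_simp
  induction j with
  | zero => simp [euler]
  | succ j ih =>
    simp only [pow_succ]
    refine ⟨ih.1.mul hdi, ?_⟩
    rw [euler_mul x ih.1 hdi, ih.2, hei]
    push_cast
    ring

/-- The induction step behind r^j ∂ᵣ^j = E(E - 1)⋯(E - j + 1), with E the Euler operator. Values off
the centre suffice because differentiation is local. -/
theorem radialDeriv_of_eq {f g : EuclideanSpace ℝ (Fin n) → ℝ} (j : ℕ) (hg : Differentiable ℝ g)
    (hfg : ∀ y, y ≠ x → f y = ‖y - x‖⁻¹ ^ j * g y) {y : EuclideanSpace ℝ (Fin n)} (hy : y ≠ x) :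
    radialDeriv x f y = ‖y - x‖⁻¹ ^ (j + 1) * (euler x g y - j * g y) := by
  have h : f =ᶠ[𝓝 y] fun z => ‖z - x‖⁻¹ ^ j * g z := by
    filter_upwards [isOpen_compl_singleton.mem_nhds hy] with z hz using hfg z hz
  obtain ⟨h1, h2⟩ := hasFDerivAt_inv_norm_pow x j hy
  have he : euler x f y = euler x (fun z => ‖z - x‖⁻¹ ^ j * g z) y := by
    rw [euler, h.fderiv_eq, euler]
  rw [radialDeriv_eq, he, euler_mul x h1 (hg y), h2]
  ring

theorem euler_scaling (k : ℝ) {f : EuclideanSpace ℝ (Fin n) → ℝ}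
    (hf : Differentiable ℝ f) (he : Differentiable ℝ (euler x f)) :
    euler x (scaling x k f) = fun y => k * euler x f y + euler x (euler x f) y := by
  funext y
  have : scaling x k f = fun z => k * f z + euler x f z := rfl
  rw [this, euler_add x ((hf y).const_mul k) (he y), euler_const_mul x k (hf y)]

theorem euler_sub_const_mul (c : ℝ) {f g : EuclideanSpace ℝ (Fin n) → ℝ}
    (hf : Differentiable ℝ f) (hg : Differentiable ℝ g) :
    euler x (fun z => f z - c * g z) = fun y => euler x f y - c * euler x g y := by
  funext y
  have : (fun z => f z - c * g z) = fun z => f z + (-c) * g z := by funext z; ring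
  rw [this, euler_add x (hf y) ((hg y).const_mul _), euler_const_mul x _ (hg y)]
  ring

theorem contDiff_scaling_iterate (k : ℝ) {u : EuclideanSpace ℝ (Fin n) → ℝ} {m : ℕ}
    (hu : ContDiff ℝ m u) (j : ℕ) (hj : j ≤ m) :
    ContDiff ℝ ((m - j : ℕ) : WithTop ℕ∞) ((scaling x k)^[j] u) := by
  induction j with
  | zero => simpa using hu
  | succ j ih =>
    rw [Function.iterate_succ_apply']
    refine contDiff_scaling x k (ih (by omega)) ?_
    have : m - j = (m - (j + 1)) + 1 := by omega
    rw [this]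
    push_cast
    exact le_rfl

/-- The first four left-hand sides are t^j d^j/dt^j of the rescaled function, up to t^k. Since t^j
d^j/dt^j = D(D - 1)⋯(D - j + 1) with D = t d/dt, and D acts as `scaling x k`, the right-hand sides
are expanded falling factorials. The last identity is the polar form of the Laplacian. -/
theorem radialDeriv_iterates {u : EuclideanSpace ℝ (Fin n) → ℝ} (hu : ContDiff ℝ 6 u) (k : ℝ)
    {t : ℝ} (ht : 0 < t) {y : EuclideanSpace ℝ (Fin n)} (hy : ‖y - x‖ = t) :
    k * u y + t * radialDeriv x u y = scaling x k u y ∧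
    k * (k - 1) * u y + 2 * k * t * radialDeriv x u y + t ^ 2 * (radialDeriv x)^[2] u y =
      (scaling x k)^[2] u y - scaling x k u y ∧
    k * (k - 1) * (k - 2) * u y + 3 * k * (k - 1) * t * radialDeriv x u y
      + 3 * k * t ^ 2 * (radialDeriv x)^[2] u y + t ^ 3 * (radialDeriv x)^[3] u y =
      (scaling x k)^[3] u y - 3 * (scaling x k)^[2] u y + 2 * scaling x k u y ∧
    k * (k - 1) * (k - 2) * (k - 3) * u y + 4 * k * (k - 1) * (k - 2) * t * radialDeriv x u y
      + 6 * k * (k - 1) * t ^ 2 * (radialDeriv x)^[2] u y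
      + 4 * k * t ^ 3 * (radialDeriv x)^[3] u y + t ^ 4 * (radialDeriv x)^[4] u y =
      (scaling x k)^[4] u y - 6 * (scaling x k)^[3] u y + 11 * (scaling x k)^[2] u y
        - 6 * scaling x k u y ∧
    t ^ 2 * (Δ u) y - t ^ 2 * (radialDeriv x)^[2] u y - (n - 1) * t * radialDeriv x u y =
      angLap x u y := by
  have hyx : y ≠ x := by rintro rfl; simp at hy; exact ht.ne hy
  set f1 := euler x u
  set f2 := euler x f1
  set f3 := euler x f2
  set f4 := euler x f3
  have c1 : ContDiff ℝ 5 f1 := contDiff_euler x hu (by norm_num)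
  have c2 : ContDiff ℝ 4 f2 := contDiff_euler x c1 (by norm_num)
  have c3 : ContDiff ℝ 3 f3 := contDiff_euler x c2 (by norm_num)
  have c4 : ContDiff ℝ 2 f4 := contDiff_euler x c3 (by norm_num)
  have d0 := hu.differentiable (by norm_num)
  have d1 := c1.differentiable (by norm_num)
  have d2 := c2.differentiable (by norm_num)
  have d3 := c3.differentiable (by norm_num)
  have d4 := c4.differentiable (by norm_num)
  have g2 : Differentiable ℝ (fun z => f2 z - 1 * f1 z) := d2.sub (d1.const_mul 1)
  have g2' : euler x (fun z => f2 z - 1 * f1 z) = fun z => f3 z - 1 * f2 z :=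
    euler_sub_const_mul x 1 d2 d1
  have g2'' : Differentiable ℝ (fun z => f3 z - 1 * f2 z) := d3.sub (d2.const_mul 1)
  have g2e : euler x (fun z => f3 z - 1 * f2 z) = fun z => f4 z - 1 * f3 z :=
    euler_sub_const_mul x 1 d3 d2
  have r1 : ∀ y, y ≠ x → radialDeriv x u y = ‖y - x‖⁻¹ ^ 1 * f1 y := by
    intro y hy
    rw [radialDeriv_eq, pow_one]
  have r2 : ∀ y, y ≠ x → (radialDeriv x)^[2] u y = ‖y - x‖⁻¹ ^ 2 * (f2 y - 1 * f1 y) := by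
    intro y hy
    have := radialDeriv_of_eq x 1 d1 r1 hy
    simpa using this
  have r3 : ∀ y, y ≠ x → (radialDeriv x)^[3] u y =
      ‖y - x‖⁻¹ ^ 3 * ((f3 y - 1 * f2 y) - 2 * (f2 y - 1 * f1 y)) := by
    intro y hy
    have := radialDeriv_of_eq x 2 g2 r2 hy
    rw [g2'] at this
    exact_mod_cast this
  have r4 : (radialDeriv x)^[4] u y =
      ‖y - x‖⁻¹ ^ 4 * (((f4 y - 1 * f3 y) - 2 * (f3 y - 1 * f2 y))
        - 3 * ((f3 y - 1 * f2 y) - 2 * (f2 y - 1 * f1 y))) := by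
    have := radialDeriv_of_eq x 3 (g2''.sub (g2.const_mul 2)) r3 hyx
    have e : euler x ((fun z => f3 z - 1 * f2 z) - fun y => 2 * (f2 y - 1 * f1 y)) =
        fun y => (f4 y - 1 * f3 y) - 2 * (f3 y - 1 * f2 y) := by
      have := euler_sub_const_mul x 2 g2'' g2
      rw [g2e, g2'] at this
      exact this
    rw [e] at this
    exact_mod_cast this
  have s1 : ∀ y, scaling x k u y = k * u y + f1 y := fun y => rfl
  have es1 : euler x (scaling x k u) = fun y => k * f1 y + f2 y := euler_scaling x k d0 d1
  have s2 : (scaling x k)^[2] u = fun y => k * (k * u y + f1 y) + (k * f1 y + f2 y) := by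
    funext y
    change k * scaling x k u y + euler x (scaling x k u) y = _
    rw [es1, s1]
  have ds1 : Differentiable ℝ (scaling x k u) := (d0.const_mul k).add d1
  have des1 : Differentiable ℝ (euler x (scaling x k u)) := by
    rw [es1]; exact (d1.const_mul k).add d2
  have ees1 : euler x (euler x (scaling x k u)) = fun y => k * f2 y + f3 y := by
    rw [es1]
    exact euler_scaling x k d1 d2
  have es2 : euler x ((scaling x k)^[2] u) =
      fun y => k * (k * f1 y + f2 y) + (k * f2 y + f3 y) := by
    have := euler_scaling x k ds1 des1
    rw [ees1, es1] at this
    exact this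
  have s3 : (scaling x k)^[3] u = fun y => k * (k * (k * u y + f1 y) + (k * f1 y + f2 y))
      + (k * (k * f1 y + f2 y) + (k * f2 y + f3 y)) := by
    funext y
    change k * (scaling x k)^[2] u y + euler x ((scaling x k)^[2] u) y = _
    rw [es2, s2]
  have ds2 : Differentiable ℝ ((scaling x k)^[2] u) :=
    (contDiff_scaling_iterate x k (m := 6) hu 2 (by norm_num)).differentiable (by norm_num)
  have des2 : Differentiable ℝ (euler x ((scaling x k)^[2] u)) := by
    rw [es2]; exact (((d1.const_mul k).add d2).const_mul k).add ((d2.const_mul k).add d3)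
  have ees2 : euler x (euler x ((scaling x k)^[2] u)) =
      fun y => k * (k * f2 y + f3 y) + (k * f3 y + f4 y) := by
    have h1 : Differentiable ℝ (scaling x k f1) := (d1.const_mul k).add d2
    have h3 : euler x (scaling x k f1) = fun y => k * f2 y + f3 y := euler_scaling x k d1 d2
    have h2 : Differentiable ℝ (euler x (scaling x k f1)) := by
      rw [h3]; exact (d2.const_mul k).add d3
    have h5 : euler x (euler x (scaling x k f1)) = fun y => k * f3 y + f4 y := by
      rw [h3]; exact euler_scaling x k d2 d3
    have h4 := euler_scaling x k h1 h2
    have h6 : euler x ((scaling x k)^[2] u) = scaling x k (scaling x k f1) := by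
      rw [es2]
      funext y
      change _ = k * scaling x k f1 y + euler x (scaling x k f1) y
      rw [h3]
      rfl
    rw [h6, h4, h5, h3]
  have es3 : euler x ((scaling x k)^[3] u) = fun y => k * (k * (k * f1 y + f2 y) + (k * f2 y + f3 y))
      + (k * (k * f2 y + f3 y) + (k * f3 y + f4 y)) := by
    have := euler_scaling x k ds2 des2
    rw [ees2, es2] at this
    exact this
  have s4 : (scaling x k)^[4] u y =
      k * (k * (k * (k * u y + f1 y) + (k * f1 y + f2 y))
        + (k * (k * f1 y + f2 y) + (k * f2 y + f3 y)))
      + (k * (k * (k * f1 y + f2 y) + (k * f2 y + f3 y))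
      + (k * (k * f2 y + f3 y) + (k * f3 y + f4 y))) := by
    change k * (scaling x k)^[3] u y + euler x ((scaling x k)^[3] u) y = _
    rw [es3, s3]
  rw [r4, r3 y hyx, r2 y hyx, r1 y hyx, hy, s4, s3, s2, s1]
  have ht' := ht.ne'
  refine ⟨?_, ?_, ?_, ?_, ?_⟩
  · field_simp
  · field_simp; ring
  · field_simp; ring
  · field_simp; ring
  · rw [angLap, hy]
    change _ = t ^ 2 * (Δ u) y - f2 y - (n - 2) * f1 y
    field_simp
    ring

/-- The tangential part of the gradient only depends on the values along the sphere. -/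
theorem angularGradient_jet₁ {p : ℝ} {u : EuclideanSpace ℝ (Fin n) → ℝ} (hu : ContDiff ℝ 6 u)
    {t : ℝ} (ht : 0 < t) {y : EuclideanSpace ℝ (Fin n)} (hy : ‖y - x‖ = t) :
    ‖gradient (jet₁ p x u t) y‖ ^ 2 - (radialDeriv x (jet₁ p x u t) y) ^ 2 =
      t⁻¹ ^ 2 * angGrad x (scaling x (kExp p) u) (scaling x (kExp p) u) y := by
  have hyx : y ≠ x := by rintro rfl; simp at hy; exact ht.ne hy
  have hyn : y - x ≠ 0 := sub_ne_zero.mpr hyx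
  have hd : DifferentiableAt ℝ u y := hu.differentiable (by norm_num) y
  have hed : DifferentiableAt ℝ (euler x u) y :=
    (contDiff_euler x (m := 5) hu (by norm_num)).differentiable (by norm_num) y
  have hE : jet₁ p x u t = fun z => kExp p * u z + t * (‖z - x‖⁻¹ ^ 1 * euler x u z) := by
    funext z; rw [jet₁, radialDeriv_eq, pow_one]
  have hN := (hasFDerivAt_inv_norm_pow x 1 hyx).1
  have hpN : ∀ i, pderiv i (fun z : EuclideanSpace ℝ (Fin n) => ‖z - x‖⁻¹ ^ 1) y =
      -(t⁻¹ ^ 3) * (y - x) i := by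
    intro i
    have hdn : DifferentiableAt ℝ (fun y : EuclideanSpace ℝ (Fin n) => ‖y - x‖) y :=
      (differentiableAt_id.sub (differentiableAt_const x)).norm ℝ hyn
    have hn0 : ‖y - x‖ ≠ 0 := norm_ne_zero_iff.mpr hyn
    have hv := (hasDerivAt_inv hn0).comp_hasFDerivAt y hdn.hasFDerivAt
    have h4 := pderiv_radial x i (g := id) differentiable_id hyx
    simp only [id, deriv_id', one_mul] at h4
    rw [show (fun z : EuclideanSpace ℝ (Fin n) => ‖z - x‖⁻¹ ^ 1) =
      (Inv.inv ∘ fun z => ‖z - x‖) by funext z; simp, pderiv, hv.fderiv, _root_.smul_apply]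
    change _ • pderiv i (fun y => ‖y - x‖) y = _
    rw [h4, hy, smul_eq_mul]
    field_simp
  -- `jet₁` carries the fixed radius t where `scaling` carries ‖y - x‖. The two functions agree on
  -- the sphere, so their gradients differ by a multiple of the normal y - x.
  have hpi : ∀ i, pderiv i (jet₁ p x u t) y =
      pderiv i (scaling x (kExp p) u) y + (-(t⁻¹ ^ 2) * euler x u y) * (y - x) i := by
    intro i
    have : scaling x (kExp p) u = fun z => kExp p * u z + euler x u z := rfl
    rw [hE, this, pderiv_add i (hd.const_mul _) ((hN.fun_mul hed).const_mul _),
      pderiv_const_mul i _ (hN.fun_mul hed), pderiv_mul i hN hed, pderiv_add i (hd.const_mul _) hed,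
      hpN, hy]
    have ht' := ht.ne'
    field_simp
    ring
  set s := -(t⁻¹ ^ 2) * euler x u y
  have hsum : ∑ i, (y - x) i ^ 2 = t ^ 2 := by rw [← norm_sub_sq_eq_sum, hy]
  have e1 : euler x (jet₁ p x u t) y = euler x (scaling x (kExp p) u) y + s * t ^ 2 := by
    rw [euler_eq_sum, euler_eq_sum, ← hsum, Finset.mul_sum, ← Finset.sum_add_distrib]
    refine Finset.sum_congr rfl fun i _ => ?_
    rw [hpi]; ring
  have e2 : ‖gradient (jet₁ p x u t) y‖ ^ 2 =
      ∑ i, pderiv i (scaling x (kExp p) u) y * pderiv i (scaling x (kExp p) u) y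
        + 2 * s * euler x (scaling x (kExp p) u) y + s ^ 2 * t ^ 2 := by
    rw [norm_gradient_sq, euler_eq_sum, ← hsum, Finset.mul_sum, Finset.mul_sum,
      ← Finset.sum_add_distrib, ← Finset.sum_add_distrib]
    refine Finset.sum_congr rfl fun i _ => ?_
    rw [hpi]; ring
  rw [radialDeriv_eq, e1, e2, hy, angGrad, hy]
  have ht' := ht.ne'
  field_simp
  ring

theorem angularGradient_eq (u : EuclideanSpace ℝ (Fin n) → ℝ)
    {t : ℝ} (ht : 0 < t) {y : EuclideanSpace ℝ (Fin n)} (hy : ‖y - x‖ = t) :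
    t ^ 2 * ‖gradient u y‖ ^ 2 - t ^ 2 * (radialDeriv x u y) ^ 2 = angGrad x u u y := by
  rw [radialDeriv_eq, norm_gradient_sq, angGrad, hy]
  have ht' := ht.ne'
  simp only [pow_two]
  field_simp

end Radial

/-! ### The scaling-invariant pairing -/

section Pairing

variable {n : ℕ} (k : ℝ) (x : EuclideanSpace ℝ (Fin n))

/-- The pairing `t^(2k) ∫ f (x + t θ) g (x + t θ) dθ` over the unit sphere. -/
def pairing (t : ℝ) :
    C(EuclideanSpace ℝ (Fin n), ℝ) →ₗ[ℝ] C(EuclideanSpace ℝ (Fin n), ℝ) →ₗ[ℝ] ℝ :=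
  LinearMap.mk₂ ℝ (fun f g => t ^ (2 * k) * sphereIntegral x (fun y => f y * g y) t)
    (fun f₁ f₂ g => by
      simp only [ContinuousMap.add_apply, add_mul]
      rw [sphereIntegral_add x (by fun_prop) (by fun_prop), mul_add])
    (fun c f g => by
      simp only [ContinuousMap.smul_apply, smul_eq_mul, mul_assoc]
      rw [sphereIntegral_const_mul]; ring)
    (fun f g₁ g₂ => by
      simp only [ContinuousMap.add_apply, mul_add]
      rw [sphereIntegral_add x (by fun_prop) (by fun_prop), mul_add])
    (fun c f g => by
      simp only [ContinuousMap.smul_apply, smul_eq_mul, mul_left_comm _ c]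
      rw [sphereIntegral_const_mul]; ring)

theorem pairing_apply (t : ℝ) (f g : C(EuclideanSpace ℝ (Fin n), ℝ)) :
    pairing k x t f g = t ^ (2 * k) * sphereIntegral x (fun y => f y * g y) t := rfl

theorem pairing_comm (t : ℝ) (f g : C(EuclideanSpace ℝ (Fin n), ℝ)) :
    pairing k x t f g = pairing k x t g f := by
  simp only [pairing_apply, mul_comm]

theorem pairing_self_nonneg {t : ℝ} (ht : 0 < t) (f : C(EuclideanSpace ℝ (Fin n), ℝ)) :
    0 ≤ pairing k x t f f := by
  rw [pairing_apply]
  exact mul_nonneg (Real.rpow_nonneg ht.le _) (integral_nonneg fun θ => mul_self_nonneg _)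

/-- Leibniz rule: the weight t^(2k) gives one k to each factor, which turns each Euler derivative
into `scaling x k`. -/
theorem hasDerivAt_pairing {f g f' g' : C(EuclideanSpace ℝ (Fin n), ℝ)}
    (hf : ContDiff ℝ 1 f) (hg : ContDiff ℝ 1 g) (hf' : ⇑f' = scaling x k f)
    (hg' : ⇑g' = scaling x k g) {t : ℝ} (ht : 0 < t) :
    HasDerivAt (fun s => pairing k x s f g)
      (t⁻¹ * (pairing k x t f' g + pairing k x t f g')) t := by
  have hfg : ContDiff ℝ 1 (fun y => f y * g y) := hf.mul hg
  have h := (Real.hasDerivAt_rpow_const (x := t) (p := 2 * k) (Or.inl ht.ne')).mul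
    (hasDerivAt_sphereIntegral x hfg ht)
  refine h.congr_deriv ?_
  have he : sphereIntegral x (euler x (fun y => f y * g y)) t =
      sphereIntegral x (fun y => f' y * g y + f y * g' y + (-(2 * k)) * (f y * g y)) t := by
    congr 1
    funext y
    rw [euler_mul x (hf.differentiable (by norm_num) y) (hg.differentiable (by norm_num) y), hf',
      hg', scaling, scaling]
    ring
  rw [he, sphereIntegral_add x (by fun_prop) (by fun_prop),
    sphereIntegral_add x (by fun_prop) (by fun_prop), sphereIntegral_const_mul,
    Real.rpow_sub_one ht.ne']
  simp only [pairing_apply]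
  have ht' := ht.ne'
  field_simp
  ring

theorem pairing_angLap [NeZero n] {f lf : C(EuclideanSpace ℝ (Fin n), ℝ)}
    {g lg : C(EuclideanSpace ℝ (Fin n), ℝ)} (hf : ContDiff ℝ 2 f) (hg : ContDiff ℝ 2 g)
    (hlf : ⇑lf = angLap x f) (hlg : ⇑lg = angLap x g) {t : ℝ} (ht : 0 < t) :
    pairing k x t f lg = pairing k x t g lf := by
  simp only [pairing_apply, hlf, hlg]
  rw [sphereIntegral_mul_angLap x (hf.of_le (by norm_num)) hg ht,
    sphereIntegral_mul_angLap x (hg.of_le (by norm_num)) hf ht, angGrad_comm]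

theorem pairing_angLap_eq_neg [NeZero n] {f lf : C(EuclideanSpace ℝ (Fin n), ℝ)}
    (hf : ContDiff ℝ 2 f) (hlf : ⇑lf = angLap x f) {t : ℝ} (ht : 0 < t) :
    pairing k x t f lf = -(t ^ (2 * k) * sphereIntegral x (angGrad x f f) t) := by
  simp only [pairing_apply, hlf]
  rw [sphereIntegral_mul_angLap x (hf.of_le (by norm_num)) hf ht]
  ring

theorem pairing_angLap_self_nonpos [NeZero n] {f lf : C(EuclideanSpace ℝ (Fin n), ℝ)}
    (hf : ContDiff ℝ 2 f) (hlf : ⇑lf = angLap x f) {t : ℝ} (ht : 0 < t) :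
    pairing k x t f lf ≤ 0 := by
  rw [pairing_angLap_eq_neg k x hf hlf ht, neg_nonpos]
  exact mul_nonneg (Real.rpow_nonneg ht.le _)
    (integral_nonneg fun θ => angGrad_self_nonneg x f _)

/-- A continuous function as an element of `C(ℝⁿ, ℝ)`; zero for discontinuous functions. -/
def toCont (f : EuclideanSpace ℝ (Fin n) → ℝ) : C(EuclideanSpace ℝ (Fin n), ℝ) :=
  open Classical in if h : Continuous f then ⟨f, h⟩ else 0

theorem coe_toCont {f : EuclideanSpace ℝ (Fin n) → ℝ} (hf : Continuous f) : ⇑(toCont f) = f := by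
  rw [toCont, dif_pos hf]; rfl

variable (u : EuclideanSpace ℝ (Fin n) → ℝ)

/-- `(t d/dt)ʲ` of the rescaled function. -/
def scalingJet (j : ℕ) : C(EuclideanSpace ℝ (Fin n), ℝ) := toCont ((scaling x k)^[j] u)

/-- The angular Laplacian of `scalingJet j`. -/
def lapJet (j : ℕ) : C(EuclideanSpace ℝ (Fin n), ℝ) := toCont (angLap x ((scaling x k)^[j] u))

/-- The squared angular Laplacian of `scalingJet j`. -/
def bilapJet (j : ℕ) : C(EuclideanSpace ℝ (Fin n), ℝ) :=
  toCont (angLap x (angLap x ((scaling x k)^[j] u)))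

variable {u}

theorem contDiff_iterate_of_le (hu : ContDiff ℝ 6 u) {m j : ℕ} (h : m + j ≤ 6) :
    ContDiff ℝ m ((scaling x k)^[j] u) :=
  (contDiff_scaling_iterate x k (m := 6) (by exact_mod_cast hu) j (by omega)).of_le
    (by exact_mod_cast (by omega : m ≤ 6 - j))

theorem contDiff_angLap_iterate (hu : ContDiff ℝ 6 u) {m j : ℕ} (h : m + 2 + j ≤ 6) :
    ContDiff ℝ m (angLap x ((scaling x k)^[j] u)) :=
  contDiff_angLap x (contDiff_iterate_of_le k x hu h) (by push_cast; exact le_rfl)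

theorem contDiff_angLap_angLap_iterate (hu : ContDiff ℝ 6 u) {m j : ℕ} (h : m + 4 + j ≤ 6) :
    ContDiff ℝ m (angLap x (angLap x ((scaling x k)^[j] u))) :=
  contDiff_angLap x (contDiff_angLap_iterate k x hu (m := m + 2) (by omega))
    (by push_cast; exact le_rfl)

theorem coe_scalingJet (hu : ContDiff ℝ 6 u) {j : ℕ} (hj : j ≤ 6) :
    ⇑(scalingJet k x u j) = (scaling x k)^[j] u :=
  coe_toCont (contDiff_iterate_of_le k x hu (m := 0) (by omega)).continuous

theorem coe_lapJet (hu : ContDiff ℝ 6 u) {j : ℕ} (hj : j ≤ 4) :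
    ⇑(lapJet k x u j) = angLap x ((scaling x k)^[j] u) :=
  coe_toCont (contDiff_angLap_iterate k x hu (m := 0) (by omega)).continuous

theorem coe_bilapJet (hu : ContDiff ℝ 6 u) {j : ℕ} (hj : j ≤ 2) :
    ⇑(bilapJet k x u j) = angLap x (angLap x ((scaling x k)^[j] u)) :=
  coe_toCont (contDiff_angLap_angLap_iterate k x hu (m := 0) (by omega)).continuous

theorem scaling_scalingJet (hu : ContDiff ℝ 6 u) {j : ℕ} (hj : j ≤ 5) :
    ⇑(scalingJet k x u (j + 1)) = scaling x k (scalingJet k x u j) := by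
  rw [coe_scalingJet k x hu (by omega), coe_scalingJet k x hu (by omega),
    Function.iterate_succ_apply']

theorem scaling_lapJet (hu : ContDiff ℝ 6 u) {j : ℕ} (hj : j ≤ 3) :
    ⇑(lapJet k x u (j + 1)) = scaling x k (lapJet k x u j) := by
  rw [coe_lapJet k x hu (by omega), coe_lapJet k x hu (by omega), Function.iterate_succ_apply']
  funext y
  exact (scaling_angLap x k (contDiff_iterate_of_le k x hu (m := 3) (by omega)) y).symm

theorem scaling_bilapJet (hu : ContDiff ℝ 6 u) :
    ⇑(bilapJet k x u 1) = scaling x k (bilapJet k x u 0) := by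
  have h := scaling_lapJet k x hu (j := 0) (by norm_num)
  rw [coe_lapJet k x hu (by norm_num), coe_lapJet k x hu (by norm_num)] at h
  rw [coe_bilapJet k x hu (by norm_num), coe_bilapJet k x hu (by norm_num), h]
  funext y
  exact (scaling_angLap x k (contDiff_angLap_iterate k x hu (m := 3) (by norm_num)) y).symm

theorem contDiff_scalingJet (hu : ContDiff ℝ 6 u) {m j : ℕ} (h : m + j ≤ 6) :
    ContDiff ℝ m (scalingJet k x u j) := by
  rw [coe_scalingJet k x hu (by omega)]; exact contDiff_iterate_of_le k x hu h

theorem contDiff_lapJet (hu : ContDiff ℝ 6 u) {m j : ℕ} (h : m + 2 + j ≤ 6) :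
    ContDiff ℝ m (lapJet k x u j) := by
  rw [coe_lapJet k x hu (by omega)]; exact contDiff_angLap_iterate k x hu h

theorem lapJet_eq (hu : ContDiff ℝ 6 u) {j : ℕ} (hj : j ≤ 4) :
    ⇑(lapJet k x u j) = angLap x (scalingJet k x u j) := by
  rw [coe_lapJet k x hu hj, coe_scalingJet k x hu (by omega)]

theorem bilapJet_eq (hu : ContDiff ℝ 6 u) {j : ℕ} (hj : j ≤ 2) :
    ⇑(bilapJet k x u j) = angLap x (lapJet k x u j) := by
  rw [coe_bilapJet k x hu hj, coe_lapJet k x hu (by omega)]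

variable {t : ℝ}

theorem pairing_scalingJet_lapJet [NeZero n] (hu : ContDiff ℝ 6 u) (ht : 0 < t) {i j : ℕ} (hi : i ≤ 4)
    (hj : j ≤ 4) :
    pairing k x t (scalingJet k x u i) (lapJet k x u j) =
      pairing k x t (scalingJet k x u j) (lapJet k x u i) :=
  pairing_angLap k x (contDiff_scalingJet k x hu (m := 2) (by omega))
    (contDiff_scalingJet k x hu (m := 2) (by omega)) (lapJet_eq k x hu hi) (lapJet_eq k x hu hj) ht

theorem pairing_scalingJet_bilapJet [NeZero n] (hu : ContDiff ℝ 6 u) (ht : 0 < t) {i j : ℕ} (hi : i ≤ 4)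
    (hj : j ≤ 2) :
    pairing k x t (scalingJet k x u i) (bilapJet k x u j) =
      pairing k x t (lapJet k x u j) (lapJet k x u i) :=
  pairing_angLap k x (contDiff_scalingJet k x hu (m := 2) (by omega))
    (contDiff_lapJet k x hu (m := 2) (by omega)) (lapJet_eq k x hu hi) (bilapJet_eq k x hu hj) ht

theorem hasDerivAt_scalingJet_scalingJet (hu : ContDiff ℝ 6 u) (ht : 0 < t) {i j : ℕ} (hi : i ≤ 5)
    (hj : j ≤ 5) :
    HasDerivAt (fun s => pairing k x s (scalingJet k x u i) (scalingJet k x u j))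
      (t⁻¹ * (pairing k x t (scalingJet k x u (i + 1)) (scalingJet k x u j)
        + pairing k x t (scalingJet k x u i) (scalingJet k x u (j + 1)))) t :=
  hasDerivAt_pairing k x (contDiff_scalingJet k x hu (m := 1) (by omega))
    (contDiff_scalingJet k x hu (m := 1) (by omega)) (scaling_scalingJet k x hu hi)
    (scaling_scalingJet k x hu hj) ht

theorem hasDerivAt_scalingJet_lapJet (hu : ContDiff ℝ 6 u) (ht : 0 < t) {i j : ℕ} (hi : i ≤ 5)
    (hj : j ≤ 3) :
    HasDerivAt (fun s => pairing k x s (scalingJet k x u i) (lapJet k x u j))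
      (t⁻¹ * (pairing k x t (scalingJet k x u (i + 1)) (lapJet k x u j)
        + pairing k x t (scalingJet k x u i) (lapJet k x u (j + 1)))) t :=
  hasDerivAt_pairing k x (contDiff_scalingJet k x hu (m := 1) (by omega))
    (contDiff_lapJet k x hu (m := 1) (by omega)) (scaling_scalingJet k x hu hi)
    (scaling_lapJet k x hu hj) ht

theorem hasDerivAt_lapJet_lapJet (hu : ContDiff ℝ 6 u) (ht : 0 < t) {i j : ℕ} (hi : i ≤ 3)
    (hj : j ≤ 3) :
    HasDerivAt (fun s => pairing k x s (lapJet k x u i) (lapJet k x u j))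
      (t⁻¹ * (pairing k x t (lapJet k x u (i + 1)) (lapJet k x u j)
        + pairing k x t (lapJet k x u i) (lapJet k x u (j + 1)))) t :=
  hasDerivAt_pairing k x (contDiff_lapJet k x hu (m := 1) (by omega))
    (contDiff_lapJet k x hu (m := 1) (by omega)) (scaling_lapJet k x hu hi)
    (scaling_lapJet k x hu hj) ht

end Pairing

/-! ### The energy in terms of the pairing -/

section Energy

variable {n : ℕ} (k : ℝ) (x : EuclideanSpace ℝ (Fin n))

/-- Substitute E = Λ - k into r²Δ = E² + (n - 2)E + L. Since k is arbitrary, the formula also serves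
Δu with k + 2. -/
theorem normSq_mul_laplacian {f : EuclideanSpace ℝ (Fin n) → ℝ} (hf : ContDiff ℝ 2 f)
    (y : EuclideanSpace ℝ (Fin n)) :
    ‖y - x‖ ^ 2 * (Δ f) y = scaling x k (scaling x k f) y + (n - 2 - 2 * k) * scaling x k f y
      + k * (k + 2 - n) * f y + angLap x f y := by
  have he := euler_scaling x k (hf.differentiable (by norm_num))
    ((contDiff_euler x (m := 1) hf (by norm_num)).differentiable (by norm_num))
  have h : scaling x k (scaling x k f) y = k * scaling x k f y + euler x (scaling x k f) y := rfl
  rw [h, he, scaling, angLap]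
  ring

theorem scaling_lincomb (a b : ℝ) {f₁ f₂ f₃ f₄ : EuclideanSpace ℝ (Fin n) → ℝ}
    (h₁ : ContDiff ℝ 1 f₁) (h₂ : ContDiff ℝ 1 f₂) (h₃ : ContDiff ℝ 1 f₃) (h₄ : ContDiff ℝ 1 f₄)
    (y : EuclideanSpace ℝ (Fin n)) :
    scaling x k (fun z => f₁ z + a * f₂ z + b * f₃ z + f₄ z) y =
      scaling x k f₁ y + a * scaling x k f₂ y + b * scaling x k f₃ y + scaling x k f₄ y := by
  have d₁ := h₁.differentiable (by norm_num) y
  have d₂ := h₂.differentiable (by norm_num) y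
  have d₃ := h₃.differentiable (by norm_num) y
  have d₄ := h₄.differentiable (by norm_num) y
  simp only [scaling]
  rw [euler_add x ((d₁.fun_add (d₂.const_mul a)).fun_add (d₃.const_mul b)) d₄,
    euler_add x (d₁.fun_add (d₂.const_mul a)) (d₃.const_mul b), euler_add x d₁ (d₂.const_mul a),
    euler_const_mul x a d₂, euler_const_mul x b d₃]
  ring

theorem angLap_lincomb (a b : ℝ) {f₁ f₂ f₃ f₄ : EuclideanSpace ℝ (Fin n) → ℝ}
    (h₁ : ContDiff ℝ 2 f₁) (h₂ : ContDiff ℝ 2 f₂) (h₃ : ContDiff ℝ 2 f₃) (h₄ : ContDiff ℝ 2 f₄)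
    (y : EuclideanSpace ℝ (Fin n)) :
    angLap x (fun z => f₁ z + a * f₂ z + b * f₃ z + f₄ z) y =
      angLap x f₁ y + a * angLap x f₂ y + b * angLap x f₃ y + angLap x f₄ y := by
  have g₂ : ContDiff ℝ 2 (fun z => a * f₂ z) := contDiff_const.mul h₂
  have g₃ : ContDiff ℝ 2 (fun z => b * f₃ z) := contDiff_const.mul h₃
  rw [angLap_add x ((h₁.add g₂).add g₃) h₄, angLap_add x (h₁.add g₂) g₃, angLap_add x h₁ g₂,
    angLap_const_mul x a h₂, angLap_const_mul x b h₃]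

variable (u : EuclideanSpace ℝ (Fin n) → ℝ)

/-- `(t d/dt)ʲ` of `t² Δu`. -/
def lapJet₂ (j : ℕ) : C(EuclideanSpace ℝ (Fin n), ℝ) :=
  scalingJet k x u (j + 2) + ((n : ℝ) - 2 - 2 * k) • scalingJet k x u (j + 1)
    + (k * (k + 2 - n)) • scalingJet k x u j + lapJet k x u j

/-- The angular Laplacian of `lapJet₂ j`. -/
def angLapJet₂ (j : ℕ) : C(EuclideanSpace ℝ (Fin n), ℝ) :=
  lapJet k x u (j + 2) + ((n : ℝ) - 2 - 2 * k) • lapJet k x u (j + 1)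
    + (k * (k + 2 - n)) • lapJet k x u j + bilapJet k x u j

/-- `(t d/dt)ʲ` of `t⁴ Δ²u`. -/
def lapJet₄ (j : ℕ) : C(EuclideanSpace ℝ (Fin n), ℝ) :=
  lapJet₂ k x u (j + 2) + ((n : ℝ) - 6 - 2 * k) • lapJet₂ k x u (j + 1)
    + ((k + 2) * (k + 4 - n)) • lapJet₂ k x u j + angLapJet₂ k x u j

variable {u}

theorem coe_lapJet₂ (j : ℕ) : ⇑(lapJet₂ k x u j) = fun y =>
    scalingJet k x u (j + 2) y + ((n : ℝ) - 2 - 2 * k) * scalingJet k x u (j + 1) y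
      + (k * (k + 2 - n)) * scalingJet k x u j y + lapJet k x u j y := rfl

theorem coe_angLapJet₂ (j : ℕ) : ⇑(angLapJet₂ k x u j) = fun y =>
    lapJet k x u (j + 2) y + ((n : ℝ) - 2 - 2 * k) * lapJet k x u (j + 1) y
      + (k * (k + 2 - n)) * lapJet k x u j y + bilapJet k x u j y := rfl

theorem coe_lapJet₄ (j : ℕ) : ⇑(lapJet₄ k x u j) = fun y =>
    lapJet₂ k x u (j + 2) y + ((n : ℝ) - 6 - 2 * k) * lapJet₂ k x u (j + 1) y
      + ((k + 2) * (k + 4 - n)) * lapJet₂ k x u j y + angLapJet₂ k x u j y := rfl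

theorem contDiff_lapJet₂ (hu : ContDiff ℝ 6 u) {m j : ℕ} (h : m + 2 + j ≤ 6) :
    ContDiff ℝ m (lapJet₂ k x u j) :=
  (((contDiff_scalingJet k x hu (by omega)).add
    (contDiff_const.mul (contDiff_scalingJet k x hu (by omega)))).add
    (contDiff_const.mul (contDiff_scalingJet k x hu (by omega)))).add
    (contDiff_lapJet k x hu (by omega))

theorem scaling_lapJet₂ (hu : ContDiff ℝ 6 u) {j : ℕ} (hj : j ≤ 3) :
    ⇑(lapJet₂ k x u (j + 1)) = scaling x k (lapJet₂ k x u j) := by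
  funext y
  rw [coe_lapJet₂, coe_lapJet₂,
    scaling_lincomb k x _ _ (contDiff_scalingJet k x hu (m := 1) (by omega))
      (contDiff_scalingJet k x hu (m := 1) (by omega))
      (contDiff_scalingJet k x hu (m := 1) (by omega)) (contDiff_lapJet k x hu (m := 1) (by omega)),
    ← scaling_lapJet k x hu hj, ← scaling_scalingJet k x hu (by omega),
    ← scaling_scalingJet k x hu (by omega), ← scaling_scalingJet k x hu (by omega)]

theorem angLap_lapJet₂ (hu : ContDiff ℝ 6 u) :
    ⇑(angLapJet₂ k x u 0) = angLap x (lapJet₂ k x u 0) := by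
  funext y
  rw [coe_lapJet₂, coe_angLapJet₂,
    angLap_lincomb x _ _ (contDiff_scalingJet k x hu (m := 2) (by norm_num))
      (contDiff_scalingJet k x hu (m := 2) (by norm_num))
      (contDiff_scalingJet k x hu (m := 2) (by norm_num))
      (contDiff_lapJet k x hu (m := 2) (by norm_num)),
    ← lapJet_eq k x hu (by norm_num), ← lapJet_eq k x hu (by norm_num),
    ← lapJet_eq k x hu (by norm_num), ← bilapJet_eq k x hu (by norm_num)]

theorem contDiff_bilapJet_zero (hu : ContDiff ℝ 6 u) : ContDiff ℝ 1 (bilapJet k x u 0) := by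
  rw [coe_bilapJet k x hu (by norm_num)]
  exact_mod_cast contDiff_angLap_angLap_iterate k x hu (m := 1) (j := 0) (by norm_num)

theorem scaling_angLapJet₂ (hu : ContDiff ℝ 6 u) :
    ⇑(angLapJet₂ k x u 1) = scaling x k (angLapJet₂ k x u 0) := by
  funext y
  rw [coe_angLapJet₂, coe_angLapJet₂,
    scaling_lincomb k x _ _ (contDiff_lapJet k x hu (m := 1) (by norm_num))
      (contDiff_lapJet k x hu (m := 1) (by norm_num))
      (contDiff_lapJet k x hu (m := 1) (by norm_num)) (contDiff_bilapJet_zero k x hu),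
    ← scaling_lapJet k x hu (by norm_num), ← scaling_lapJet k x hu (by norm_num),
    ← scaling_lapJet k x hu (by norm_num), ← scaling_bilapJet k x hu]

theorem contDiff_angLapJet₂_zero (hu : ContDiff ℝ 6 u) : ContDiff ℝ 1 (angLapJet₂ k x u 0) :=
  (((contDiff_lapJet k x hu (m := 1) (by norm_num)).add
    (contDiff_const.mul (contDiff_lapJet k x hu (m := 1) (by norm_num)))).add
    (contDiff_const.mul (contDiff_lapJet k x hu (m := 1) (by norm_num)))).add
    (contDiff_bilapJet_zero k x hu)

theorem scaling_lapJet₄ (hu : ContDiff ℝ 6 u) :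
    ⇑(lapJet₄ k x u 1) = scaling x k (lapJet₄ k x u 0) := by
  funext y
  rw [coe_lapJet₄, coe_lapJet₄,
    scaling_lincomb k x _ _ (contDiff_lapJet₂ k x hu (m := 1) (by norm_num))
      (contDiff_lapJet₂ k x hu (m := 1) (by norm_num))
      (contDiff_lapJet₂ k x hu (m := 1) (by norm_num)) (contDiff_angLapJet₂_zero k x hu),
    ← scaling_lapJet₂ k x hu (by norm_num), ← scaling_lapJet₂ k x hu (by norm_num),
    ← scaling_lapJet₂ k x hu (by norm_num), ← scaling_angLapJet₂ k x hu]

theorem lapJet₂_zero (hu : ContDiff ℝ 6 u) :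
    ⇑(lapJet₂ k x u 0) = fun y => ‖y - x‖ ^ 2 * (Δ u) y := by
  funext y
  rw [normSq_mul_laplacian k x (hu.of_le (by norm_num)), coe_lapJet₂,
    coe_lapJet k x hu (by norm_num)]
  simp only [coe_scalingJet k x hu (j := 0 + 2) (by norm_num),
    coe_scalingJet k x hu (j := 0 + 1) (by norm_num), coe_scalingJet k x hu (j := 0) (by norm_num)]
  rfl

/-- Pulling r² out of `scaling x k` raises k by 2 and r² passes freely through `angLap`, so the
expansion of r²Δ with parameter k + 2 applies to Δu. This is where the primed coefficients n - 6 -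
2k and (k + 2)(k + 4 - n) come from. -/
theorem lapJet₄_zero (hu : ContDiff ℝ 6 u) :
    ⇑(lapJet₄ k x u 0) = fun y => ‖y - x‖ ^ 2 * (‖y - x‖ ^ 2 * (Δ (Δ u)) y) := by
  have hv : ContDiff ℝ 4 (Δ u) := contDiff_laplacian hu (by norm_num)
  have hv2 : ContDiff ℝ 2 (Δ u) := hv.of_le (by norm_num)
  have hd := hv.differentiable (by norm_num)
  have hed : Differentiable ℝ (euler x (Δ u)) :=
    (contDiff_euler x (m := 3) hv (by norm_num)).differentiable (by norm_num)
  have h1 := scaling_lapJet₂ k x hu (j := 0) (by norm_num)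
  have h2 := scaling_lapJet₂ k x hu (j := 1) (by norm_num)
  have e0 : scaling x k (fun y => ‖y - x‖ ^ 2 * (Δ u) y) =
      fun y => ‖y - x‖ ^ 2 * scaling x (k + 2) (Δ u) y := by
    funext y
    rw [scaling, euler_normSq_mul x (hd y), scaling]; ring
  have e1 : scaling x k (fun y => ‖y - x‖ ^ 2 * scaling x (k + 2) (Δ u) y) =
      fun y => ‖y - x‖ ^ 2 * scaling x (k + 2) (scaling x (k + 2) (Δ u)) y := by
    funext y
    have hs : DifferentiableAt ℝ (scaling x (k + 2) (Δ u)) y :=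
      ((hd y).const_mul _).fun_add (hed y)
    rw [scaling, euler_normSq_mul x hs,
      scaling.eq_def x (k + 2) (scaling x (k + 2) (Δ u))]
    ring
  rw [lapJet₂_zero k x hu, e0] at h1
  rw [h1, e1] at h2
  have h3 := angLap_lapJet₂ k x hu
  rw [lapJet₂_zero k x hu] at h3
  funext y
  rw [coe_lapJet₄]
  simp only [zero_add]
  rw [h2, h1, h3, lapJet₂_zero k x hu, angLap_normSq_mul x hv2,
    normSq_mul_laplacian (k + 2) x hv2]
  ring

/-- Each Euler derivative is rewritten as a scaling minus a multiple: the multiple is k for `u`, k +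
2 for r²Δu and k + 4 for r⁴Δ²u. -/
theorem normSq_mul_pohozaevFlux (hu : ContDiff ℝ 6 u) (y : EuclideanSpace ℝ (Fin n)) :
    ‖y - x‖ ^ 4 * pohozaevFlux x k u y =
      lapJet₂ k x u 1 y * lapJet₂ k x u 1 y - (k + 2) * (lapJet₂ k x u 1 y * lapJet₂ k x u 0 y)
        - lapJet₄ k x u 0 y * scalingJet k x u 2 y + k * (lapJet₄ k x u 0 y * scalingJet k x u 1 y)
        + scalingJet k x u 1 y * lapJet₄ k x u 1 y
        - (k + 4) * (scalingJet k x u 1 y * lapJet₄ k x u 0 y) := by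
  have hv : ContDiff ℝ 4 (Δ u) := contDiff_laplacian hu (by norm_num)
  have hw : ContDiff ℝ 2 (Δ (Δ u)) := contDiff_laplacian hv (by norm_num)
  have hd := hv.differentiable (by norm_num)
  have hwd := hw.differentiable (by norm_num)
  have h1 := congrFun (scaling_lapJet₂ k x hu (j := 0) (by norm_num)) y
  have h2 := congrFun (scaling_lapJet₄ k x hu) y
  rw [lapJet₂_zero k x hu, scaling, euler_normSq_mul x (hd y)] at h1
  have hN : DifferentiableAt ℝ (fun y => ‖y - x‖ ^ 2 * (Δ (Δ u)) y) y :=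
    (((contDiff_normSq x).mul hw).differentiable (by norm_num)) y
  rw [lapJet₄_zero k x hu, scaling, euler_normSq_mul x hN, euler_normSq_mul x (hwd y)] at h2
  have h3 : scalingJet k x u 2 y = k * scalingJet k x u 1 y + euler x (scaling x k u) y := by
    rw [scaling_scalingJet k x hu (j := 1) (by norm_num), scaling,
      coe_scalingJet k x hu (by norm_num)]
    rfl
  have h4 : scalingJet k x u 1 y = scaling x k u y := by
    rw [coe_scalingJet k x hu (by norm_num)]; rfl
  simp only [zero_add] at h1
  rw [h1, h2, h3, h4, lapJet₂_zero k x hu, lapJet₄_zero k x hu, pohozaevFlux, scaling]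
  ring

theorem pairing_pohozaevFlux (hu : ContDiff ℝ 6 u) (t : ℝ) :
    t ^ (2 * k) * sphereIntegral x (fun y => ‖y - x‖ ^ 4 * pohozaevFlux x k u y) t =
      pairing k x t (lapJet₂ k x u 1) (lapJet₂ k x u 1)
        - (k + 2) * pairing k x t (lapJet₂ k x u 1) (lapJet₂ k x u 0)
        - pairing k x t (lapJet₄ k x u 0) (scalingJet k x u 2)
        + k * pairing k x t (lapJet₄ k x u 0) (scalingJet k x u 1)
        + pairing k x t (scalingJet k x u 1) (lapJet₄ k x u 1)
        - (k + 4) * pairing k x t (scalingJet k x u 1) (lapJet₄ k x u 0) := by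
  simp only [normSq_mul_pohozaevFlux k x hu]
  rw [sphereIntegral_sub x (by fun_prop) (by fun_prop),
    sphereIntegral_add x (by fun_prop) (by fun_prop),
    sphereIntegral_add x (by fun_prop) (by fun_prop),
    sphereIntegral_sub x (by fun_prop) (by fun_prop),
    sphereIntegral_sub x (by fun_prop) (by fun_prop), sphereIntegral_const_mul,
    sphereIntegral_const_mul, sphereIntegral_const_mul]
  simp only [pairing_apply]
  ring

end Energy

/-! ### Boundary terms and the correction by c as pairings of jets -/

section Expansion

variable {n : ℕ} {p : ℝ} (x : EuclideanSpace ℝ (Fin n)) {u : EuclideanSpace ℝ (Fin n) → ℝ} {t : ℝ}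

theorem exponent_eq (hp : 1 < p) : 6 * (p + 1) / (p - 1) = 2 * kExp p + 6 := by
  have : p - 1 ≠ 0 := by linarith
  rw [kExp]; field_simp; ring

theorem rpow_mul_surfaceIntegral [NeZero n] (q : ℝ) (ht : 0 < t)
    (g : EuclideanSpace ℝ (Fin n) → ℝ) :
    t ^ (q - n) * surfaceIntegral x t g = t⁻¹ * (t ^ q * sphereIntegral x g t) := by
  obtain ⟨l, hl⟩ : ∃ l, n = l + 1 := ⟨n - 1, by have := NeZero.pos n; omega⟩
  have h2 : n - 1 = l := by omega
  have h3 : t ^ n = t ^ l * t := by rw [hl, pow_succ]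
  have ht' := ht.ne'
  change t ^ (q - n) * (t ^ (n - 1) * sphereIntegral x g t) = _
  rw [Real.rpow_sub_natCast ht', h2, h3]
  field_simp

theorem boundary_eq [NeZero n] (hp : 1 < p) (ht : 0 < t) (g : EuclideanSpace ℝ (Fin n) → ℝ) :
    boundary p x t g = t ^ (2 * kExp p) * sphereIntegral x g t := by
  rw [boundary, exponent_eq hp,
    show 2 * kExp p + 6 - n - 5 = (2 * kExp p + 1) - n by ring,
    rpow_mul_surfaceIntegral x _ ht, Real.rpow_add_one ht.ne']
  have ht' := ht.ne'
  field_simp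

theorem boundary_eq_pairing [NeZero n] (hp : 1 < p) (ht : 0 < t)
    {g : EuclideanSpace ℝ (Fin n) → ℝ} (f h : C(EuclideanSpace ℝ (Fin n), ℝ))
    (hg : ∀ y, ‖y - x‖ = t → g y = f y * h y) :
    boundary p x t g = pairing (kExp p) x t f h := by
  rw [boundary_eq x hp ht, pairing_apply, sphereIntegral_congr x ht hg]

theorem jets_eq (hu : ContDiff ℝ 6 u) (ht : 0 < t) {y : EuclideanSpace ℝ (Fin n)}
    (hy : ‖y - x‖ = t) :
    jet₁ p x u t y = scalingJet (kExp p) x u 1 y ∧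
    jet₂ p x u t y = scalingJet (kExp p) x u 2 y - scalingJet (kExp p) x u 1 y ∧
    jet₃ p x u t y = scalingJet (kExp p) x u 3 y - 3 * scalingJet (kExp p) x u 2 y
      + 2 * scalingJet (kExp p) x u 1 y ∧
    jet₄ p x u t y = scalingJet (kExp p) x u 4 y - 6 * scalingJet (kExp p) x u 3 y
      + 11 * scalingJet (kExp p) x u 2 y - 6 * scalingJet (kExp p) x u 1 y := by
  obtain ⟨h1, h2, h3, h4, -⟩ := radialDeriv_iterates x hu (kExp p) ht hy
  rw [coe_scalingJet _ x hu (by norm_num), coe_scalingJet _ x hu (by norm_num),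
    coe_scalingJet _ x hu (by norm_num), coe_scalingJet _ x hu (by norm_num)]
  exact ⟨h1, h2, h3, h4⟩

theorem angularLaplacianEnergy_eq [NeZero n] (hp : 1 < p) (hu : ContDiff ℝ 6 u) (ht : 0 < t) :
    angularLaplacianEnergy p x u t =
      pairing (kExp p) x t (lapJet (kExp p) x u 0) (lapJet (kExp p) x u 0) := by
  refine boundary_eq_pairing x hp ht _ _ fun y hy => ?_
  rw [(radialDeriv_iterates x hu (kExp p) ht hy).2.2.2.2, coe_lapJet _ x hu (by norm_num), pow_two]
  rfl

theorem angularGradientEnergy_eq [NeZero n] (hp : 1 < p) (hu : ContDiff ℝ 6 u) (ht : 0 < t) :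
    angularGradientEnergy p x u t =
      -pairing (kExp p) x t (scalingJet (kExp p) x u 0) (lapJet (kExp p) x u 0) := by
  rw [angularGradientEnergy, boundary_eq x hp ht,
    pairing_angLap_eq_neg _ x (contDiff_scalingJet _ x hu (m := 2) (by norm_num))
      (lapJet_eq _ x hu (by norm_num)) ht, neg_neg, coe_scalingJet _ x hu (by norm_num)]
  congr 1
  exact sphereIntegral_congr x ht fun y hy => angularGradient_eq x u ht hy

theorem angularGradientEnergy'_eq [NeZero n] (hp : 1 < p) (hu : ContDiff ℝ 6 u) (ht : 0 < t) :
    angularGradientEnergy' p x u t =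
      -(t⁻¹ ^ 2 *
        pairing (kExp p) x t (scalingJet (kExp p) x u 1) (lapJet (kExp p) x u 1)) := by
  rw [angularGradientEnergy', boundary_eq x hp ht,
    pairing_angLap_eq_neg _ x (contDiff_scalingJet _ x hu (m := 2) (by norm_num))
      (lapJet_eq _ x hu (by norm_num)) ht, coe_scalingJet _ x hu (by norm_num),
    sphereIntegral_congr x ht fun y hy => angularGradient_jet₁ x hu ht hy,
    sphereIntegral_const_mul]
  simp only [Function.iterate_one]
  ring

theorem deriv_angularLaplacianEnergy [NeZero n] (hp : 1 < p) (hu : ContDiff ℝ 6 u) (ht : 0 < t) :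
    deriv (fun s => angularLaplacianEnergy p x u s) t =
      t⁻¹ * (2 * pairing (kExp p) x t (lapJet (kExp p) x u 0) (lapJet (kExp p) x u 1)) := by
  have h := hasDerivAt_lapJet_lapJet (kExp p) x hu ht (i := 0) (j := 0) (by norm_num) (by norm_num)
  have e : (fun s => angularLaplacianEnergy p x u s) =ᶠ[𝓝 t] fun s =>
      pairing (kExp p) x s (lapJet (kExp p) x u 0) (lapJet (kExp p) x u 0) := by
    filter_upwards [lt_mem_nhds ht] with s hs using angularLaplacianEnergy_eq x hp hu hs
  rw [(h.congr_of_eventuallyEq e).deriv, pairing_comm _ x t (lapJet (kExp p) x u (0 + 1))]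
  ring

theorem deriv_angularGradientEnergy [NeZero n] (hp : 1 < p) (hu : ContDiff ℝ 6 u) (ht : 0 < t) :
    deriv (fun s => angularGradientEnergy p x u s) t =
      -(t⁻¹ * (2 * pairing (kExp p) x t (scalingJet (kExp p) x u 1) (lapJet (kExp p) x u 0))) := by
  have h := (hasDerivAt_scalingJet_lapJet (kExp p) x hu ht (i := 0) (j := 0) (by norm_num)
    (by norm_num)).neg
  have e : (fun s => angularGradientEnergy p x u s) =ᶠ[𝓝 t] -fun s =>
      pairing (kExp p) x s (scalingJet (kExp p) x u 0) (lapJet (kExp p) x u 0) := by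
    filter_upwards [lt_mem_nhds ht] with s hs using angularGradientEnergy_eq x hp hu hs
  rw [(h.congr_of_eventuallyEq e).deriv,
    pairing_scalingJet_lapJet _ x hu ht (i := 0) (j := 0 + 1) (by norm_num) (by norm_num)]
  ring

theorem deriv_angularGradientEnergy' [NeZero n] (hp : 1 < p) (hu : ContDiff ℝ 6 u) (ht : 0 < t) :
    deriv (fun s => angularGradientEnergy' p x u s) t =
      t⁻¹ ^ 3 * (2 * pairing (kExp p) x t (scalingJet (kExp p) x u 1) (lapJet (kExp p) x u 1)
        - 2 * pairing (kExp p) x t (scalingJet (kExp p) x u 2) (lapJet (kExp p) x u 1)) := by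
  have h := (((hasDerivAt_inv ht.ne').pow 2).mul (hasDerivAt_scalingJet_lapJet (kExp p) x hu ht
    (i := 1) (j := 1) (by norm_num) (by norm_num))).neg
  have e : (fun s => angularGradientEnergy' p x u s) =ᶠ[𝓝 t] -((Inv.inv ^ 2) * fun s =>
      pairing (kExp p) x s (scalingJet (kExp p) x u 1) (lapJet (kExp p) x u 1)) := by
    filter_upwards [lt_mem_nhds ht] with s hs using angularGradientEnergy'_eq x hp hu hs
  rw [(h.congr_of_eventuallyEq e).deriv,
    pairing_scalingJet_lapJet _ x hu ht (i := 1) (j := 1 + 1) (by norm_num) (by norm_num)]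
  simp only [Pi.pow_apply, Nat.reduceSub, pow_one]
  have ht' := ht.ne'
  field_simp
  ring

theorem energy_eq [NeZero n] (hp : 1 < p) (hu : ContDiff ℝ 6 u) (ht : 0 < t) :
    energy p x u t =
      t ^ (2 * kExp p + 6 - n) * (∫ y in ball x t, lagrangian p u y)
      - pairing (kExp p) x t (scalingJet (kExp p) x u 4) (scalingJet (kExp p) x u 1)
      + 2 * pairing (kExp p) x t (scalingJet (kExp p) x u 3) (scalingJet (kExp p) x u 2)
      + (10 - δ₁ n p) * pairing (kExp p) x t (scalingJet (kExp p) x u 3) (scalingJet (kExp p) x u 1)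
      + (δ₁ n p - 14) * pairing (kExp p) x t (scalingJet (kExp p) x u 2) (scalingJet (kExp p) x u 2)
      + (7 * δ₁ n p - δ₂ n p - 27)
        * pairing (kExp p) x t (scalingJet (kExp p) x u 2) (scalingJet (kExp p) x u 1)
      + (66 - 16 * δ₁ n p + 4 * δ₂ n p)
        * pairing (kExp p) x t (scalingJet (kExp p) x u 1) (scalingJet (kExp p) x u 1)
      + δ₄ n p * pairing (kExp p) x t (scalingJet (kExp p) x u 1) (scalingJet (kExp p) x u 0)
      + 2 * δ₄ n p * pairing (kExp p) x t (scalingJet (kExp p) x u 0) (scalingJet (kExp p) x u 0)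
      + (kExp p + 2) / 2 * pairing (kExp p) x t (lapJet₂ (kExp p) x u 0) (lapJet₂ (kExp p) x u 0)
      + 2 * pairing (kExp p) x t (lapJet (kExp p) x u 0) (lapJet (kExp p) x u 0)
      + pairing (kExp p) x t (lapJet (kExp p) x u 0) (lapJet (kExp p) x u 1)
      + 4 * (β n p - n + 4)
        * pairing (kExp p) x t (scalingJet (kExp p) x u 0) (lapJet (kExp p) x u 0)
      + 2 * (β n p - n + 4)
        * pairing (kExp p) x t (scalingJet (kExp p) x u 1) (lapJet (kExp p) x u 0)
      + 8 * pairing (kExp p) x t (scalingJet (kExp p) x u 1) (lapJet (kExp p) x u 1)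
      - 2 * pairing (kExp p) x t (scalingJet (kExp p) x u 2) (lapJet (kExp p) x u 1) := by
  have hJ := fun y hy => jets_eq (p := p) x hu ht (y := y) hy
  have hU0 : ⇑(scalingJet (kExp p) x u 0) = u := coe_scalingJet _ x hu (by norm_num)
  have hbulk : (∫ y in Metric.ball x t, 1 / 2 * ‖gradient (Δ u) y‖ ^ 2)
      - 1 / (p + 1) * (∫ y in Metric.ball x t, |u y| ^ (p + 1)) =
      ∫ y in ball x t, lagrangian p u y := by
    have hint : ∀ {f : EuclideanSpace ℝ (Fin n) → ℝ}, Continuous f →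
        IntegrableOn f (ball x t) := fun hf =>
      (hf.continuousOn.integrableOn_compact (isCompact_closedBall x t)).mono_set
        ball_subset_closedBall
    have c1 : Continuous (fun y => ‖gradient (Δ u) y‖ ^ 2) :=
      (contDiff_normSq_gradient (contDiff_laplacian hu (by norm_num))).continuous
    have c2 : Continuous (fun y => |u y| ^ (p + 1)) :=
      (contDiff_abs_rpow (by linarith) (hu.of_le (by norm_num))).continuous
    rw [← integral_const_mul]
    exact (integral_sub (hint (continuous_const.mul c1)) (hint (continuous_const.mul c2))).symm
  have hB1 : boundary p x t (fun y => jet₄ p x u t y * jet₁ p x u t y) =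
      pairing (kExp p) x t (scalingJet (kExp p) x u 4 - (6 : ℝ) • scalingJet (kExp p) x u 3
        + (11 : ℝ) • scalingJet (kExp p) x u 2 - (6 : ℝ) • scalingJet (kExp p) x u 1)
        (scalingJet (kExp p) x u 1) :=
    boundary_eq_pairing x hp ht _ _ fun y hy => by
      rw [(hJ y hy).2.2.2, (hJ y hy).1]; rfl
  have hB2 : boundary p x t (fun y => jet₃ p x u t y * jet₂ p x u t y) =
      pairing (kExp p) x t (scalingJet (kExp p) x u 3 - (3 : ℝ) • scalingJet (kExp p) x u 2
        + (2 : ℝ) • scalingJet (kExp p) x u 1)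
        (scalingJet (kExp p) x u 2 - scalingJet (kExp p) x u 1) :=
    boundary_eq_pairing x hp ht _ _ fun y hy => by
      rw [(hJ y hy).2.2.1, (hJ y hy).2.1]; rfl
  have hB3 : boundary p x t (fun y => jet₃ p x u t y * jet₁ p x u t y) =
      pairing (kExp p) x t (scalingJet (kExp p) x u 3 - (3 : ℝ) • scalingJet (kExp p) x u 2
        + (2 : ℝ) • scalingJet (kExp p) x u 1) (scalingJet (kExp p) x u 1) :=
    boundary_eq_pairing x hp ht _ _ fun y hy => by
      rw [(hJ y hy).2.2.1, (hJ y hy).1]; rfl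
  have hB4 : boundary p x t (fun y => t ^ 4 * (Δ u) y ^ 2) =
      pairing (kExp p) x t (lapJet₂ (kExp p) x u 0) (lapJet₂ (kExp p) x u 0) :=
    boundary_eq_pairing x hp ht _ _ fun y hy => by
      simp only [lapJet₂_zero _ x hu, hy]; ring
  have hB5 : boundary p x t (fun y => jet₂ p x u t y * jet₁ p x u t y) =
      pairing (kExp p) x t (scalingJet (kExp p) x u 2 - scalingJet (kExp p) x u 1)
        (scalingJet (kExp p) x u 1) :=
    boundary_eq_pairing x hp ht _ _ fun y hy => by
      rw [(hJ y hy).2.1, (hJ y hy).1]; rfl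
  have hB6 : boundary p x t (fun y => jet₁ p x u t y ^ 2) =
      pairing (kExp p) x t (scalingJet (kExp p) x u 1) (scalingJet (kExp p) x u 1) :=
    boundary_eq_pairing x hp ht _ _ fun y hy => by
      rw [(hJ y hy).1, pow_two]
  have hB7 : boundary p x t (fun y => jet₂ p x u t y ^ 2) =
      pairing (kExp p) x t (scalingJet (kExp p) x u 2 - scalingJet (kExp p) x u 1)
        (scalingJet (kExp p) x u 2 - scalingJet (kExp p) x u 1) :=
    boundary_eq_pairing x hp ht _ _ fun y hy => by
      rw [(hJ y hy).2.1, pow_two]; rfl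
  have hB8 : boundary p x t (fun y => jet₁ p x u t y * u y) =
      pairing (kExp p) x t (scalingJet (kExp p) x u 1) (scalingJet (kExp p) x u 0) :=
    boundary_eq_pairing x hp ht _ _ fun y hy => by
      rw [(hJ y hy).1, hU0]
  have hB9 : boundary p x t (fun y => u y ^ 2) =
      pairing (kExp p) x t (scalingJet (kExp p) x u 0) (scalingJet (kExp p) x u 0) :=
    boundary_eq_pairing x hp ht _ _ fun y hy => by
      rw [hU0, pow_two]
  rw [energy, hbulk, exponent_eq hp, hB1, hB2, hB3, hB4, hB5, hB6, hB7, hB8, hB9,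
    angularLaplacianEnergy_eq x hp hu ht, angularGradientEnergy_eq x hp hu ht,
    angularGradientEnergy'_eq x hp hu ht, deriv_angularLaplacianEnergy x hp hu ht,
    deriv_angularGradientEnergy x hp hu ht, deriv_angularGradientEnergy' x hp hu ht]
  simp only [map_add, map_sub, map_smul, LinearMap.add_apply, LinearMap.sub_apply,
    LinearMap.smul_apply, smul_eq_mul]
  rw [pairing_comm _ x t (scalingJet (kExp p) x u 1) (scalingJet (kExp p) x u 2)]
  have i1 : t * t⁻¹ = 1 := mul_inv_cancel₀ ht.ne'
  have i2 : t ^ 2 * t⁻¹ ^ 2 = 1 := by rw [← mul_pow, i1, one_pow]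
  have i3 : t ^ 3 * t⁻¹ ^ 3 = 1 := by rw [← mul_pow, i1, one_pow]
  generalize pairing (kExp p) x t = B
  linear_combination (B (lapJet (kExp p) x u 0) (lapJet (kExp p) x u 1)
      + (β n p - n + 4) * (2 * B (scalingJet (kExp p) x u 1) (lapJet (kExp p) x u 0))) * i1
    + 6 * B (scalingJet (kExp p) x u 1) (lapJet (kExp p) x u 1) * i2
    + (2 * B (scalingJet (kExp p) x u 1) (lapJet (kExp p) x u 1)
        - 2 * B (scalingJet (kExp p) x u 2) (lapJet (kExp p) x u 1)) * i3

/-- The exponent κ is free because the second derivative of the rescaled function uses κ = k - 1. -/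
theorem hasDerivAt_rpow_mul_ray (κ : ℝ) {f : EuclideanSpace ℝ (Fin n) → ℝ}
    (hf : ContDiff ℝ 1 f) (θ : EuclideanSpace ℝ (Fin n)) (ht : 0 < t) :
    HasDerivAt (fun s : ℝ => s ^ κ * f (x + s • θ))
      (t ^ (κ - 1) * (scaling x κ f (x + t • θ))) t := by
  have h := (Real.hasDerivAt_rpow_const (x := t) (p := κ) (Or.inl ht.ne')).mul
    (hasDerivAt_comp_ray x (hf.differentiable (by norm_num) (x + t • θ)))
  refine h.congr_deriv ?_
  have e : euler x f (x + t • θ) = t * fderiv ℝ f (x + t • θ) θ := by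
    simp [euler]
  rw [scaling, e, Real.rpow_sub_one ht.ne']
  have ht' := ht.ne'
  field_simp

theorem iteratedDeriv_rescaled (hu : ContDiff ℝ 6 u) (θ : EuclideanSpace ℝ (Fin n)) (ht : 0 < t) :
    t * iteratedDeriv 1 (fun s => rescaled p x u s θ) t =
      t ^ kExp p * scalingJet (kExp p) x u 1 (x + t • θ) ∧
    t ^ 2 * iteratedDeriv 2 (fun s => rescaled p x u s θ) t =
      t ^ kExp p * (scalingJet (kExp p) x u 2 (x + t • θ)
        - scalingJet (kExp p) x u 1 (x + t • θ)) := by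
  have hc1 : ContDiff ℝ 1 u := hu.of_le (by norm_num)
  have hs : ContDiff ℝ 1 (scaling x (kExp p) u) := contDiff_scaling x _ hu (by norm_num)
  have d1 : ∀ s : ℝ, 0 < s → deriv (fun s => rescaled p x u s θ) s =
      s ^ (kExp p - 1) * scaling x (kExp p) u (x + s • θ) := fun s hs =>
    (hasDerivAt_rpow_mul_ray x (kExp p) hc1 θ hs).deriv
  have d2 : deriv (deriv (fun s => rescaled p x u s θ)) t =
      t ^ (kExp p - 1 - 1) * scaling x (kExp p - 1) (scaling x (kExp p) u) (x + t • θ) := by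
    have h := hasDerivAt_rpow_mul_ray x (kExp p - 1) hs θ ht
    refine (h.congr_of_eventuallyEq ?_).deriv
    filter_upwards [lt_mem_nhds ht] with s hs using d1 s hs
  have ht' := ht.ne'
  rw [coe_scalingJet _ x hu (by norm_num), coe_scalingJet _ x hu (by norm_num)]
  refine ⟨?_, ?_⟩
  · rw [iteratedDeriv_one, d1 t ht, Real.rpow_sub_one ht']
    simp only [Function.iterate_one]
    field_simp
  · rw [iteratedDeriv_succ, iteratedDeriv_one, d2, Real.rpow_sub_one ht', Real.rpow_sub_one ht']
    -- Lowering the exponent by one subtracts the identity from the scaling operator.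
    have e : scaling x (kExp p - 1) (scaling x (kExp p) u) (x + t • θ) =
        (scaling x (kExp p))^[2] u (x + t • θ) - (scaling x (kExp p))^[1] u (x + t • θ) := by
      change _ = scaling x (kExp p) (scaling x (kExp p) u) (x + t • θ)
        - scaling x (kExp p) u (x + t • θ)
      rw [scaling, scaling.eq_def x (kExp p) (scaling x (kExp p) u)]
      ring
    rw [e]
    field_simp

/-- An upper triangular c with vanishing (0,2) entry reaches all the pairings of U₀, U₁, U₂ except
⟨U₀,U₂⟩. The mixed coefficients come from t² d²/dt² = Λ² - Λ. -/
theorem modifiedEnergy_eq (hu : ContDiff ℝ 6 u) (ht : 0 < t)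
    (c₀₀ c₀₁ c₁₁ c₁₂ c₂₂ : ℝ) :
    modifiedEnergy p x u t ![![c₀₀, c₀₁, 0], ![0, c₁₁, c₁₂], ![0, 0, c₂₂]] =
      energy p x u t
      - (c₀₀ * pairing (kExp p) x t (scalingJet (kExp p) x u 0) (scalingJet (kExp p) x u 0)
        + c₀₁ * pairing (kExp p) x t (scalingJet (kExp p) x u 1) (scalingJet (kExp p) x u 0)
        + (c₁₁ - c₁₂ + c₂₂)
          * pairing (kExp p) x t (scalingJet (kExp p) x u 1) (scalingJet (kExp p) x u 1)
        + (c₁₂ - 2 * c₂₂)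
          * pairing (kExp p) x t (scalingJet (kExp p) x u 2) (scalingJet (kExp p) x u 1)
        + c₂₂
          * pairing (kExp p) x t (scalingJet (kExp p) x u 2) (scalingJet (kExp p) x u 2)) := by
  rw [modifiedEnergy]
  congr 1
  have hU0 : ⇑(scalingJet (kExp p) x u 0) = u := coe_scalingJet _ x hu (by norm_num)
  simp only [pairing_apply]
  simp only [mul_left_comm _ (t ^ (2 * kExp p)), ← sphereIntegral_const_mul]
  rw [← sphereIntegral_add x (by fun_prop) (by fun_prop),
    ← sphereIntegral_add x (by fun_prop) (by fun_prop),
    ← sphereIntegral_add x (by fun_prop) (by fun_prop),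
    ← sphereIntegral_add x (by fun_prop) (by fun_prop)]
  rw [surfaceIntegral, one_pow, one_mul]
  refine integral_congr_ae (Eventually.of_forall fun θ => ?_)
  obtain ⟨h1, h2⟩ := iteratedDeriv_rescaled (p := p) x hu (θ : EuclideanSpace ℝ (Fin n)) ht
  have h0 : rescaled p x u t θ = t ^ kExp p * scalingJet (kExp p) x u 0 (x + t • (θ : _)) := by
    rw [hU0]; rfl
  have hk : t ^ (2 * kExp p) = t ^ kExp p * t ^ kExp p := by
    rw [← Real.rpow_add ht]; ring_nf
  simp only [zero_add, one_smul]
  simp only [Fin.sum_univ_three, Fin.isValue, Matrix.cons_val_zero, Matrix.cons_val_one,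
    Matrix.cons_val, Fin.val_zero, Fin.val_one, Fin.val_two, iteratedDeriv_zero, h0, hk]
  generalize iteratedDeriv 1 (fun s => rescaled p x u s θ) t = D1 at *
  generalize iteratedDeriv 2 (fun s => rescaled p x u s θ) t = D2 at *
  generalize t ^ kExp p = T at *
  have h11 : t ^ (1 + 1) * D1 * D1 = (t * D1) * (t * D1) := by ring
  have h12 : t ^ (1 + 2) * D1 * D2 = (t * D1) * (t ^ 2 * D2) := by ring
  have h22 : t ^ (2 + 2) * D2 * D2 = (t ^ 2 * D2) * (t ^ 2 * D2) := by ring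
  rw [h1] at h11 h12
  rw [h2] at h12 h22
  linear_combination c₁₁ * h11 + c₁₂ * h12 + c₂₂ * h22
    + c₀₁ * T * scalingJet (kExp p) x u 0 (x + t • (θ : _)) * h1

end Expansion

/-! ### The derivative of the modified energy -/

section Derivative

/-- The coefficients `c_{ij}` of the modified energy, depending on a free parameter `γ`. -/
def energyCoeff (n : ℕ) (p γ : ℝ) : Fin 3 → Fin 3 → ℝ :=
  let a := (n : ℝ) - 2 - 2 * kExp p
  let b := kExp p * (kExp p + 2 - n)
  let a' := (n : ℝ) - 6 - 2 * kExp p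
  let b' := (kExp p + 2) * (kExp p + 4 - n)
  -- The entries replace the boundary coefficients of the energy by those for which the derivative
  -- sees only jets of order 1 to 3. The part -2γ of `c₁₂` leaves 2γ⟨U₂,U₁⟩ in the modified energy,
  -- and t d/dt of that is 2γ(⟨U₃,U₁⟩ + ⟨U₂,U₂⟩).
  let c₂₂ := δ₁ n p - 12 - a'
  let c₁₂ := 7 * δ₁ n p - δ₂ n p - 27 + (3 * b + b' + a * a' - 4 * (a + a')) - 2 * γ + 2 * c₂₂
  let c₁₁ := 66 - 16 * δ₁ n p + 4 * δ₂ n p + (a * b - 2 * (b + b' + a * a')) - c₂₂ + c₁₂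
  ![![2 * δ₄ n p - 2 * (b * b'), δ₄ n p - b * b', 0], ![0, c₁₁, c₁₂], ![0, 0, c₂₂]]

variable {n : ℕ} {p : ℝ} (x : EuclideanSpace ℝ (Fin n)) {u : EuclideanSpace ℝ (Fin n) → ℝ} {t : ℝ}

theorem modifiedEnergy_energyCoeff [NeZero n] (hp : 1 < p) (hu : ContDiff ℝ 6 u) (γ : ℝ)
    {a b a' b' : ℝ} (ha : a = (n : ℝ) - 2 - 2 * kExp p) (hb : b = kExp p * (kExp p + 2 - n))
    (ha' : a' = (n : ℝ) - 6 - 2 * kExp p) (hb' : b' = (kExp p + 2) * (kExp p + 4 - n))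
    (ht : 0 < t) :
    modifiedEnergy p x u t (energyCoeff n p γ) =
      t ^ (2 * kExp p + 6 - n) * (∫ y in ball x t, lagrangian p u y)
      - pairing (kExp p) x t (scalingJet (kExp p) x u 4) (scalingJet (kExp p) x u 1)
      + 2 * pairing (kExp p) x t (scalingJet (kExp p) x u 3) (scalingJet (kExp p) x u 2)
      + (4 - a - a') * pairing (kExp p) x t (scalingJet (kExp p) x u 3) (scalingJet (kExp p) x u 1)
      + (a' - 2) * pairing (kExp p) x t (scalingJet (kExp p) x u 2) (scalingJet (kExp p) x u 2)
      + (2 * γ - (3 * b + b' + a * a' - 4 * (a + a')))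
        * pairing (kExp p) x t (scalingJet (kExp p) x u 2) (scalingJet (kExp p) x u 1)
      + (2 * (b + b' + a * a') - a * b)
        * pairing (kExp p) x t (scalingJet (kExp p) x u 1) (scalingJet (kExp p) x u 1)
      + b * b' * pairing (kExp p) x t (scalingJet (kExp p) x u 1) (scalingJet (kExp p) x u 0)
      + 2 * (b * b') * pairing (kExp p) x t (scalingJet (kExp p) x u 0) (scalingJet (kExp p) x u 0)
      + (kExp p + 2) / 2 * pairing (kExp p) x t (lapJet₂ (kExp p) x u 0) (lapJet₂ (kExp p) x u 0)
      + 2 * pairing (kExp p) x t (lapJet (kExp p) x u 0) (lapJet (kExp p) x u 0)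
      + pairing (kExp p) x t (lapJet (kExp p) x u 0) (lapJet (kExp p) x u 1)
      + 2 * (b + b') * pairing (kExp p) x t (scalingJet (kExp p) x u 0) (lapJet (kExp p) x u 0)
      + (b + b') * pairing (kExp p) x t (scalingJet (kExp p) x u 1) (lapJet (kExp p) x u 0)
      + 8 * pairing (kExp p) x t (scalingJet (kExp p) x u 1) (lapJet (kExp p) x u 1)
      - 2 * pairing (kExp p) x t (scalingJet (kExp p) x u 2) (lapJet (kExp p) x u 1) := by
  -- The coefficients of ⟨U₃,U₁⟩, ⟨U₀,LU₀⟩ and ⟨U₁,LU₀⟩ are out of reach of c; these two identities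
  -- put them in the required form.
  have h1 : δ₁ n p = a + a' + 6 := by rw [δ₁, ha, ha']; ring
  have h2 : β n p - n + 4 = (b + b') / 2 := by rw [β, hb, hb']; ring
  rw [energyCoeff, modifiedEnergy_eq x hu ht, energy_eq x hp hu ht, h2, h1, ← ha, ← hb, ← ha', ← hb']
  ring

/-- The derivative of the modified energy, as a quadratic form in the jets. -/
theorem hasDerivAt_modifiedEnergy (hn : 3 ≤ n) (hp : 1 < p) (hu : IsSolution n p u) (γ : ℝ)
    {a b a' b' : ℝ} (ha : a = (n : ℝ) - 2 - 2 * kExp p) (hb : b = kExp p * (kExp p + 2 - n))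
    (ha' : a' = (n : ℝ) - 6 - 2 * kExp p) (hb' : b' = (kExp p + 2) * (kExp p + 4 - n))
    (ht : 0 < t) :
    HasDerivAt (fun s => modifiedEnergy p x u s (energyCoeff n p γ))
      (t⁻¹ * (3 * pairing (kExp p) x t (scalingJet (kExp p) x u 3) (scalingJet (kExp p) x u 3)
        + 2 * γ * pairing (kExp p) x t (scalingJet (kExp p) x u 3) (scalingJet (kExp p) x u 1)
        + 2 * pairing (kExp p) x t (scalingJet (kExp p) x u 3) (lapJet (kExp p) x u 1)
        + (a ^ 2 - 4 * b - 2 * b' - 2 * a * a' + 4 * (a + a') + 2 * γ)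
          * pairing (kExp p) x t (scalingJet (kExp p) x u 2) (scalingJet (kExp p) x u 2)
        - 4 * pairing (kExp p) x t (scalingJet (kExp p) x u 2) (lapJet (kExp p) x u 2)
        + 2 * (a + 4) * pairing (kExp p) x t (scalingJet (kExp p) x u 2) (lapJet (kExp p) x u 1)
        + (b ^ 2 + 2 * b * b' - 4 * (a * b' + a' * b))
          * pairing (kExp p) x t (scalingJet (kExp p) x u 1) (scalingJet (kExp p) x u 1)
        - (4 * (a + a') - 4 * b - 2 * b')
          * pairing (kExp p) x t (scalingJet (kExp p) x u 1) (lapJet (kExp p) x u 1)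
        + 3 * pairing (kExp p) x t (lapJet (kExp p) x u 1) (lapJet (kExp p) x u 1))) t := by
  have : NeZero n := ⟨by omega⟩
  have hu6 := hu.1
  have hk : kExp p * (p - 1) = 6 := by
    have : p - 1 ≠ 0 := by linarith
    rw [kExp]; field_simp
  have hUU := fun {i j : ℕ} => hasDerivAt_scalingJet_scalingJet (kExp p) x hu6 ht (i := i) (j := j)
  have hUL := fun {i j : ℕ} => hasDerivAt_scalingJet_lapJet (kExp p) x hu6 ht (i := i) (j := j)
  have hLL := fun {i j : ℕ} => hasDerivAt_lapJet_lapJet (kExp p) x hu6 ht (i := i) (j := j)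
  have hV := hasDerivAt_pairing (kExp p) x (contDiff_lapJet₂ (kExp p) x hu6 (m := 1) (j := 0)
    (by norm_num)) (contDiff_lapJet₂ (kExp p) x hu6 (m := 1) (j := 0) (by norm_num))
    (scaling_lapJet₂ (kExp p) x hu6 (j := 0) (by norm_num))
    (scaling_lapJet₂ (kExp p) x hu6 (j := 0) (by norm_num)) ht
  have hbulk := hasDerivAt_bulk x hn hp hk hu ht
  rw [pairing_pohozaevFlux (kExp p) x hu6] at hbulk
  have h := (((((((((((((((hbulk.fun_sub (hUU (i := 4) (j := 1) (by norm_num) (by norm_num))).fun_add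
    ((hUU (i := 3) (j := 2) (by norm_num) (by norm_num)).const_mul 2)).fun_add
    ((hUU (i := 3) (j := 1) (by norm_num) (by norm_num)).const_mul (4 - a - a'))).fun_add
    ((hUU (i := 2) (j := 2) (by norm_num) (by norm_num)).const_mul (a' - 2))).fun_add
    ((hUU (i := 2) (j := 1) (by norm_num) (by norm_num)).const_mul
      (2 * γ - (3 * b + b' + a * a' - 4 * (a + a'))))).fun_add
    ((hUU (i := 1) (j := 1) (by norm_num) (by norm_num)).const_mul
      (2 * (b + b' + a * a') - a * b))).fun_add
    ((hUU (i := 1) (j := 0) (by norm_num) (by norm_num)).const_mul (b * b'))).fun_add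
    ((hUU (i := 0) (j := 0) (by norm_num) (by norm_num)).const_mul (2 * (b * b')))).fun_add
    (hV.const_mul ((kExp p + 2) / 2))).fun_add
    ((hLL (i := 0) (j := 0) (by norm_num) (by norm_num)).const_mul 2)).fun_add
    (hLL (i := 0) (j := 1) (by norm_num) (by norm_num))).fun_add
    ((hUL (i := 0) (j := 0) (by norm_num) (by norm_num)).const_mul (2 * (b + b')))).fun_add
    ((hUL (i := 1) (j := 0) (by norm_num) (by norm_num)).const_mul (b + b'))).fun_add
    ((hUL (i := 1) (j := 1) (by norm_num) (by norm_num)).const_mul 8)).fun_sub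
    ((hUL (i := 2) (j := 1) (by norm_num) (by norm_num)).const_mul 2))
  refine HasDerivAt.congr_deriv (h.congr_of_eventuallyEq ?_) ?_
  · filter_upwards [lt_mem_nhds ht] with s hs
    exact modifiedEnergy_energyCoeff x hp hu6 γ ha hb ha' hb' hs
  clear h hV hbulk hUU hUL hLL
  -- Symmetry of the pairing and of L brings each pairing to one representative, with L² split
  -- between the two arguments. After that the cancellation is polynomial algebra.
  have sL := fun {i j : ℕ} => pairing_scalingJet_lapJet (kExp p) x hu6 ht (i := i) (j := j)
  have sQ := fun {i j : ℕ} => pairing_scalingJet_bilapJet (kExp p) x hu6 ht (i := i) (j := j)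
  have cU := fun i j : ℕ => pairing_comm (kExp p) x t (scalingJet (kExp p) x u i)
    (scalingJet (kExp p) x u j)
  have cL := fun i j : ℕ => pairing_comm (kExp p) x t (lapJet (kExp p) x u i)
    (lapJet (kExp p) x u j)
  have cX := fun i j : ℕ => pairing_comm (kExp p) x t (lapJet (kExp p) x u i)
    (scalingJet (kExp p) x u j)
  have cQ := fun i j : ℕ => pairing_comm (kExp p) x t (bilapJet (kExp p) x u i)
    (scalingJet (kExp p) x u j)
  simp only [lapJet₄, lapJet₂, angLapJet₂, map_add, map_smul, LinearMap.add_apply,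
    LinearMap.smul_apply, smul_eq_mul, zero_add, Nat.reduceAdd, ← ha, ← hb, ← ha', ← hb']
  simp only [cX, cQ]
  simp only [sQ (i := 1) (j := 0) (by norm_num) (by norm_num),
    sQ (i := 2) (j := 0) (by norm_num) (by norm_num),
    sQ (i := 1) (j := 1) (by norm_num) (by norm_num),
    sL (i := 0) (j := 1) (by norm_num) (by norm_num),
    sL (i := 1) (j := 2) (by norm_num) (by norm_num),
    sL (i := 1) (j := 3) (by norm_num) (by norm_num),
    cL 0 1, cL 0 2, cU 0 1, cU 0 2, cU 0 3, cU 1 2, cU 1 3, cU 1 4, cU 1 5, cU 2 3]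
  ring

end Derivative

/-! ### The sign of the derivative -/

section Sign

variable {n : ℕ} (k : ℝ) (x : EuclideanSpace ℝ (Fin n)) {u : EuclideanSpace ℝ (Fin n) → ℝ} {t : ℝ}

/-- Coercivity of the quadratic form `hasDerivAt_modifiedEnergy`, by completing squares in
`3 U₃ + γ U₁ + Δ_θ U₁` and in the angular gradient of `2 U₂ - (a + 4) / 2 U₁`. -/
theorem le_quadraticForm [NeZero n] (hu : ContDiff ℝ 6 u) (ht : 0 < t) {a A₁ A₂ A₃ γ : ℝ}
    (h₁ : 0 ≤ A₁ + 2 * γ) (h₂ : ((a + 4) / 2) ^ 2 ≤ A₂ + 2 * γ / 3) :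
    (A₃ - γ ^ 2 / 3) * pairing k x t (scalingJet k x u 1) (scalingJet k x u 1) ≤
      3 * pairing k x t (scalingJet k x u 3) (scalingJet k x u 3)
        + 2 * γ * pairing k x t (scalingJet k x u 3) (scalingJet k x u 1)
        + 2 * pairing k x t (scalingJet k x u 3) (lapJet k x u 1)
        + (A₁ + 2 * γ) * pairing k x t (scalingJet k x u 2) (scalingJet k x u 2)
        - 4 * pairing k x t (scalingJet k x u 2) (lapJet k x u 2)
        + 2 * (a + 4) * pairing k x t (scalingJet k x u 2) (lapJet k x u 1)
        + A₃ * pairing k x t (scalingJet k x u 1) (scalingJet k x u 1)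
        - A₂ * pairing k x t (scalingJet k x u 1) (lapJet k x u 1)
        + 3 * pairing k x t (lapJet k x u 1) (lapJet k x u 1) := by
  have hU : ∀ j ≤ 2, ContDiff ℝ 2 (scalingJet k x u j) := fun j hj =>
    contDiff_scalingJet k x hu (m := 2) (by omega)
  have hs := pairing_self_nonneg k x ht
    ((3 : ℝ) • scalingJet k x u 3 + γ • scalingJet k x u 1 + lapJet k x u 1)
  have hF := pairing_angLap_self_nonpos k x
    (f := (2 : ℝ) • scalingJet k x u 2 + (-((a + 4) / 2)) • scalingJet k x u 1)
    (lf := (2 : ℝ) • lapJet k x u 2 + (-((a + 4) / 2)) • lapJet k x u 1)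
    ((contDiff_const.mul (hU 2 le_rfl)).add (contDiff_const.mul (hU 1 (by norm_num))))
    (by
      funext y
      simp only [ContinuousMap.coe_add, ContinuousMap.coe_smul, Pi.add_apply, Pi.smul_apply,
        smul_eq_mul, lapJet_eq k x hu (show 2 ≤ 4 by norm_num),
        lapJet_eq k x hu (show 1 ≤ 4 by norm_num)]
      rw [← angLap_const_mul x _ (hU 2 le_rfl), ← angLap_const_mul x _ (hU 1 (by norm_num)),
        ← angLap_add x (contDiff_const.mul (hU 2 le_rfl))
          (contDiff_const.mul (hU 1 (by norm_num)))]
      rfl) ht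
  have h11 := pairing_angLap_self_nonpos k x (hU 1 (by norm_num))
    (lapJet_eq k x hu (show 1 ≤ 4 by norm_num)) ht
  have hLL := pairing_self_nonneg k x ht (lapJet k x u 1)
  have h22 := mul_nonneg h₁ (pairing_self_nonneg k x ht (scalingJet k x u 2))
  have h11' := mul_nonneg (sub_nonneg.2 h₂) (neg_nonneg.2 h11)
  simp only [map_add, map_smul, LinearMap.add_apply, LinearMap.smul_apply, smul_eq_mul,
    pairing_comm k x t (lapJet k x u 1) (scalingJet k x u _),
    pairing_comm k x t (scalingJet k x u 1) (scalingJet k x u 3),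
    pairing_scalingJet_lapJet k x hu ht (i := 1) (j := 2) (by norm_num) (by norm_num)] at hs hF
  -- The difference of the two sides is one third of the first square, the angular gradient square,
  -- (A₁ + 2γ)⟨U₂,U₂⟩, a nonnegative multiple of -⟨U₁,LU₁⟩, and (8/3)⟨LU₁,LU₁⟩.
  linarith

end Sign

/-! ### Admissible parameters -/

section Parameters

variable {e q : ℝ}

/-- From q > e + 2 the right side exceeds 24 + 24e, and e < 12 puts (4 + e)² below that. -/
theorem sq_le_of_le_fourteen (he : 0 < e) (heq : e < q - 2) (hq : q ≤ 14) :
    (4 + e) ^ 2 ≤ 6 * (q ^ 2 - e ^ 2) := by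
  nlinarith

/-- The bound 22e ≤ e² + 121 absorbs the linear term; a fraction of `h` then controls e², and q ≥
29/2 pays for the constants. -/
theorem sq_le_of_ten_sq_lt (heq : e < q - 2) (h : 10 * e ^ 2 < 6 * q ^ 2 + 16) (hq : 29 / 2 ≤ q) :
    (4 + e) ^ 2 ≤ 6 * (q ^ 2 - e ^ 2) := by
  nlinarith [sq_nonneg (e - 11)]

/-- The inequalities confine e to 7 ≤ e < 12. There the left side is at most (4(6e - 10))², and the
single term 48(4 + 2e)(q² - e²) already dominates it; the other terms are nonnegative. -/
theorem sq_lt_of_le_fourteen (he : 0 < e) (heq : e < q - 2) (hq : q ≤ 14)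
    (h : 6 * q ^ 2 + 16 ≤ 10 * e ^ 2) :
    (10 * e ^ 2 - 6 * q ^ 2 - 16) ^ 2 <
      12 * ((q ^ 2 - (2 + e) ^ 2) ^ 2 + 2 * (q ^ 2 - (2 + e) ^ 2) * (q ^ 2 - e ^ 2)
        + 4 * ((4 + 2 * e) * (q ^ 2 - e ^ 2) + 2 * e * (q ^ 2 - (2 + e) ^ 2))) := by
  have h1 : 0 < q ^ 2 - (2 + e) ^ 2 := by nlinarith
  have h2 : 4 + 4 * e ≤ q ^ 2 - e ^ 2 := by nlinarith
  have h4 : e < 12 := by linarith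
  have hlow : 7 ≤ e := by nlinarith
  have h3 : 10 * e ^ 2 - 6 * q ^ 2 - 16 ≤ 4 * (6 * e - 10) := by nlinarith
  have h6 : (10 * e ^ 2 - 6 * q ^ 2 - 16) ^ 2 ≤ (4 * (6 * e - 10)) ^ 2 :=
    pow_le_pow_left₀ (by linarith) h3 2
  have h5 : (4 + 2 * e) * (4 + 4 * e) ≤ (4 + 2 * e) * (q ^ 2 - e ^ 2) :=
    mul_le_mul_of_nonneg_left h2 (by linarith)
  have h7 : (4 * (6 * e - 10)) ^ 2 < 48 * ((4 + 2 * e) * (4 + 4 * e)) := by nlinarith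
  have h8 : 0 < (q ^ 2 - (2 + e) ^ 2) * (q ^ 2 - e ^ 2) := mul_pos h1 (by linarith)
  have h9 : 0 < e * (q ^ 2 - (2 + e) ^ 2) := mul_pos he h1
  nlinarith [sq_nonneg (q ^ 2 - (2 + e) ^ 2)]

/-- A parameter `γ` for which the quadratic form in `hasDerivAt_modifiedEnergy` is coercive. -/
theorem exists_parameter (he : 0 < e) (heq : e < q - 2)
    (h : q ≤ 14 ∨ 29 / 2 ≤ q ∧ 10 * e ^ 2 < 6 * q ^ 2 + 16) :
    ∃ γ : ℝ, 0 ≤ 6 * q ^ 2 + 16 - 10 * e ^ 2 + 2 * γ ∧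
      (4 + e) ^ 2 ≤ 6 * (q ^ 2 - e ^ 2) + 2 * γ / 3 ∧
      γ ^ 2 < 3 * ((q ^ 2 - (2 + e) ^ 2) ^ 2 + 2 * (q ^ 2 - (2 + e) ^ 2) * (q ^ 2 - e ^ 2)
        + 4 * ((4 + 2 * e) * (q ^ 2 - e ^ 2) + 2 * e * (q ^ 2 - (2 + e) ^ 2))) := by
  have hA₂ : (4 + e) ^ 2 ≤ 6 * (q ^ 2 - e ^ 2) := h.elim (sq_le_of_le_fourteen he heq)
    fun h => sq_le_of_ten_sq_lt heq h.2 h.1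
  by_cases hA : 10 * e ^ 2 ≤ 6 * q ^ 2 + 16
  · refine ⟨0, by linarith, by linarith, ?_⟩
    have h1 : 0 < q ^ 2 - (2 + e) ^ 2 := by nlinarith
    have h2 : 0 < q ^ 2 - e ^ 2 := by nlinarith
    rw [zero_pow two_ne_zero]
    positivity
  · push Not at hA
    have hq : q ≤ 14 := h.elim id fun h => absurd h.2 (by linarith)
    -- The least γ allowed by the first condition, which becomes an equality.
    refine ⟨(10 * e ^ 2 - 6 * q ^ 2 - 16) / 2, by linarith, by linarith, ?_⟩
    have := sq_lt_of_le_fourteen he heq hq hA.le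
    linarith [div_pow (10 * e ^ 2 - 6 * q ^ 2 - 16) 2 2]

end Parameters

/-! ### The exponents -/

section Exponents

theorem sqrt_lt_of_thirty_one_le {N : ℝ} (hN : 31 ≤ N) :
    √(15 * N ^ 2 - 60 * N + 190) < 5 * N - 30 := by
  rw [Real.sqrt_lt' (by linarith)]
  nlinarith

theorem kExp_pos {p : ℝ} (hp : 1 < p) : 0 < kExp p := div_pos (by norm_num) (by linarith)

theorem one_lt_of_supercritical {n : ℕ} {p : ℝ} (hn : 6 < n)
    (hp : ((n : ℝ) + 6) / ((n : ℝ) - 6) < p) : 1 < p := by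
  have hn' : (6 : ℝ) < n := by exact_mod_cast hn
  refine lt_trans ?_ hp
  rw [lt_div_iff₀ (by linarith)]
  linarith

theorem kExp_lt_of_supercritical {n : ℕ} {p : ℝ} (hn : 6 < n)
    (hp : ((n : ℝ) + 6) / ((n : ℝ) - 6) < p) : kExp p < ((n : ℝ) - 6) / 2 := by
  have hn' : (6 : ℝ) < n := by exact_mod_cast hn
  have h1 := one_lt_of_supercritical hn hp
  rw [div_lt_iff₀ (by linarith)] at hp
  rw [kExp, div_lt_iff₀ (by linarith)]
  linarith

/-- Solving p < p_m for k gives k > (5n - 30 - S)/10, where S is the square root in p_m. Hence e <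
S/10 and 10e² < S²/10 = 6q² + 13. -/
theorem sq_lt_of_lt_pM {n : ℕ} {p : ℝ} (hn : 30 < n)
    (hp : ((n : ℝ) + 6) / ((n : ℝ) - 6) < p) (hpM : (p : EReal) < pM n) :
    10 * (((n : ℝ) - 6) / 2 - kExp p) ^ 2 < 6 * (((n : ℝ) - 2) / 2) ^ 2 + 16 := by
  have hN : (31 : ℝ) ≤ n := by exact_mod_cast hn
  have h1 := one_lt_of_supercritical (by omega) hp
  have hk := kExp_lt_of_supercritical (by omega) hp
  rw [pM, if_neg (by omega), EReal.coe_lt_coe_iff] at hpM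
  have hS := sqrt_lt_of_thirty_one_le hN
  have hS2 := Real.sq_sqrt (show (0 : ℝ) ≤ 15 * n ^ 2 - 60 * n + 190 by nlinarith)
  set S := √(15 * (n : ℝ) ^ 2 - 60 * n + 190)
  rw [lt_div_iff₀ (by linarith)] at hpM
  have hlow : (5 * n - 30 - S) / 10 < kExp p := by
    rw [kExp, lt_div_iff₀ (by linarith)]
    linarith
  have he : (((n : ℝ) - 6) / 2 - kExp p) ^ 2 < (S / 10) ^ 2 :=
    pow_lt_pow_left₀ (by linarith) (by linarith) two_ne_zero
  nlinarith

/-- The two conjugate radicands -(d₁ ± 36√d₂) of Cardano's formula multiply to a perfect cube. -/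
theorem d₁_sq_sub (N : ℝ) : d₁ N ^ 2 - 1296 * d₂ N = (1024 + 768 * N ^ 2) ^ 3 := by
  rw [d₁, d₂]; ring

theorem d₁_neg {N : ℝ} (hN : 31 ≤ N) : d₁ N < 0 := by
  -- In the variable m = N - 31 all coefficients have one sign.
  obtain ⟨m, hm, rfl⟩ : ∃ m, 0 ≤ m ∧ N = m + 31 := ⟨N - 31, by linarith, by ring⟩
  rw [← neg_pos, d₁]
  ring_nf
  positivity

theorem d₂_nonneg {N : ℝ} (hN : 31 ≤ N) : 0 ≤ d₂ N := by
  obtain ⟨m, hm, rfl⟩ : ∃ m, 0 ≤ m ∧ N = m + 31 := ⟨N - 31, by linarith, by ring⟩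
  rw [d₂]
  ring_nf
  positivity

theorem d₁_add_neg {N : ℝ} (hN : 31 ≤ N) : d₁ N + 36 * √(d₂ N) < 0 := by
  have h := d₁_sq_sub N
  have h1 := d₁_neg hN
  have hs := Real.sq_sqrt (d₂_nonneg hN)
  have h0 := Real.sqrt_nonneg (d₂ N)
  have hM : 0 < (1024 + 768 * N ^ 2) ^ 3 := by positivity
  by_contra! hc
  nlinarith

theorem d₀_spec {N : ℝ} (hN : 31 ≤ N) :
    0 < d₀ N ∧ d₀ N ^ 3 = -(d₁ N + 36 * √(d₂ N)) := by
  have h := d₁_add_neg hN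
  have hd : d₀ N = (-(d₁ N + 36 * √(d₂ N))) ^ (1 / 3 : ℝ) := by
    rw [d₀, cbrt, sign_neg h, abs_of_neg h]
    simp
  have hpos : 0 < -(d₁ N + 36 * √(d₂ N)) := by linarith
  rw [hd]
  refine ⟨Real.rpow_pos_of_pos hpos _, ?_⟩
  rw [← Real.rpow_natCast, ← Real.rpow_mul hpos.le]
  norm_num

/-- `3 / 2 * d₀ + (1536 + 1152 N²) / d₀` is a root of a depressed cubic. -/
theorem cubic_eq {N σ : ℝ} (hN : 31 ≤ N)
    (hσ : σ = 3 / 2 * d₀ N + (1536 + 1152 * N ^ 2) / d₀ N) :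
    σ ^ 3 - 9 / 2 * (1536 + 1152 * N ^ 2) * σ + 27 / 4 * d₁ N = 0 := by
  obtain ⟨hpos, h3⟩ := d₀_spec hN
  have hne := hpos.ne'
  have hd := d₁_sq_sub N
  have hs := Real.sq_sqrt (d₂_nonneg hN)
  set r := √(d₂ N)
  -- By `d₁_sq_sub` the second summand is 3/2 times the cube root of the conjugate radicand.
  have hP : ((1536 + 1152 * N ^ 2) / d₀ N) ^ 3 = -(27 / 8) * (d₁ N - 36 * r) := by
    rw [div_pow, h3, div_eq_iff (by linarith [d₁_add_neg hN])]
    linear_combination (-27 / 8) * hd + (27 / 8) * 1296 * hs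
  have hmul : d₀ N * ((1536 + 1152 * N ^ 2) / d₀ N) = 1536 + 1152 * N ^ 2 := by
    field_simp
  rw [hσ]
  linear_combination (27 / 8) * h3 + hP +
    (9 / 2 * (3 / 2 * d₀ N + (1536 + 1152 * N ^ 2) / d₀ N)) * hmul

/-- The threshold τ on the left corresponds to d = 7N/20 - 1, and the cubic of `cubic_eq` is
negative there. With P = 1536 + 1152N², the arithmetic–geometric mean inequality gives σ² ≥ 6P for
the root σ, beyond the turning points, so the cubic is nonnegative on [σ, ∞) and τ must lie below σ.
-/
theorem lt_cubic_root {N : ℝ} (hN : 31 ≤ N) :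
    9 * N ^ 2 + 96 - 36 * (7 / 20 * N - 1) ^ 2 <
      3 / 2 * d₀ N + (1536 + 1152 * N ^ 2) / d₀ N := by
  obtain ⟨hpos, -⟩ := d₀_spec hN
  have hP : 0 < 1536 + 1152 * N ^ 2 := by positivity
  have hdiv := div_pos hP hpos
  have hmul : d₀ N * ((1536 + 1152 * N ^ 2) / d₀ N) = 1536 + 1152 * N ^ 2 := by
    field_simp
  have hroot := cubic_eq hN rfl
  set σ := 3 / 2 * d₀ N + (1536 + 1152 * N ^ 2) / d₀ N with hσ
  have hσ0 : 0 < σ := by positivity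
  have hσ2 : 6 * (1536 + 1152 * N ^ 2) ≤ σ ^ 2 := by
    nlinarith [sq_nonneg (3 / 2 * d₀ N - (1536 + 1152 * N ^ 2) / d₀ N)]
  set τ := 9 * N ^ 2 + 96 - 36 * (7 / 20 * N - 1) ^ 2 with hτ
  have hf : τ ^ 3 - 9 / 2 * (1536 + 1152 * N ^ 2) * τ + 27 / 4 * d₁ N < 0 := by
    obtain ⟨m, hm, rfl⟩ : ∃ m, 0 ≤ m ∧ N = m + 31 := ⟨N - 31, by linarith, by ring⟩
    rw [← neg_pos, hτ, d₁]
    ring_nf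
    positivity
  by_contra! hc
  have : 0 ≤ (τ - σ) * (τ ^ 2 + τ * σ + σ ^ 2 - 9 / 2 * (1536 + 1152 * N ^ 2)) := by
    refine mul_nonneg (by linarith) ?_
    nlinarith [mul_nonneg (hσ0.le.trans hc) hσ0.le, sq_nonneg τ]
  nlinarith

theorem d_lt {N : ℝ} (hN : 31 ≤ N) : d N < 7 / 20 * N - 1 := by
  have h := lt_cubic_root hN
  have hs : √(9 * N ^ 2 + 96 - (1536 + 1152 * N ^ 2) / d₀ N - 3 / 2 * d₀ N) <
      6 * (7 / 20 * N - 1) := by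
    rw [Real.sqrt_lt' (by linarith)]
    linarith
  rw [d]
  linarith

/-- For n ≥ 31, p_c = 1 + 12/(n - 8 - 2d) and p_m = 1 + 12/(n - 6 - S/5) with S the square root in
p_m, so the claim is d < S/10 - 1. This follows from S ≥ 7n/2 and `d_lt`. -/
theorem pC_lt_pM {n : ℕ} (hn : 15 ≤ n) : pC n < pM n := by
  rw [pC, if_neg (by omega)]
  by_cases h30 : n ≤ 30
  · rw [pM, if_pos h30]
    exact EReal.coe_lt_top _
  rw [pM, if_neg h30, EReal.coe_lt_coe_iff]
  have hN : (31 : ℝ) ≤ n := by exact_mod_cast (by omega : 31 ≤ n)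
  have hS := sqrt_lt_of_thirty_one_le hN
  have hS' : 7 / 2 * (n : ℝ) ≤ √(15 * n ^ 2 - 60 * n + 190) :=
    Real.le_sqrt_of_sq_le (by nlinarith)
  have hd := d_lt hN
  set S := √(15 * (n : ℝ) ^ 2 - 60 * n + 190)
  have hden : 0 < n - 8 - 2 * d n := by linarith
  rw [div_lt_div_iff₀ hden (by linarith)]
  linarith

end Exponents

/-! ### Monotonicity -/

section Monotonicity

variable {n : ℕ} {p : ℝ}

theorem rpow_mul_surfaceIntegral_jet [NeZero n] (x : EuclideanSpace ℝ (Fin n))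
    {u : EuclideanSpace ℝ (Fin n) → ℝ} (hp : 1 < p) (hu : ContDiff ℝ 6 u) {t : ℝ} (ht : 0 < t) :
    t ^ (6 * (p + 1) / (p - 1) - 6 - n) *
        surfaceIntegral x t (fun y => (6 / (p - 1) * u y + t * radialDeriv x u y) ^ 2) =
      t⁻¹ * pairing (kExp p) x t (scalingJet (kExp p) x u 1) (scalingJet (kExp p) x u 1) := by
  rw [exponent_eq hp, add_sub_cancel_right, rpow_mul_surfaceIntegral x _ ht, pairing_apply]
  congr 2
  refine sphereIntegral_congr x ht fun y hy => ?_
  rw [← (jets_eq (p := p) x hu ht hy).1, pow_two]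
  rfl

theorem exists_le_deriv_modifiedEnergy (hn : 6 < n) (hp : ((n : ℝ) + 6) / ((n : ℝ) - 6) < p)
    (hpM : (p : EReal) < pM n) :
    ∃ (c : Fin 3 → Fin 3 → ℝ) (C : ℝ), 0 < C ∧
      ∀ (u : EuclideanSpace ℝ (Fin n) → ℝ), IsSolution n p u →
      ∀ (x : EuclideanSpace ℝ (Fin n)) (t : ℝ), 0 < t →
        DifferentiableAt ℝ (fun s => modifiedEnergy p x u s c) t ∧
        C * t ^ (6 * (p + 1) / (p - 1) - 6 - n) *
            surfaceIntegral x t (fun y => (6 / (p - 1) * u y + t * radialDeriv x u y) ^ 2)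
          ≤ deriv (fun s => modifiedEnergy p x u s c) t := by
  have : NeZero n := ⟨by omega⟩
  have hp1 := one_lt_of_supercritical hn hp
  have hk0 := kExp_pos hp1
  have hk := kExp_lt_of_supercritical hn hp
  -- In these variables a = 2e + 4, a' = 2e, b = (2 + e)² - q² and b' = e² - q²; the bound n ≤ 30 is
  -- q ≤ 14.
  obtain ⟨γ, h₁, h₂, h₃⟩ := exists_parameter (e := ((n : ℝ) - 6) / 2 - kExp p)
    (q := ((n : ℝ) - 2) / 2) (by linarith) (by linarith) (by
      rcases le_or_gt n 30 with h30 | h30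
      · have : (n : ℝ) ≤ 30 := by exact_mod_cast h30
        exact Or.inl (by linarith)
      · have : (31 : ℝ) ≤ n := by exact_mod_cast h30
        exact Or.inr ⟨by linarith, sq_lt_of_lt_pM h30 hp hpM⟩)
  obtain ⟨a, ha⟩ : ∃ a, a = (n : ℝ) - 2 - 2 * kExp p := ⟨_, rfl⟩
  obtain ⟨b, hb⟩ : ∃ b, b = kExp p * (kExp p + 2 - n) := ⟨_, rfl⟩
  obtain ⟨a', ha'⟩ : ∃ a', a' = (n : ℝ) - 6 - 2 * kExp p := ⟨_, rfl⟩
  obtain ⟨b', hb'⟩ : ∃ b', b' = (kExp p + 2) * (kExp p + 4 - n) := ⟨_, rfl⟩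
  refine ⟨energyCoeff n p γ, b ^ 2 + 2 * b * b' - 4 * (a * b' + a' * b) - γ ^ 2 / 3, ?_,
    fun u hu x t ht => ?_⟩
  · refine lt_of_lt_of_eq (div_pos (sub_pos.2 h₃) (three_pos (α := ℝ))) ?_
    rw [ha, hb, ha', hb']
    ring
  · have h := hasDerivAt_modifiedEnergy x (by omega) hp1 hu γ ha hb ha' hb' ht
    refine ⟨h.differentiableAt, ?_⟩
    rw [h.deriv, mul_assoc, rpow_mul_surfaceIntegral_jet x hp1 hu.1 ht, mul_left_comm]
    refine mul_le_mul_of_nonneg_left (le_quadraticForm (kExp p) x hu.1 ht ?_ ?_) (by positivity)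
    · refine h₁.trans_eq ?_
      rw [ha, hb, ha', hb']
      ring
    · convert h₂ using 1
      · rw [ha]; ring
      · rw [ha, hb, ha', hb']; ring

end Monotonicity

end Triharmonic

end

theorem theorem2p2 :
    (∀ n : ℕ, 15 ≤ n → Triharmonic.pC n < Triharmonic.pM n) ∧
    ∀ (n : ℕ) (p : ℝ), 6 < n → ((n : ℝ) + 6) / ((n : ℝ) - 6) < p →
      (p : EReal) < Triharmonic.pM n →
      ∃ (c : Fin 3 → Fin 3 → ℝ) (C : ℝ), 0 < C ∧
        ∀ (u : EuclideanSpace ℝ (Fin n) → ℝ), Triharmonic.IsSolution n p u →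
        ∀ x : EuclideanSpace ℝ (Fin n),
          MonotoneOn (fun t => Triharmonic.modifiedEnergy p x u t c) (Set.Ioi 0) ∧
          ∀ t : ℝ, 0 < t →
            DifferentiableAt ℝ (fun s => Triharmonic.modifiedEnergy p x u s c) t ∧
            C * t ^ (6 * (p + 1) / (p - 1) - 6 - n) *
                Triharmonic.surfaceIntegral x t
                  (fun y => (6 / (p - 1) * u y + t * Triharmonic.radialDeriv x u y) ^ 2)
              ≤ deriv (fun s => Triharmonic.modifiedEnergy p x u s c) t := by
  refine ⟨fun n hn => Triharmonic.pC_lt_pM hn, fun n p hn hp hpM => ?_⟩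
  obtain ⟨c, C, hC, h⟩ := Triharmonic.exists_le_deriv_modifiedEnergy hn hp hpM
  refine ⟨c, C, hC, fun u hu x => ⟨?_, h u hu x⟩⟩
  refine monotoneOn_of_deriv_nonneg (convex_Ioi 0)
    (fun t ht => (h u hu x t ht).1.continuousAt.continuousWithinAt)
    (fun t ht => (h u hu x t (interior_subset ht)).1.differentiableWithinAt) fun t ht => ?_
  have ht' : 0 < t := interior_subset ht
  refine le_trans ?_ (h u hu x t ht').2
  have : 0 ≤ Triharmonic.surfaceIntegral x t
      (fun y => (6 / (p - 1) * u y + t * Triharmonic.radialDeriv x u y) ^ 2) :=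
    mul_nonneg (pow_nonneg ht'.le _) (MeasureTheory.integral_nonneg fun θ => sq_nonneg _)
  exact mul_nonneg (mul_nonneg hC.le (Real.rpow_nonneg ht'.le _)) this
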